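/- Let $N\ge 3$, $a>0$, $1<\gamma\le \frac N4+\frac12$, $\mu>0$, $\mu+\lambda>0$, and let $f\in [L^1_{\mathrm{loc}}(\mathbb R^N\times[0,\infty))]^N$ satisfy $\operatorname{div} f=0$ in the sense of distributions. Throughout, $L^p_{\mathrm{loc}}(0,\infty;X)$ denotes the functions that lie in $L^p(0,T;X)$ for every $T<\infty$, and $\dot H^1(\mathbb R^N)$ is the space of $u\in L^{2N/(N-2)}(\mathbb R^N)$ with weak gradient in $L^2$, normed by $\|\nabla u\|_{L^2}$. Consider the isentropic compressible Navier–Stokes system $$\partial_t\rho+\operatorname{div}(\rho v)=0,\qquad \partial_t(\rho v)+\operatorname{div}(\rho v\otimes v)=-\nabla p+\mu\Delta v+(\mu+\lambda)\nabla\operatorname{div}v+f,\qquad p=a\rho^\gamma$$ on $\mathbb R^N\times(0,\infty)$, with initial data satisfying $0\le\rho_0\in L^1_{\mathrm{loc}}(\mathbb R^N)$, $\rho_0v_0\in L^1_{\mathrm{loc}}(\mathbb R^N)$ and $\rho_0^\gamma+\rho_0|v_0|^2\in L^1(\mathbb R^N)$ (finite initial energy). A pair $(\rho,v)$ is a finite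 energy global weak solution with these data if (i) $0\le\rho\in L^1_{\mathrm{loc}}(\mathbb R^N\times(0,\infty))$, $\rho v\in L^1_{\mathrm{loc}}(\mathbb R^N\times(0,\infty))$, $\rho^\gamma+\rho|v|^2\in L^\infty_{\mathrm{loc}}(0,\infty;L^1(\mathbb R^N))$ and $v\in L^2_{\mathrm{loc}}(0,\infty;\dot H^1(\mathbb R^N))$; (ii) for all $\psi\in C_c^\infty(\mathbb R^N)$, $\phi\in[C_c^\infty(\mathbb R^N)]^N$ and $\xi\in C^1_c([0,\infty))$, $$\xi(0)\int\rho_0\psi\,dx+\int_0^\infty\!\!\int\rho\,\psi\,\xi'\,dx\,dt+\int_0^\infty\!\!\int\rho v\cdot\nabla\psi\,\xi\,dx\,dt=0,$$ $$\begin{aligned}&\xi(0)\int\rho_0v_0\cdot\phi\,dx+\int_0^\infty\!\!\int\rho v\cdot\phi\,\xi'\,dx\,dt+\int_0^\infty\!\!\int\rho\, v\otimes v:\nabla\phi\,\xi\,dx\,dt\\&\quad=-\int_0^\infty\!\!\int p\,\operatorname{div}\phi\,\xi\,dx\,dt-\mu\int_0^\infty\!\!\int v\cdot\Delta\phi\,\xi\,dx\,dt-(\mu+\lambda)\int_0^\infty\!\!\int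 v\cdot\nabla\operatorname{div}\phi\,\xi\,dx\,dt-\int_0^\infty\!\!\int f\cdot\phi\,\xi\,dx\,dt;\end{aligned}$$ (iii) with $\mathcal E(t)=\int\big[\tfrac12\rho|v|^2+\tfrac{a\rho^\gamma}{\gamma-1}\big]dx$, the energy inequality $$\frac{d}{dt}\mathcal E(t)+\int\big(\mu|\nabla v|^2+(\mu+\lambda)|\operatorname{div}v|^2\big)dx\le0$$ holds in the sense of distributions on $(0,\infty)$. Suppose moreover that $$\int_{\mathbb R^N}\rho_0|v_0||x|\,dx<\infty,\qquad \int_{\mathbb R^N}\rho_0v_0\cdot x\,dx>0.$$ Then there is no finite energy global weak solution $(\rho,v)$ with initial data $(\rho_0,v_0)$ such that $$\rho|x|^2\in L^1_{\mathrm{loc}}(0,\infty;L^1(\mathbb R^N)),\qquad v\in L^1_{\mathrm{loc}}(0,\infty;L^{\frac N{N-1}}(\mathbb R^N)).$$ -/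

import Mathlib

open MeasureTheory Set
open scoped ENNReal ContDiff

noncomputable section

namespace CompressibleNS

/-- The Euclidean space `ℝᴺ`. -/
abbrev Space (N : ℕ) : Type := EuclideanSpace ℝ (Fin N)

/-- `N × N` real matrices with the Frobenius (Euclidean) norm; the entry `(i, j)` of a velocity
gradient is `∂ⱼ vᵢ`. -/
abbrev Grad (N : ℕ) : Type := EuclideanSpace ℝ (Fin N × Fin N)

/-- Smooth compactly supported maps `C_c^∞`. -/
def IsTest {E F : Type*} [NormedAddCommGroup E] [NormedSpace ℝ E]
    [NormedAddCommGroup F] [NormedSpace ℝ F] (ψ : E → F) : Prop :=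
  ContDiff ℝ ∞ ψ ∧ HasCompactSupport ψ

/-- `C¹` functions of time with compact support in `[0, ∞)` (a compactly supported `C¹` function
on the half-line is the restriction of one on `ℝ`; only its values on `[0, ∞)` are used). -/
def IsTimeTest (ξ : ℝ → ℝ) : Prop :=
  ContDiff ℝ 1 ξ ∧ HasCompactSupport ξ

/-- Smooth functions of time with compact support in the open half-line `(0, ∞)`. -/
def IsInteriorTimeTest (ξ : ℝ → ℝ) : Prop :=
  IsTest ξ ∧ tsupport ξ ⊆ Ioi 0

/-- The classical divergence of a vector field on `ℝᴺ`. -/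
def divergence {N : ℕ} (φ : Space N → Space N) (x : Space N) : ℝ :=
  ∑ i : Fin N, fderiv ℝ φ x (EuclideanSpace.single i 1) i

/-- `G` is the weak gradient of the vector field `u`: `G = (∂ⱼ uᵢ)` in the sense of
distributions on `ℝᴺ`. -/
def HasWeakGradient {N : ℕ} (u : Space N → Space N) (G : Space N → Grad N) : Prop :=
  LocallyIntegrable u ∧ LocallyIntegrable G ∧
    ∀ ψ : Space N → ℝ, IsTest ψ → ∀ i j : Fin N,
      ∫ x, u x i * fderiv ℝ ψ x (EuclideanSpace.single j 1) = - ∫ x, G x (i, j) * ψ x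

/-- `g ∈ L^p(0, T; L^q(ℝᴺ))` for every `T < ∞`. -/
def MemLpLqLoc {N : ℕ} {F : Type*} [NormedAddCommGroup F] (p q : ℝ≥0∞)
    (g : ℝ → Space N → F) : Prop :=
  ∀ T : ℝ, 0 < T →
    AEStronglyMeasurable (fun z : ℝ × Space N => g z.1 z.2)
      ((volume.restrict (Ioo 0 T)).prod volume) ∧
    eLpNorm (fun t : ℝ => eLpNorm (g t) q volume) p (volume.restrict (Ioo 0 T)) < ⊤

/-- `v ∈ L²(0, T; Ḣ¹(ℝᴺ))` for every `T < ∞`, with spatial weak gradient `G`.  For `N ≥ 3` the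
homogeneous Sobolev space `Ḣ¹(ℝᴺ)` (the completion of `C_c^∞` in the Dirichlet norm) consists of
the `u ∈ L^{2N/(N-2)}` whose weak gradient is in `L²`; its norm is the `L²` norm of the
gradient. -/
def MemL2HDotLoc {N : ℕ} (v : ℝ → Space N → Space N) (G : ℝ → Space N → Grad N) : Prop :=
  AEStronglyMeasurable (fun z : ℝ × Space N => v z.1 z.2)
    ((volume.restrict (Ioi 0)).prod volume) ∧
  (∀ᵐ t ∂(volume.restrict (Ioi (0 : ℝ))),
    MemLp (v t) ((2 * N : ℝ≥0∞) / (N - 2 : ℝ≥0∞)) volume ∧ HasWeakGradient (v t) (G t)) ∧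
  MemLpLqLoc 2 2 G

/-- The pressure law `p(ρ) = a ρ^γ`. -/
def pressure (a γ r : ℝ) : ℝ := a * r ^ γ

/-- The energy `𝓔 = ∫ (½ ρ|v|² + a ρ^γ / (γ - 1)) dx` of a density and a velocity field at a
fixed time. -/
def energy {N : ℕ} (a γ : ℝ) (r : Space N → ℝ) (u : Space N → Space N) : ℝ :=
  ∫ x, (1 / 2 * r x * ‖u x‖ ^ 2 + pressure a γ (r x) / (γ - 1))

/-- The dissipation `∫ (μ |∇v|² + (μ + λ) |div v|²) dx` in terms of the gradient `G = ∇v`. -/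
def dissipation {N : ℕ} (μ lam : ℝ) (G : Space N → Grad N) : ℝ :=
  ∫ x, (μ * ‖G x‖ ^ 2 + (μ + lam) * (∑ i : Fin N, G x (i, i)) ^ 2)

/-- The energy inequality `d𝓔/dt + ∫ (μ |∇v|² + (μ + λ) |div v|²) dx ≤ 0` on `(0, ∞)`, with the
time derivative taken in the sense of distributions. -/
def EnergyInequality {N : ℕ} (a γ μ lam : ℝ) (ρ : ℝ → Space N → ℝ) (v : ℝ → Space N → Space N)
    (G : ℝ → Space N → Grad N) : Prop :=
  ∀ ξ : ℝ → ℝ, IsInteriorTimeTest ξ → (∀ t, 0 ≤ ξ t) →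
    - (∫ t in Ioi (0 : ℝ), energy a γ (ρ t) (v t) * deriv ξ t)
      + ∫ t in Ioi (0 : ℝ), dissipation μ lam (G t) * ξ t ≤ 0

/-- `div f = 0` in the sense of distributions on `ℝᴺ × (0, ∞)`. -/
def DivergenceFree {N : ℕ} (f : ℝ → Space N → Space N) : Prop :=
  ∀ ψ : Space N → ℝ, IsTest ψ → ∀ ξ : ℝ → ℝ, IsInteriorTimeTest ξ →
    ∫ t in Ioi (0 : ℝ), ∫ x, inner ℝ (f t x) (gradient ψ x) * ξ t = 0

/-- Admissible initial data (which in particular have finite energy): `0 ≤ ρ₀ ∈ L¹_loc`,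
`ρ₀ v₀ ∈ L¹_loc`, `ρ₀^γ + ρ₀ |v₀|² ∈ L¹`. -/
structure IsInitialData {N : ℕ} (γ : ℝ) (ρ₀ : Space N → ℝ) (v₀ : Space N → Space N) : Prop where
  nonneg : ∀ᵐ x, 0 ≤ ρ₀ x
  density : LocallyIntegrable ρ₀
  momentum : LocallyIntegrable (fun x => ρ₀ x • v₀ x)
  internal : Integrable (fun x => ρ₀ x ^ γ)
  kinetic : Integrable (fun x => ρ₀ x * ‖v₀ x‖ ^ 2)

/-- The continuity equation `∂ₜρ + div(ρv) = 0`, `ρ(0) = ρ₀`, in weak form. -/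
def ContinuityEquation {N : ℕ} (ρ₀ : Space N → ℝ)
    (ρ : ℝ → Space N → ℝ) (v : ℝ → Space N → Space N) : Prop :=
  ∀ ψ : Space N → ℝ, IsTest ψ → ∀ ξ : ℝ → ℝ, IsTimeTest ξ →
    ξ 0 * (∫ x, ρ₀ x * ψ x)
      + (∫ t in Ioi (0 : ℝ), ∫ x, ρ t x * ψ x * deriv ξ t)
      + (∫ t in Ioi (0 : ℝ), ∫ x, ρ t x * inner ℝ (v t x) (gradient ψ x) * ξ t) = 0

/-- The momentum equation
`∂ₜ(ρv) + div(ρ v ⊗ v) = -∇p(ρ) + μ Δv + (μ + λ) ∇div v + f`, `(ρv)(0) = ρ₀v₀`, in weak form. -/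
def MomentumEquation {N : ℕ} (a γ μ lam : ℝ) (f : ℝ → Space N → Space N)
    (ρ₀ : Space N → ℝ) (v₀ : Space N → Space N)
    (ρ : ℝ → Space N → ℝ) (v : ℝ → Space N → Space N) : Prop :=
  ∀ φ : Space N → Space N, IsTest φ → ∀ ξ : ℝ → ℝ, IsTimeTest ξ →
    ξ 0 * (∫ x, ρ₀ x * inner ℝ (v₀ x) (φ x))
      + (∫ t in Ioi (0 : ℝ), ∫ x, ρ t x * inner ℝ (v t x) (φ x) * deriv ξ t)
      + (∫ t in Ioi (0 : ℝ), ∫ x, ρ t x * inner ℝ (v t x) (fderiv ℝ φ x (v t x)) * ξ t)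
    = - (∫ t in Ioi (0 : ℝ), ∫ x, pressure a γ (ρ t x) * divergence φ x * ξ t)
      - μ * (∫ t in Ioi (0 : ℝ), ∫ x, inner ℝ (v t x) (Laplacian.laplacian φ x) * ξ t)
      - (μ + lam) *
          (∫ t in Ioi (0 : ℝ), ∫ x, inner ℝ (v t x) (gradient (divergence φ) x) * ξ t)
      - (∫ t in Ioi (0 : ℝ), ∫ x, inner ℝ (f t x) (φ x) * ξ t)

/-- `(ρ, v)` is a finite energy global weak solution of the isentropic compressible
Navier-Stokes system with force `f` and initial data `(ρ₀, v₀)`. -/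
structure IsFiniteEnergyWeakSolution {N : ℕ} (a γ μ lam : ℝ) (f : ℝ → Space N → Space N)
    (ρ₀ : Space N → ℝ) (v₀ : Space N → Space N)
    (ρ : ℝ → Space N → ℝ) (v : ℝ → Space N → Space N) : Prop where
  nonneg : ∀ᵐ z ∂((volume.restrict (Ioi (0 : ℝ))).prod (volume : Measure (Space N))),
    0 ≤ ρ z.1 z.2
  density : LocallyIntegrableOn (fun z : ℝ × Space N => ρ z.1 z.2) (Ioi 0 ×ˢ univ)
  momentum : LocallyIntegrableOn (fun z : ℝ × Space N => ρ z.1 z.2 • v z.1 z.2) (Ioi 0 ×ˢ univ)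
  internal : MemLpLqLoc ∞ 1 (fun t x => ρ t x ^ γ)
  kinetic : MemLpLqLoc ∞ 1 (fun t x => ρ t x * ‖v t x‖ ^ 2)
  continuity : ContinuityEquation ρ₀ ρ v
  momentumEq : MomentumEquation a γ μ lam f ρ₀ v₀ ρ v
  viscous : ∃ G : ℝ → Space N → Grad N,
    MemL2HDotLoc v G ∧ EnergyInequality a γ μ lam ρ v G

end CompressibleNS

end

noncomputable section

namespace CompressibleNS

open Filter
open scoped NNReal Topology Convolution

/-! A solution of positive mass in this class must disperse at linear speed. Such dispersal keeps
`‖∇v‖₂` bounded below for all large times, whereas the energy inequality allows only a finite total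
dissipation.

Virial estimate. Put I = ∫ρ|x|²/2, J = ∫ρv·x, and let E be the energy. Continuity gives I' = J, and
testing the momentum equation with the field x gives J' = ∫ρ|v|² + N∫p (`virial_identity`). The
field x is approximated by nφ(x/n) with φ a compactly supported gradient equal to x near 0. Being
gradients, these fields do not see f. Their second derivatives are bounded in L^N and live in |x| ≥
n, so v ∈ L^{N/(N-1)} makes the viscous terms vanish in the limit. The functional H = I - tJ + t²E =
½∫ρ|x-tv|² + t²∫aρ^γ/(γ-1) then satisfies H' ≤ (2-σ)H/t with σ = min(2, N(γ-1)) (`virial_growth`).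
Hence ∫ρ|x-tv|² = O(t^{2-σ}) and ∫ρ^γ = O(t^{-σ}) (`exists_virial_decay`).

Linear spreading. For M = ∫ρ⟨x⟩ the first decay yields M - tM' ≤ Ct^{1-σ/2}, so M/t can drop by at
most O(s^{-σ/2}) after time s (`first_moment_growth`). The second decay and conservation of mass
make M(s) exceed any multiple of s^{1-σ/2} for large s (`eventually_lt_first_moment`). Together
these give M ≥ ct (`exists_first_moment_ge`). The condition ∫ρ₀v₀·x > 0 enters by making ρ₀ nonzero,
so that the mass is positive (`mass_pos`).

Contradiction. Where ρ ≤ 1, |x| ≤ |x-tv| + t|v|, and ∫ρ|v| over this set is at most a constant times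
‖∇v‖₂, by Hölder and Sobolev (`exists_integral_lowPart_le`). Where ρ > 1, the decay of ∫ρ^γ and
∫ρ|x|² = O(t²) give a contribution o(t). Thus ct ≤ o(t) + At‖∇v‖₂ (`exists_dissipation_ge`), against
`dissipation_bound`. -/

/-! ### Mollification in L² and weak partial derivatives. -/

/-- Jensen's inequality for the square, against a density of total mass one. -/
theorem sq_lintegral_mul_le {α : Type*} [MeasurableSpace α] {μ : Measure α} {w g : α → ℝ≥0∞}
    (hw : AEMeasurable w μ) (hg : AEMeasurable g μ) (h1 : ∫⁻ y, w y ∂μ = 1) :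
    (∫⁻ y, w y * g y ∂μ) ^ (2 : ℝ) ≤ ∫⁻ y, w y * g y ^ (2 : ℝ) ∂μ := by
  have h2 : Real.HolderConjugate 2 2 := Real.HolderConjugate.two_two
  have key := ENNReal.lintegral_mul_le_Lp_mul_Lq μ h2 (f := fun y => w y ^ (1 / 2 : ℝ))
    (g := fun y => w y ^ (1 / 2 : ℝ) * g y) (hw.pow_const _) ((hw.pow_const _).mul hg)
  have e1 : ∀ y, w y ^ (1 / 2 : ℝ) * (w y ^ (1 / 2 : ℝ) * g y) = w y * g y := fun y => by
    rw [← mul_assoc, ← ENNReal.rpow_add_of_nonneg _ _ (by norm_num) (by norm_num)]; norm_num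
  have e2 : ∀ y, (w y ^ (1 / 2 : ℝ)) ^ (2 : ℝ) = w y := fun y => by
    rw [← ENNReal.rpow_mul]; norm_num
  have e3 : ∀ y, (w y ^ (1 / 2 : ℝ) * g y) ^ (2 : ℝ) = w y * g y ^ (2 : ℝ) := fun y => by
    rw [ENNReal.mul_rpow_of_nonneg _ _ (by norm_num), e2]
  simp only [Pi.mul_apply, e1, e2, e3, h1, ENNReal.one_rpow, one_mul] at key
  calc (∫⁻ y, w y * g y ∂μ) ^ (2 : ℝ)
      ≤ ((∫⁻ y, w y * g y ^ (2 : ℝ) ∂μ) ^ (1 / 2 : ℝ)) ^ (2 : ℝ) := by gcongr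
    _ = _ := by rw [← ENNReal.rpow_mul]; norm_num

/-- Mollification does not increase the `L²` norm. -/
theorem eLpNorm_two_convolution_le {N : ℕ} {φ g : Space N → ℝ} (hφ : Continuous φ)
    (h0 : ∀ x, 0 ≤ φ x) (hi : Integrable φ) (h1 : ∫ x, φ x = 1)
    (hg : AEStronglyMeasurable g volume) :
    eLpNorm (fun x => ∫ y, φ (x - y) * g y) 2 volume ≤ eLpNorm g 2 volume := by
  have hφ1 : ∫⁻ x, ‖φ x‖ₑ = 1 := by
    rw [← ofReal_integral_norm_eq_lintegral_enorm hi]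
    simp [Real.norm_of_nonneg (h0 _), h1]
  rw [eLpNorm_eq_lintegral_rpow_enorm_toReal (by norm_num) (by norm_num),
    eLpNorm_eq_lintegral_rpow_enorm_toReal (by norm_num) (by norm_num)]
  simp only [ENNReal.toReal_ofNat]
  gcongr 1
  have hpt : ∀ x, ‖∫ y, φ (x - y) * g y‖ₑ ^ (2 : ℝ) ≤ ∫⁻ y, ‖φ (x - y)‖ₑ * ‖g y‖ₑ ^ (2 : ℝ) := by
    intro x
    calc ‖∫ y, φ (x - y) * g y‖ₑ ^ (2 : ℝ)
        ≤ (∫⁻ y, ‖φ (x - y)‖ₑ * ‖g y‖ₑ) ^ (2 : ℝ) := by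
          gcongr
          refine (enorm_integral_le_lintegral_enorm _).trans (le_of_eq ?_)
          simp
      _ ≤ _ := by
          apply sq_lintegral_mul_le
          · exact (by fun_prop : Continuous fun y => φ (x - y)).enorm.measurable.aemeasurable
          · exact hg.enorm
          · rw [lintegral_sub_left_eq_self (fun y => ‖φ y‖ₑ) x, hφ1]
  calc ∫⁻ x, ‖∫ y, φ (x - y) * g y‖ₑ ^ (2 : ℝ)
      ≤ ∫⁻ x, ∫⁻ y, ‖φ (x - y)‖ₑ * ‖g y‖ₑ ^ (2 : ℝ) := lintegral_mono hpt
    _ = ∫⁻ y, ∫⁻ x, ‖φ (x - y)‖ₑ * ‖g y‖ₑ ^ (2 : ℝ) := by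
        rw [lintegral_lintegral_swap]
        apply AEMeasurable.mul
        · exact (by fun_prop : Continuous fun z : Space N × Space N =>
            φ (z.1 - z.2)).enorm.measurable.aemeasurable
        · exact (hg.enorm.pow_const (2 : ℝ)).comp_quasiMeasurePreserving
            Measure.quasiMeasurePreserving_snd
    _ = ∫⁻ y, ‖g y‖ₑ ^ (2 : ℝ) := by
        congr 1 with y
        rw [lintegral_mul_const _
          (by fun_prop : Continuous fun x => φ (x - y)).enorm.measurable,
          lintegral_sub_right_eq_self (fun x => ‖φ x‖ₑ) y, hφ1, one_mul]

/-- `g j` is the weak partial derivative `∂ⱼ u` of the scalar function `u`. -/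
def HasWeakPartials {N : ℕ} (u : Space N → ℝ) (g : Fin N → Space N → ℝ) : Prop :=
  ∀ ψ : Space N → ℝ, IsTest ψ → ∀ j,
    ∫ x, u x * fderiv ℝ ψ x (EuclideanSpace.single j 1) = - ∫ x, g j x * ψ x

theorem norm_clm_le_sum {N : ℕ} (L : Space N →L[ℝ] ℝ) :
    ‖L‖ ≤ ∑ j, ‖L (EuclideanSpace.single j 1)‖ := by
  refine L.opNorm_le_bound (by positivity) fun x => ?_
  have hx : x = ∑ j, x j • EuclideanSpace.single j (1 : ℝ) := by
    ext k; simp [Finset.sum_apply, Pi.single_apply]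
  conv_lhs => rw [hx]
  rw [map_sum, Finset.sum_mul]
  refine (norm_sum_le _ _).trans (Finset.sum_le_sum fun j _ => ?_)
  rw [map_smul, norm_smul, mul_comm]
  gcongr
  exact PiLp.norm_apply_le x j

/-- The derivative falls on `φ`, and `y ↦ φ (x - y)` is itself a test function. The definition of
the weak partials moves the derivative onto `w`; its sign cancels the one from reflecting the
argument. -/
theorem fderiv_mollify {N : ℕ} {φ w : Space N → ℝ} {g : Fin N → Space N → ℝ} (hφ : IsTest φ)
    (hw : LocallyIntegrable w) (hwg : HasWeakPartials w g) (x : Space N) (j : Fin N) :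
    fderiv ℝ (φ ⋆[ContinuousLinearMap.lsmul ℝ ℝ, volume] w) x (EuclideanSpace.single j 1)
      = ∫ y, φ (x - y) * g j y := by
  have hd := hφ.2.hasFDerivAt_convolution_left (μ := volume) (ContinuousLinearMap.lsmul ℝ ℝ)
    (hφ.1.of_le (by norm_num)) hw x
  rw [hd.fderiv, convolution_eq_swap, ContinuousLinearMap.integral_apply]
  · have htest : IsTest (fun y => φ (x - y)) :=
      ⟨hφ.1.comp (by fun_prop), hφ.2.comp_homeomorph (Homeomorph.subLeft x)⟩
    have := hwg _ htest j
    have e : ∀ y, fderiv ℝ (fun y => φ (x - y)) y (EuclideanSpace.single j 1)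
        = - fderiv ℝ φ (x - y) (EuclideanSpace.single j 1) := by
      intro y
      have h1 : HasFDerivAt φ (fderiv ℝ φ (x - y)) (x - y) :=
        (hφ.1.differentiable (by norm_num) _).hasFDerivAt
      have h2 : HasFDerivAt (fun y : Space N => x - y) (-(ContinuousLinearMap.id ℝ (Space N))) y :=
        (hasFDerivAt_id y).const_sub x
      have h3 : HasFDerivAt (fun y => φ (x - y)) _ y := h1.comp y h2
      rw [h3.fderiv]; simp
    simp only [e, mul_neg, integral_neg, neg_inj] at this
    simp only [mul_comm (φ _), ← this]
    congr 1 with y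
    simp [mul_comm]
  · have hc : HasCompactSupport (fderiv ℝ φ) := hφ.2.fderiv ℝ
    have := hc.convolutionExists_left (μ := volume)
      ((ContinuousLinearMap.lsmul ℝ ℝ : ℝ →L[ℝ] ℝ →L[ℝ] ℝ).precompL (Space N))
      (hφ.1.continuous_fderiv (by norm_num)) hw x
    exact this.integrable_swap


/-! ### Scale-critical cutoffs in L^N. -/

theorem eLpNorm_comp_inv_smul {N : ℕ} (hN : N ≠ 0) {F : Type*} [NormedAddCommGroup F]
    {Θ : Space N → F} (hΘ : Continuous Θ) {n : ℕ} (hn : n ≠ 0) :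
    eLpNorm (fun x => Θ ((n : ℝ)⁻¹ • x)) N volume = n * eLpNorm Θ N volume := by
  have hn' : (n : ℝ)⁻¹ ≠ 0 := by positivity
  have hmap := Measure.map_addHaar_smul (volume : Measure (Space N)) hn'
  have h1 := eLpNorm_map_measure (p := (N : ℝ≥0∞)) (f := fun x : Space N => (n : ℝ)⁻¹ • x)
    (μ := volume) (g := Θ) hΘ.aestronglyMeasurable
    (by fun_prop : Continuous fun x : Space N => (n : ℝ)⁻¹ • x).measurable.aemeasurable
  change _ = eLpNorm (fun x => Θ ((n : ℝ)⁻¹ • x)) N volume at h1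
  change Measure.map (fun x : Space N => (n : ℝ)⁻¹ • x) volume = _ at hmap
  rw [← h1, hmap, eLpNorm_smul_measure_of_ne_top (by simp)]
  congr 1
  simp only [finrank_euclideanSpace, Fintype.card_fin, one_div, ENNReal.toReal_inv,
    ENNReal.toReal_natCast, inv_pow, inv_inv, abs_pow, Nat.abs_cast]
  rw [ENNReal.ofReal_pow (by positivity), ENNReal.ofReal_natCast, ← ENNReal.rpow_natCast,
    ← ENNReal.rpow_mul, mul_inv_cancel₀ (by exact_mod_cast hN), ENNReal.rpow_one]

/-- `L^N` is the scale-critical space for gradients of cutoffs: dilation by `n` costs a factor `n`,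
which the derivative returns. Such gradients are therefore bounded in `L^N`, though not small, and
smallness has to come from the tail of the other factor. -/
theorem eLpNorm_inv_smul_comp_inv_smul {N : ℕ} (hN : N ≠ 0) {F : Type*} [NormedAddCommGroup F]
    [NormedSpace ℝ F] {Θ : Space N → F} (hΘ : Continuous Θ) {n : ℕ} (hn : n ≠ 0) :
    eLpNorm (fun x => (n : ℝ)⁻¹ • Θ ((n : ℝ)⁻¹ • x)) N volume = eLpNorm Θ N volume := by
  have := eLpNorm_const_smul (c := (n : ℝ)⁻¹) (fun x => Θ ((n : ℝ)⁻¹ • x)) (N : ℝ≥0∞) volume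
  change eLpNorm ((n : ℝ)⁻¹ • fun x => Θ ((n : ℝ)⁻¹ • x)) N volume = _
  rw [this, eLpNorm_comp_inv_smul hN hΘ hn, ← mul_assoc]
  have : ‖(n : ℝ)⁻¹‖ₑ * (n : ℝ≥0∞) = 1 := by
    rw [enorm_inv (by positivity), Real.enorm_natCast]
    exact ENNReal.inv_mul_cancel (by exact_mod_cast hn) (by simp)
  rw [this, one_mul]

theorem tendsto_eLpNorm_indicator_norm_ge {N : ℕ} {F : Type*} [NormedAddCommGroup F]
    {p : ℝ≥0∞} (hp0 : p ≠ 0) (hp : p ≠ ⊤) {u : Space N → F} (hu : MemLp u p volume) :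
    Tendsto (fun n : ℕ => eLpNorm ({x | (n : ℝ) ≤ ‖x‖}.indicator u) p volume) atTop (𝓝 0) := by
  have hpos : 0 < p.toReal := ENNReal.toReal_pos hp0 hp
  have hms : ∀ n : ℕ, MeasurableSet {x : Space N | (n : ℝ) ≤ ‖x‖} := fun n =>
    measurableSet_le measurable_const measurable_norm
  have key : Tendsto (fun n : ℕ => ∫⁻ x, ‖{x | (n : ℝ) ≤ ‖x‖}.indicator u x‖ₑ ^ p.toReal)
      atTop (𝓝 (∫⁻ _ : Space N, 0)) := by
    apply tendsto_lintegral_of_dominated_convergence' (fun x => ‖u x‖ₑ ^ p.toReal)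
    · intro n
      exact (hu.1.indicator (hms n)).enorm.pow_const _
    · intro n
      refine Eventually.of_forall fun x => ?_
      dsimp only
      gcongr
      exact enorm_indicator_le_enorm_self _ _
    · exact (lintegral_rpow_enorm_lt_top_of_eLpNorm_lt_top hp0 hp hu.2).ne
    · refine Eventually.of_forall fun x => ?_
      apply tendsto_const_nhds.congr'
      obtain ⟨m, hm⟩ := exists_nat_gt ‖x‖
      filter_upwards [eventually_ge_atTop m] with n hn
      have : x ∉ {x : Space N | (n : ℝ) ≤ ‖x‖} := by
        simp only [mem_ofPred_eq, not_le]
        exact hm.trans_le (by exact_mod_cast hn)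
      rw [indicator_of_notMem this]
      simp [hpos]
  simp_rw [eLpNorm_eq_lintegral_rpow_enorm_toReal hp0 hp]
  have := (ENNReal.continuous_rpow_const (y := 1 / p.toReal)).continuousAt.tendsto.comp key
  simpa [hpos, Function.comp_def] using this

/-- Pairing with the scaled cutoffs `n⁻¹ Θ(n⁻¹ x)`, `Θ` vanishing near the origin. -/
theorem eLpNorm_scaled_smul_le {N : ℕ} (hN : N ≠ 0) {F : Type*} [NormedAddCommGroup F]
    [NormedSpace ℝ F] {p r : ℝ≥0∞} [ENNReal.HolderTriple N p r] {u : Space N → F}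
    (hu : AEStronglyMeasurable u volume) {Θ : Space N → ℝ} (hΘ : Continuous Θ)
    (h0 : ∀ x, ‖x‖ < 1 → Θ x = 0) {n : ℕ} (hn : n ≠ 0) :
    eLpNorm (fun x => ((n : ℝ)⁻¹ * Θ ((n : ℝ)⁻¹ • x)) • u x) r volume ≤
      eLpNorm Θ N volume * eLpNorm ({x | (n : ℝ) ≤ ‖x‖}.indicator u) p volume := by
  have e : (fun x => ((n : ℝ)⁻¹ * Θ ((n : ℝ)⁻¹ • x)) • u x) =
      (fun x => (n : ℝ)⁻¹ • Θ ((n : ℝ)⁻¹ • x)) • ({x | (n : ℝ) ≤ ‖x‖}.indicator u) := by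
    ext1 x
    simp only [Pi.smul_apply', smul_eq_mul]
    by_cases hx : (n : ℝ) ≤ ‖x‖
    · rw [indicator_of_mem (by exact hx)]
    · rw [h0, mul_zero, zero_smul, zero_smul]
      rw [norm_smul, norm_inv, Real.norm_natCast, inv_mul_lt_iff₀ (by positivity), mul_one]
      exact not_le.1 hx
  rw [e, ← eLpNorm_inv_smul_comp_inv_smul hN hΘ hn]
  apply eLpNorm_smul_le_mul_eLpNorm
  · exact hu.indicator (measurableSet_le measurable_const measurable_norm)
  · exact (by fun_prop : Continuous fun x => (n : ℝ)⁻¹ • Θ ((n : ℝ)⁻¹ • x)).aestronglyMeasurable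

/-- Hölder pairs a scale-invariant `L^N` norm with the `L^p` tail of `u` over `‖x‖ ≥ n`, which tends
to zero. -/
theorem tendsto_eLpNorm_scaled_smul {N : ℕ} (hN : N ≠ 0) {F : Type*} [NormedAddCommGroup F]
    [NormedSpace ℝ F] {p r : ℝ≥0∞} [ENNReal.HolderTriple N p r] (hp0 : p ≠ 0) (hp : p ≠ ⊤)
    {u : Space N → F} (hu : MemLp u p volume) {Θ : Space N → ℝ} (hΘ : Continuous Θ)
    (hc : HasCompactSupport Θ) (h0 : ∀ x, ‖x‖ < 1 → Θ x = 0) :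
    Tendsto (fun n : ℕ => eLpNorm (fun x => ((n : ℝ)⁻¹ * Θ ((n : ℝ)⁻¹ • x)) • u x) r volume)
      atTop (𝓝 0) := by
  have h1 := ENNReal.Tendsto.const_mul (a := eLpNorm Θ N volume)
    (tendsto_eLpNorm_indicator_norm_ge hp0 hp hu)
    (Or.inr (hΘ.memLp_of_hasCompactSupport hc).2.ne)
  rw [mul_zero] at h1
  refine tendsto_of_tendsto_of_tendsto_of_le_of_le' tendsto_const_nhds h1
    (Eventually.of_forall fun _ => zero_le) ?_
  filter_upwards [eventually_ne_atTop 0] with n hn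
  exact eLpNorm_scaled_smul_le hN hu.1 hΘ h0 hn

/-! ### The Sobolev inequality for weak gradients. -/

/-- A sequence of mollifiers shrinking to the origin. -/
def mollifier (N n : ℕ) : ContDiffBump (0 : Space N) where
  rIn := 1 / (n + 1)
  rOut := 2 / (n + 1)
  rIn_pos := by positivity
  rIn_lt_rOut := by gcongr; norm_num

theorem isTest_normed_mollifier (N n : ℕ) : IsTest ((mollifier N n).normed volume) :=
  ⟨(mollifier N n).contDiff_normed, (mollifier N n).hasCompactSupport_normed⟩

theorem ae_tendsto_mollify {N : ℕ} {w : Space N → ℝ} (hw : LocallyIntegrable w) :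
    ∀ᵐ x, Tendsto (fun n => ((mollifier N n).normed volume
      ⋆[ContinuousLinearMap.lsmul ℝ ℝ, volume] w) x) atTop (𝓝 (w x)) := by
  -- The constant 2 is the fixed ratio of outer to inner radius, which keeps the bumps comparable to
  -- averages over balls, as Lebesgue differentiation requires.
  apply ContDiffBump.ae_convolution_tendsto_right_of_locallyIntegrable (K := 2) _ _ hw
  · have := tendsto_one_div_add_atTop_nhds_zero_nat (𝕜 := ℝ)
    have h2 := this.const_mul 2
    simp only [mul_zero] at h2
    refine h2.congr fun n => ?_
    simp [mollifier]; ring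
  · refine Eventually.of_forall fun n => ?_
    simp only [mollifier]
    apply le_of_eq; ring

/-- The Sobolev inequality for compactly supported functions with weak partial derivatives. -/
theorem sobolev_of_hasCompactSupport {N : ℕ} (hN : 3 ≤ N) {p : ℝ≥0}
    (hp : (p : ℝ)⁻¹ = 2⁻¹ - (N : ℝ)⁻¹) {w : Space N → ℝ} {g : Fin N → Space N → ℝ}
    (hw : LocallyIntegrable w) (hc : HasCompactSupport w) (hwg : HasWeakPartials w g)
    (hg : ∀ j, AEStronglyMeasurable (g j) volume) :
    eLpNorm w p volume ≤ SNormLESNormFDerivOfEqConst ℝ (volume : Measure (Space N)) (2 : ℝ≥0) *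
      ∑ j, eLpNorm (g j) 2 volume := by
  set C := SNormLESNormFDerivOfEqConst ℝ (volume : Measure (Space N)) (2 : ℝ≥0)
  set W : ℕ → Space N → ℝ := fun n => (mollifier N n).normed volume
      ⋆[ContinuousLinearMap.lsmul ℝ ℝ, volume] w
  have hφ : ∀ n, IsTest ((mollifier N n).normed volume) := isTest_normed_mollifier N
  have hW1 : ∀ n, ContDiff ℝ 1 (W n) := fun n =>
    (hφ n).2.contDiff_convolution_left (n := 1) _ ((hφ n).1.of_le (by norm_num)) hw
  have hW2 : ∀ n, HasCompactSupport (W n) := fun n => (hφ n).2.convolution _ hc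
  have hbound : ∀ n, eLpNorm (W n) p volume ≤ C * ∑ j, eLpNorm (g j) 2 volume := by
    intro n
    have hgns := eLpNorm_le_eLpNorm_fderiv_of_eq (volume : Measure (Space N)) (hW1 n) (hW2 n)
      (p := 2) (p' := p) (by norm_num) (by simp; omega) (by simpa using hp)
    refine hgns.trans ?_
    gcongr
    have hcont : ∀ j, Continuous fun x => fderiv ℝ (W n) x (EuclideanSpace.single j 1) :=
      fun j => ((hW1 n).continuous_fderiv (by norm_num)).clm_apply continuous_const
    calc eLpNorm (fderiv ℝ (W n)) (2 : ℝ≥0) volume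
        ≤ eLpNorm (fun x => ∑ j, ‖fderiv ℝ (W n) x (EuclideanSpace.single j 1)‖) 2 volume :=
          eLpNorm_mono_real fun x => norm_clm_le_sum _
      _ ≤ ∑ j, eLpNorm (fun x => ‖fderiv ℝ (W n) x (EuclideanSpace.single j 1)‖) 2 volume := by
          have := eLpNorm_sum_le (μ := (volume : Measure (Space N))) (p := 2) (s := Finset.univ)
            (f := fun j x => ‖fderiv ℝ (W n) x (EuclideanSpace.single j 1)‖)
            (fun j _ => (hcont j).norm.aestronglyMeasurable) (by norm_num)
          refine le_trans (le_of_eq ?_) this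
          congr 1
          ext x; simp
      _ ≤ ∑ j, eLpNorm (g j) 2 volume := by
          refine Finset.sum_le_sum fun j _ => ?_
          rw [eLpNorm_norm]
          simp only [W, fderiv_mollify (hφ n) hw hwg]
          exact eLpNorm_two_convolution_le (hφ n).1.continuous
            (fun x => (mollifier N n).nonneg_normed x) (mollifier N n).integrable_normed
            (mollifier N n).integral_normed (hg j)
  -- The bound is uniform in `n` and `W n` converges to `w` almost everywhere, so Fatou's lemma
  -- carries it to `w`.
  refine (Lp.eLpNorm_lim_le_liminf_eLpNorm (fun n => (hW1 n).continuous.aestronglyMeasurable) w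
    (ae_tendsto_mollify hw)).trans ?_
  refine (liminf_le_liminf (Eventually.of_forall hbound)).trans ?_
  simp

/-- The standard smooth cutoff, `1` on the unit ball and `0` outside the ball of radius `2`. -/
def cutoff (N : ℕ) : ContDiffBump (0 : Space N) where
  rIn := 1
  rOut := 2
  rIn_pos := one_pos
  rIn_lt_rOut := by norm_num

theorem isTest_cutoff (N : ℕ) : IsTest (cutoff N) :=
  ⟨(cutoff N).contDiff, (cutoff N).hasCompactSupport⟩

theorem cutoff_eq_one {N : ℕ} {x : Space N} (hx : ‖x‖ ≤ 1) : cutoff N x = 1 :=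
  (cutoff N).one_of_mem_closedBall (by simpa [cutoff] using hx)

theorem cutoff_eventuallyEq_one {N : ℕ} {x : Space N} (hx : ‖x‖ < 1) :
    (cutoff N : Space N → ℝ) =ᶠ[𝓝 x] fun _ => 1 := by
  filter_upwards [(Metric.isOpen_ball (x := (0 : Space N)) (ε := 1)).mem_nhds (by simpa using hx)]
    with y hy
  exact cutoff_eq_one (by simpa using (mem_ball_zero_iff.1 hy).le)

theorem fderiv_cutoff_eq_zero {N : ℕ} {x : Space N} (hx : ‖x‖ < 1) : fderiv ℝ (cutoff N) x = 0 := by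
  rw [(cutoff_eventuallyEq_one hx).fderiv_eq]; simp

theorem IsTest.comp_inv_smul {N : ℕ} {F : Type*} [NormedAddCommGroup F] [NormedSpace ℝ F]
    {Θ : Space N → F} (h : IsTest Θ) {n : ℕ} (hn : n ≠ 0) :
    IsTest (fun x => Θ ((n : ℝ)⁻¹ • x)) :=
  ⟨h.1.comp (by fun_prop), h.2.comp_smul (by positivity)⟩

/-- The Leibniz rule in weak form: testing `u` against `χ ψ` and expanding the derivative of that
product leaves exactly these partials. -/
theorem HasWeakPartials.mul_test {N : ℕ} {u : Space N → ℝ} {g : Fin N → Space N → ℝ}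
    (h : HasWeakPartials u g) (hu : LocallyIntegrable u) (hg : ∀ j, LocallyIntegrable (g j))
    {χ : Space N → ℝ} (hχ : IsTest χ) :
    HasWeakPartials (fun x => χ x * u x) (fun j x => χ x * g j x +
      fderiv ℝ χ x (EuclideanSpace.single j 1) * u x) := by
  intro ψ hψ j
  have hprod : IsTest (fun x => χ x * ψ x) := ⟨hχ.1.mul hψ.1, hχ.2.mul_right⟩
  have key := h _ hprod j
  have hd : ∀ x, fderiv ℝ (fun x => χ x * ψ x) x (EuclideanSpace.single j 1) =
      χ x * fderiv ℝ ψ x (EuclideanSpace.single j 1) +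
      ψ x * fderiv ℝ χ x (EuclideanSpace.single j 1) := by
    intro x
    rw [fderiv_fun_mul (hχ.1.differentiable (by norm_num) x) (hψ.1.differentiable (by norm_num) x)]
    simp
  have hcψ : Continuous fun x => fderiv ℝ ψ x (EuclideanSpace.single j 1) :=
    (hψ.1.continuous_fderiv (by norm_num)).clm_apply continuous_const
  have hcχ : Continuous fun x => fderiv ℝ χ x (EuclideanSpace.single j 1) :=
    (hχ.1.continuous_fderiv (by norm_num)).clm_apply continuous_const
  have i1 : Integrable fun x => u x * (χ x * fderiv ℝ ψ x (EuclideanSpace.single j 1)) := by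
    simpa [mul_comm] using hu.integrable_smul_right_of_hasCompactSupport
      (hχ.1.continuous.mul hcψ) hχ.2.mul_right
  have i2 : Integrable fun x => u x * (ψ x * fderiv ℝ χ x (EuclideanSpace.single j 1)) := by
    simpa [mul_comm] using hu.integrable_smul_right_of_hasCompactSupport
      (hψ.1.continuous.mul hcχ) hψ.2.mul_right
  have i3 : Integrable fun x => g j x * (χ x * ψ x) := by
    simpa [mul_comm] using (hg j).integrable_smul_right_of_hasCompactSupport
      hprod.1.continuous hprod.2
  simp only [hd, mul_add] at key
  rw [integral_add i1 i2] at key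
  have e1 : ∫ x, χ x * u x * fderiv ℝ ψ x (EuclideanSpace.single j 1) =
      ∫ x, u x * (χ x * fderiv ℝ ψ x (EuclideanSpace.single j 1)) := by congr 1 with x; ring
  have e2 : ∫ x, (χ x * g j x + fderiv ℝ χ x (EuclideanSpace.single j 1) * u x) * ψ x =
      (∫ x, g j x * (χ x * ψ x)) +
        ∫ x, u x * (ψ x * fderiv ℝ χ x (EuclideanSpace.single j 1)) := by
    rw [← integral_add i3 i2]; congr 1 with x; ring
  rw [e1, e2]; linarith

/-- The Sobolev inequality `‖u‖_{2N/(N-2)} ≤ C ‖∇u‖₂` for scalar functions. -/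
theorem sobolev_scalar {N : ℕ} (hN : 3 ≤ N) {p : ℝ≥0}
    (hp : (p : ℝ)⁻¹ = 2⁻¹ - (N : ℝ)⁻¹) {u : Space N → ℝ} {g : Fin N → Space N → ℝ}
    (hu : MemLp u p volume) (hul : LocallyIntegrable u) (hgl : ∀ j, LocallyIntegrable (g j))
    (hwg : HasWeakPartials u g) :
    eLpNorm u p volume ≤ SNormLESNormFDerivOfEqConst ℝ (volume : Measure (Space N)) (2 : ℝ≥0) *
      ∑ j, eLpNorm (g j) 2 volume := by
  set C := SNormLESNormFDerivOfEqConst ℝ (volume : Measure (Space N)) (2 : ℝ≥0)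
  have hN0 : N ≠ 0 := by omega
  have hNpos : (0 : ℝ) < N := by positivity
  have hppos : 0 < (p : ℝ) := by
    rw [← inv_pos, hp, sub_pos]
    gcongr
    exact_mod_cast (by omega : 2 < N)
  have hp0 : (p : ℝ≥0∞) ≠ 0 := by
    simpa using (show p ≠ 0 from fun h => by simp [h] at hppos)
  -- The relation `1/N + 1/p = 1/2` puts the error term `u ∇χ` of the cutoff in `L²`.
  have : ENNReal.HolderTriple N p 2 := ⟨by
    have h1 : (N : ℝ≥0∞) = ((N : ℝ≥0) : ℝ≥0∞) := by simp
    have h2 : (2 : ℝ≥0∞) = ((2 : ℝ≥0) : ℝ≥0∞) := by simp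
    rw [h1, h2, ← ENNReal.coe_inv (by simpa using hN0), ← ENNReal.coe_inv (by simpa using hp0),
      ← ENNReal.coe_inv (by norm_num), ← ENNReal.coe_add, ENNReal.coe_inj, ← NNReal.coe_inj]
    push_cast
    rw [hp]; ring⟩
  let χ : ℕ → Space N → ℝ := fun n x => cutoff N ((n : ℝ)⁻¹ • x)
  have hχ : ∀ n ≠ 0, IsTest (χ n) := fun n hn => (isTest_cutoff N).comp_inv_smul hn
  have hfd : ∀ n j x, fderiv ℝ (χ n) x (EuclideanSpace.single j 1) =
      (n : ℝ)⁻¹ * fderiv ℝ (cutoff N) ((n : ℝ)⁻¹ • x) (EuclideanSpace.single j 1) := by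
    intro n j x
    simp only [χ, fderiv_comp_smul (f := (cutoff N)), FunLike.coe_smul, Pi.smul_apply, smul_eq_mul]
  let Θ : Fin N → Space N → ℝ := fun j x => fderiv ℝ (cutoff N) x (EuclideanSpace.single j 1)
  have hΘc : ∀ j, Continuous (Θ j) := fun j =>
    ((isTest_cutoff N).1.continuous_fderiv (by norm_num)).clm_apply continuous_const
  have hΘs : ∀ j, HasCompactSupport (Θ j) := fun j =>
    ((isTest_cutoff N).2.fderiv_apply ℝ _)
  have hΘ0 : ∀ j x, ‖x‖ < 1 → Θ j x = 0 := fun j x hx => by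
    simp [Θ, fderiv_cutoff_eq_zero hx]
  have htail : ∀ j, Tendsto (fun n : ℕ => eLpNorm
      (fun x => ((n : ℝ)⁻¹ * Θ j ((n : ℝ)⁻¹ • x)) • u x) 2 volume) atTop (𝓝 0) := fun j =>
    tendsto_eLpNorm_scaled_smul hN0 hp0 (by simp) hu (hΘc j) (hΘs j) (hΘ0 j)
  have hbound : ∀ n ≠ 0, eLpNorm (fun x => χ n x * u x) p volume ≤ C * ∑ j,
      (eLpNorm (g j) 2 volume +
        eLpNorm (fun x => ((n : ℝ)⁻¹ * Θ j ((n : ℝ)⁻¹ • x)) • u x) 2 volume) := by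
    intro n hn
    have hm : ∀ j, AEStronglyMeasurable (fun x => χ n x * g j x) volume := fun j =>
      (hχ n hn).1.continuous.aestronglyMeasurable.mul (hgl j).aestronglyMeasurable
    have hm' : ∀ j, AEStronglyMeasurable (fun x => fderiv ℝ (χ n) x (EuclideanSpace.single j 1)
        * u x) volume := fun j =>
      (((hχ n hn).1.continuous_fderiv (by norm_num)).clm_apply
        continuous_const).aestronglyMeasurable.mul hu.1
    refine (sobolev_of_hasCompactSupport hN hp ?_ ?_ (hwg.mul_test hul hgl (hχ n hn))
      (fun j => (hm j).add (hm' j))).trans ?_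
    · exact (hul.integrable_smul_left_of_hasCompactSupport (hχ n hn).1.continuous
        (hχ n hn).2).locallyIntegrable
    · exact (hχ n hn).2.mul_right
    · gcongr with j
      refine (eLpNorm_add_le (hm j) (hm' j) (by norm_num)).trans ?_
      gcongr ?_ + ?_
      · refine eLpNorm_mono fun x => ?_
        rw [norm_mul, Real.norm_of_nonneg (cutoff N).nonneg]
        exact mul_le_of_le_one_left (norm_nonneg _) (cutoff N).le_one
      · simp only [hfd, Θ, smul_eq_mul]
        exact le_rfl
  have hlim : Tendsto (fun n : ℕ => C * ∑ j, (eLpNorm (g j) 2 volume +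
        eLpNorm (fun x => ((n : ℝ)⁻¹ * Θ j ((n : ℝ)⁻¹ • x)) • u x) 2 volume)) atTop
      (𝓝 (C * ∑ j, (eLpNorm (g j) 2 volume + 0))) := by
    refine ENNReal.Tendsto.const_mul ?_ (Or.inr (by simp))
    exact tendsto_finsetSum _ fun j _ => (htail j).const_add _
  simp only [add_zero] at hlim
  have hconv : ∀ x, Tendsto (fun n : ℕ => χ (n + 1) x * u x) atTop (𝓝 (u x)) := by
    intro x
    apply tendsto_const_nhds.congr'
    obtain ⟨m, hm⟩ := exists_nat_gt ‖x‖
    filter_upwards [eventually_ge_atTop m] with n hn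
    have : χ (n + 1) x = 1 := cutoff_eq_one <| by
      rw [norm_smul, norm_inv, Real.norm_natCast, inv_mul_le_iff₀ (by positivity), mul_one]
      refine hm.le.trans ?_
      exact_mod_cast hn.trans (Nat.le_succ n)
    rw [this, one_mul]
  -- Fatou removes the cutoff. The index starts at `1` because the cutoff at scale `0` is not
  -- compactly supported.
  refine (Lp.eLpNorm_lim_le_liminf_eLpNorm (f := fun n x => χ (n + 1) x * u x) (fun n => ?_) u
    (Eventually.of_forall hconv)).trans ?_
  · exact (hχ _ n.succ_ne_zero).1.continuous.aestronglyMeasurable.mul hu.1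
  · refine (liminf_le_liminf (Eventually.of_forall fun n => hbound _ n.succ_ne_zero)).trans ?_
    exact le_of_eq ((tendsto_add_atTop_iff_nat 1).2 hlim).liminf_eq

/-- The Sobolev inequality for vector fields, with the weak gradient of `HasWeakGradient`. -/
theorem HasWeakGradient.sobolev {N : ℕ} (hN : 3 ≤ N) {p : ℝ≥0}
    (hp : (p : ℝ)⁻¹ = 2⁻¹ - (N : ℝ)⁻¹) :
    ∃ C : ℝ≥0, ∀ (u : Space N → Space N) (G : Space N → Grad N), MemLp u p volume →
      HasWeakGradient u G → eLpNorm u p volume ≤ C * eLpNorm G 2 volume := by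
  set C := SNormLESNormFDerivOfEqConst ℝ (volume : Measure (Space N)) (2 : ℝ≥0)
  -- One factor `N` sums the components of `u`; the other sums the partial derivatives of a single
  -- component.
  refine ⟨N * (N * C), fun u G hu ⟨hul, hGl, hw⟩ => ?_⟩
  have hp1 : 1 ≤ (p : ℝ≥0∞) := by
    have h1 : (p : ℝ)⁻¹ ≤ 1 := by
      rw [hp]; have : (0 : ℝ) ≤ (N : ℝ)⁻¹ := by positivity
      linarith
    have hppos : 0 < (p : ℝ) := by
      rw [← inv_pos, hp, sub_pos]; gcongr; exact_mod_cast (by omega : 2 < N)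
    have : (1 : ℝ) ≤ p := by
      rwa [inv_le_one₀ hppos] at h1
    exact_mod_cast this
  have hcomp : ∀ i, eLpNorm (fun x => u x i) p volume ≤ C * (N * eLpNorm G 2 volume) := by
    intro i
    have hli : LocallyIntegrable (fun x => u x i) := fun x => by
      obtain ⟨s, hs, hi⟩ := hul x
      exact ⟨s, hs, (EuclideanSpace.proj (𝕜 := ℝ) i).integrable_comp hi⟩
    have hlg : ∀ j, LocallyIntegrable (fun x => G x (i, j)) := fun j x => by
      obtain ⟨s, hs, hi⟩ := hGl x
      exact ⟨s, hs, (EuclideanSpace.proj (𝕜 := ℝ) (i, j)).integrable_comp hi⟩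
    refine (sobolev_scalar hN hp (u := fun x => u x i) (g := fun j x => G x (i, j))
      (hu.of_le hli.aestronglyMeasurable (Eventually.of_forall fun x => PiLp.norm_apply_le _ _))
      hli hlg (fun ψ hψ j => hw ψ hψ i j)).trans ?_
    gcongr
    calc ∑ j, eLpNorm (fun x => G x (i, j)) 2 volume ≤ ∑ _j : Fin N, eLpNorm G 2 volume :=
          Finset.sum_le_sum fun j _ => eLpNorm_mono fun x => PiLp.norm_apply_le _ _
      _ = _ := by simp
  have hdec : u = ∑ i, fun x => u x i • EuclideanSpace.single i (1 : ℝ) := by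
    ext x k; simp [Finset.sum_apply, Pi.single_apply]
  calc eLpNorm u p volume
      ≤ ∑ i, eLpNorm (fun x => u x i • EuclideanSpace.single i (1 : ℝ)) p volume := by
        conv_lhs => rw [hdec]
        refine eLpNorm_sum_le (fun i _ => ?_) hp1
        exact ((EuclideanSpace.proj (𝕜 := ℝ) i).continuous.comp_aestronglyMeasurable
          hu.1).smul_const _
    _ ≤ ∑ i : Fin N, C * (N * eLpNorm G 2 volume) := by
        refine Finset.sum_le_sum fun i _ => le_trans (eLpNorm_mono fun x => ?_) (hcomp i)
        simp [norm_smul]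
    _ = _ := by simp; ring

/-! ### Functions of time and weak monotonicity. -/

/-- Integrability on every bounded time interval `(0, T)`. -/
def TimeLoc (h : ℝ → ℝ) : Prop := ∀ T : ℝ, IntegrableOn h (Ioo 0 T)

theorem TimeLoc.mul_continuous {h ξ : ℝ → ℝ} (hh : TimeLoc h) (hξ : ContinuousOn ξ (Ioi 0))
    {T : ℝ} (hT : ∀ t, T ≤ t → ξ t = 0) {M : ℝ} (hM : ∀ t, 0 < t → |ξ t| ≤ M) :
    IntegrableOn (fun t => h t * ξ t) (Ioi 0) := by
  have h1 : IntegrableOn (fun t => h t * ξ t) (Ioo 0 T) :=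
    (hh T).mul_bdd (c := M)
      ((hξ.mono Ioo_subset_Ioi_self).aestronglyMeasurable measurableSet_Ioo)
      ((ae_restrict_mem measurableSet_Ioo).mono fun t ht => hM t ht.1)
  refine h1.of_forall_sdiff_eq_zero measurableSet_Ioi fun t ht => ?_
  have : T ≤ t := by
    by_contra hlt
    exact ht.2 ⟨ht.1, not_le.1 hlt⟩
  rw [hT t this, mul_zero]

theorem TimeLoc.mul_compact {h ξ : ℝ → ℝ} (hh : TimeLoc h) (hξ : Continuous ξ)
    (hc : HasCompactSupport ξ) : IntegrableOn (fun t => h t * ξ t) (Ioi 0) := by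
  obtain ⟨M, hM⟩ := hξ.bounded_above_of_compact_support hc
  obtain ⟨T, hT⟩ := hc.isCompact.bddAbove
  refine hh.mul_continuous hξ.continuousOn (T := T + 1) (fun t ht => ?_) (M := M) fun t _ => hM t
  by_contra hne
  have := hT (subset_tsupport ξ hne)
  linarith

theorem IsInteriorTimeTest.deriv_continuous {ξ : ℝ → ℝ} (h : IsInteriorTimeTest ξ) :
    Continuous (deriv ξ) := h.1.1.continuous_deriv (by norm_num)

theorem TimeLoc.mul_deriv {h ξ : ℝ → ℝ} (hh : TimeLoc h) (hξ : IsInteriorTimeTest ξ) :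
    IntegrableOn (fun t => h t * deriv ξ t) (Ioi 0) :=
  hh.mul_compact hξ.deriv_continuous hξ.1.2.deriv

theorem TimeLoc.mul_test {h ξ : ℝ → ℝ} (hh : TimeLoc h) (hξ : IsInteriorTimeTest ξ) :
    IntegrableOn (fun t => h t * ξ t) (Ioi 0) :=
  hh.mul_compact hξ.1.1.continuous hξ.1.2

theorem IsInteriorTimeTest.isTimeTest {ξ : ℝ → ℝ} (h : IsInteriorTimeTest ξ) : IsTimeTest ξ :=
  ⟨h.1.1.of_le (by norm_num), h.1.2⟩

theorem IsInteriorTimeTest.eq_zero {ξ : ℝ → ℝ} (h : IsInteriorTimeTest ξ) {t : ℝ} (ht : t ≤ 0) :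
    ξ t = 0 :=
  image_eq_zero_of_notMem_tsupport fun hm => not_lt.2 ht (h.2 hm)

/-- Since `ξ` vanishes near `0`, a weight that is singular there, such as a negative power of `t`,
still produces a test function. This is how integrating factors are inserted into weak differential
inequalities. -/
theorem IsInteriorTimeTest.mul_left {ξ w : ℝ → ℝ} (h : IsInteriorTimeTest ξ)
    (hw : ContDiffOn ℝ ∞ w (Ioi 0)) : IsInteriorTimeTest (fun t => w t * ξ t) := by
  have hs : tsupport (fun t => w t * ξ t) ⊆ tsupport ξ := tsupport_mul_subset_right
  refine ⟨⟨?_, h.1.2.mul_left⟩, hs.trans h.2⟩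
  rw [contDiff_iff_contDiffAt]
  intro t
  by_cases ht : 0 < t
  · exact (hw.contDiffAt (Ioi_mem_nhds ht)).mul h.1.1.contDiffAt
  · have hn : t ∉ tsupport ξ := fun hm => ht (h.2 hm)
    have : (fun t => w t * ξ t) =ᶠ[𝓝 t] fun _ => 0 := by
      filter_upwards [notMem_tsupport_iff_eventuallyEq.1 hn] with y hy
      simp [hy]
    exact contDiffAt_const.congr_of_eventuallyEq this

theorem IsInteriorTimeTest.deriv_mul_left {ξ w : ℝ → ℝ} (h : IsInteriorTimeTest ξ) {w' t : ℝ}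
    (hw : HasDerivAt w w' t) :
    deriv (fun t => w t * ξ t) t = w' * ξ t + w t * deriv ξ t :=
  (hw.mul (h.1.1.differentiable (by norm_num) t).hasDerivAt).deriv

/-- One-dimensional mollifiers. -/
def timeMollifier (n : ℕ) : ContDiffBump (0 : ℝ) where
  rIn := 1 / (n + 1)
  rOut := 2 / (n + 1)
  rIn_pos := by positivity
  rIn_lt_rOut := by gcongr; norm_num

theorem tendsto_timeMollifier_rOut : Tendsto (fun n => (timeMollifier n).rOut) atTop (𝓝 0) := by
  have := tendsto_one_div_add_atTop_nhds_zero_nat (𝕜 := ℝ)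
  have h2 := this.const_mul 2
  simp only [mul_zero] at h2
  refine h2.congr fun n => ?_
  simp [timeMollifier]; ring

theorem timeMollifier_rOut_le (n : ℕ) : (timeMollifier n).rOut ≤ 2 := by
  simp only [timeMollifier]
  rw [div_le_iff₀ (by positivity)]
  have : (0 : ℝ) ≤ n := by positivity
  linarith

/-- A primitive of the mollifier: a smooth nondecreasing step from `0` to `1`. -/
def smoothStep (n : ℕ) (x : ℝ) : ℝ := ∫ u in (-3)..x, (timeMollifier n).normed volume u

theorem hasDerivAt_smoothStep (n : ℕ) (x : ℝ) :
    HasDerivAt (smoothStep n) ((timeMollifier n).normed volume x) x :=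
  (timeMollifier n).continuous_normed.integral_hasStrictDerivAt _ _ |>.hasDerivAt

theorem deriv_smoothStep (n : ℕ) : deriv (smoothStep n) = (timeMollifier n).normed volume :=
  funext fun x => (hasDerivAt_smoothStep n x).deriv

theorem contDiff_smoothStep (n : ℕ) : ContDiff ℝ ∞ (smoothStep n) := by
  rw [contDiff_infty_iff_deriv, deriv_smoothStep]
  exact ⟨fun x => (hasDerivAt_smoothStep n x).differentiableAt, (timeMollifier n).contDiff_normed⟩

theorem monotone_smoothStep (n : ℕ) : Monotone (smoothStep n) :=
  monotone_of_deriv_nonneg (contDiff_smoothStep n |>.differentiable (by norm_num)) fun x => by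
    rw [deriv_smoothStep]; exact (timeMollifier n).nonneg_normed x

theorem smoothStep_eq_zero {n : ℕ} {x : ℝ} (hx : x ≤ -(timeMollifier n).rOut) :
    smoothStep n x = 0 := by
  have h0 : EqOn ((timeMollifier n).normed volume) 0 (uIcc (-3) x) := fun u hu => by
    have hu2 : u ≤ -(timeMollifier n).rOut := by
      -- The base point `-3` lies to the left of every support, since the radii are at most `2`.
      have h3 : (-3 : ℝ) ≤ -(timeMollifier n).rOut := by linarith [timeMollifier_rOut_le n]
      exact hu.2.trans (sup_le h3 hx)
    have : u ∉ Function.support ((timeMollifier n).normed volume) := by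
      rw [ContDiffBump.support_normed_eq, Metric.mem_ball, dist_zero_right, not_lt,
        Real.norm_eq_abs]
      exact le_trans (by linarith) (neg_le_abs u)
    simpa using this
  rw [smoothStep, intervalIntegral.integral_congr h0]; simp

theorem smoothStep_eq_one {n : ℕ} {x : ℝ} (hx : (timeMollifier n).rOut ≤ x) :
    smoothStep n x = 1 := by
  rw [smoothStep, intervalIntegral.integral_eq_integral_of_support_subset,
    ContDiffBump.integral_normed]
  rw [ContDiffBump.support_normed_eq, Real.ball_eq_Ioo]
  intro u hu
  have := timeMollifier_rOut_le n
  exact ⟨by linarith [hu.1], by linarith [hu.2]⟩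

/-- A function with nonpositive distributional derivative is almost everywhere nonincreasing. -/
theorem ae_le_of_weak_antitone {a : ℝ} (ha : 0 ≤ a) {h : ℝ → ℝ}
    (hi : ∀ T, IntegrableOn h (Ioo a T))
    (hw : ∀ ζ, IsInteriorTimeTest ζ → tsupport ζ ⊆ Ioi a → (∀ t, 0 ≤ ζ t) →
      0 ≤ ∫ t in Ioi (0 : ℝ), h t * deriv ζ t) :
    ∀ᵐ s ∂(volume.restrict (Ioi a)), ∀ᵐ t ∂(volume.restrict (Ioi s)), h t ≤ h s := by
  set g := (Ioi a).indicator h with hg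
  have hgl : LocallyIntegrable g := fun x => by
    refine ⟨Ioo (x - 1) (x + 1), Ioo_mem_nhds (by linarith) (by linarith), ?_⟩
    rw [hg, integrableOn_indicator_iff measurableSet_Ioi]
    exact (hi (x + 1)).mono_set fun t ht => ⟨ht.1, ht.2.2⟩
  have hconv : ∀ᵐ x, Tendsto (fun n => ((timeMollifier n).normed volume
      ⋆[ContinuousLinearMap.lsmul ℝ ℝ, volume] g) x) atTop (𝓝 (g x)) := by
    apply ContDiffBump.ae_convolution_tendsto_right_of_locallyIntegrable (K := 2)
      tendsto_timeMollifier_rOut _ hgl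
    refine Eventually.of_forall fun n => ?_
    simp only [timeMollifier]
    apply le_of_eq; ring
  filter_upwards [ae_restrict_of_ae hconv, ae_restrict_mem measurableSet_Ioi] with s hs has
  filter_upwards [ae_restrict_of_ae hconv, ae_restrict_mem measurableSet_Ioi] with t ht hst
  have has' : a < s := has
  have hst' : s < t := hst
  have hgs : g s = h s := indicator_of_mem has h
  have hgt : g t = h t := indicator_of_mem (show a < t from has'.trans hst') h
  rw [hgs] at hs; rw [hgt] at ht
  refine le_of_tendsto_of_tendsto ht hs ?_
  -- For such `n` the bump around `s` stays to the right of `a`.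
  filter_upwards [tendsto_timeMollifier_rOut.eventually_lt_const (sub_pos.2 has')] with n hn
  set b := (timeMollifier n).normed volume with hb
  -- A smoothed indicator of `[s, t]`. Its derivative is the bump at `s` minus the bump at `t`, so
  -- testing with it compares the mollified values at two Lebesgue points.
  let ζ : ℝ → ℝ := fun τ => smoothStep n (τ - s) - smoothStep n (τ - t)
  have hζd : ContDiff ℝ ∞ ζ :=
    ((contDiff_smoothStep n).comp (contDiff_id.sub contDiff_const)).sub
      ((contDiff_smoothStep n).comp (contDiff_id.sub contDiff_const))
  have hsupp : Function.support ζ ⊆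
        Icc (s - (timeMollifier n).rOut) (t + (timeMollifier n).rOut) := by
    intro τ hτ
    by_contra hout
    apply hτ
    rw [mem_Icc, not_and_or, not_le, not_le] at hout
    rcases hout with h1 | h1
    · simp only [ζ]
      rw [smoothStep_eq_zero (by linarith), smoothStep_eq_zero (by linarith), sub_zero]
    · simp only [ζ]
      rw [smoothStep_eq_one (by linarith), smoothStep_eq_one (by linarith), sub_self]
  have htsupp : tsupport ζ ⊆ Icc (s - (timeMollifier n).rOut) (t + (timeMollifier n).rOut) :=
    closure_minimal hsupp isClosed_Icc
  have hta : tsupport ζ ⊆ Ioi a := fun τ hτ => by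
    have := (htsupp hτ).1
    change a < τ
    linarith
  have hζ : IsInteriorTimeTest ζ :=
    ⟨⟨hζd, HasCompactSupport.of_support_subset_isCompact isCompact_Icc hsupp⟩,
      fun τ hτ => ha.trans_lt (hta hτ)⟩
  have key := hw ζ hζ hta fun τ => sub_nonneg.2 (monotone_smoothStep n (by linarith))
  have hder : ∀ τ, deriv ζ τ = b (s - τ) - b (t - τ) := by
    intro τ
    have h1 : HasDerivAt ζ (b (τ - s) - b (τ - t)) τ :=
      ((hasDerivAt_smoothStep n _).comp_sub_const τ s).sub
        ((hasDerivAt_smoothStep n _).comp_sub_const τ t)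
    rw [h1.deriv, hb, ← ContDiffBump.normed_neg _ (τ - s), ← ContDiffBump.normed_neg _ (τ - t),
      neg_sub, neg_sub]
  have hint : ∀ x, Integrable fun τ => b (x - τ) * g τ := fun x => by
    have : HasCompactSupport fun τ => b (x - τ) :=
      (timeMollifier n).hasCompactSupport_normed.comp_homeomorph (Homeomorph.subLeft x)
    exact hgl.integrable_smul_left_of_hasCompactSupport
      ((timeMollifier n).continuous_normed.comp (by fun_prop)) this
  have e : ∫ τ in Ioi (0 : ℝ), h τ * deriv ζ τ = ∫ τ, (b (s - τ) * g τ - b (t - τ) * g τ) := by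
    rw [← integral_indicator measurableSet_Ioi]
    congr 1 with τ
    have hz : ∀ τ, τ ≤ a → deriv ζ τ = 0 := fun τ hτ =>
      image_eq_zero_of_notMem_tsupport fun hm => not_lt.2 hτ (hta (tsupport_deriv_subset hm))
    rw [← sub_mul, ← hder]
    by_cases hτ : a < τ
    · rw [indicator_of_mem (mem_Ioi.2 (ha.trans_lt hτ)), hg,
        indicator_of_mem (mem_Ioi.2 hτ), mul_comm]
    · rw [hz τ (not_lt.1 hτ), zero_mul]
      simp [indicator, hz τ (not_lt.1 hτ)]
  rw [e, integral_sub (hint s) (hint t), sub_nonneg] at key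
  simp only [convolution_eq_swap, ContinuousLinearMap.lsmul_apply, smul_eq_mul]
  exact key

theorem contDiffOn_rpow (s : ℝ) : ContDiffOn ℝ ∞ (fun t : ℝ => t ^ s) (Ioi 0) :=
  contDiffOn_id.rpow_const_of_ne fun _ ht => ne_of_gt ht

theorem integral_Ioi_deriv_eq_zero {ξ : ℝ → ℝ} (hξ : IsInteriorTimeTest ξ) :
    ∫ t in Ioi (0 : ℝ), deriv ξ t = 0 := by
  have h1 : ∫ t in Ioi (0 : ℝ), deriv ξ t = ∫ t, deriv ξ t := by
    refine setIntegral_eq_integral_of_forall_compl_eq_zero fun t ht => ?_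
    exact image_eq_zero_of_notMem_tsupport fun hm => ht (hξ.2 (tsupport_deriv_subset hm))
  rw [h1]
  exact integral_eq_zero_of_hasDerivAt_of_integrable
    (fun t => (hξ.1.1.differentiable (by norm_num) t).hasDerivAt)
    (hξ.deriv_continuous.integrable_of_hasCompactSupport hξ.1.2.deriv)
    (hξ.1.1.continuous.integrable_of_hasCompactSupport hξ.1.2)

theorem timeLoc_const (c : ℝ) : TimeLoc fun _ => c := fun T => by
  simp

theorem exists_mem_Ioi_of_ae {a : ℝ} {p : ℝ → Prop} (h : ∀ᵐ s ∂(volume.restrict (Ioi a)), p s) :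
    ∃ s, a < s ∧ p s := by
  have : NeBot (ae (volume.restrict (Ioi a))) := ae_restrict_neBot.2 (by simp)
  obtain ⟨s, hs⟩ := (h.and (ae_restrict_mem measurableSet_Ioi)).exists
  exact ⟨s, hs.2, hs.1⟩

theorem ae_restrict_Ioi_mono {a b : ℝ} (hab : a ≤ b) {p : ℝ → Prop}
    (h : ∀ᵐ s ∂(volume.restrict (Ioi a)), p s) : ∀ᵐ s ∂(volume.restrict (Ioi b)), p s :=
  ae_restrict_of_ae_restrict_of_subset (Ioi_subset_Ioi hab) h

/-! ### Differential inequalities in time. -/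

/-- The virial functional `I - tJ + t²E` grows at most like `t^(2-σ)`. -/
theorem virial_growth {σ : ℝ} (hσ2 : σ ≤ 2) {I J Q E : ℝ → ℝ}
    (iI : TimeLoc I) (iJ : TimeLoc J) (iQ : TimeLoc Q) (iE : TimeLoc E)
    (hI : ∀ ξ, IsInteriorTimeTest ξ →
      ∫ t in Ioi (0 : ℝ), I t * deriv ξ t = - ∫ t in Ioi (0 : ℝ), J t * ξ t)
    (hJ : ∀ ξ, IsInteriorTimeTest ξ →
      ∫ t in Ioi (0 : ℝ), J t * deriv ξ t = - ∫ t in Ioi (0 : ℝ), Q t * ξ t)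
    (hE : ∀ ξ, IsInteriorTimeTest ξ → (∀ t, 0 ≤ ξ t) → 0 ≤ ∫ t in Ioi (0 : ℝ), E t * deriv ξ t)
    (hH : ∀ᵐ t ∂(volume.restrict (Ioi (0 : ℝ))),
      t ^ 2 * (2 * E t - Q t) ≤ (2 - σ) * (I t - t * J t + t ^ 2 * E t)) :
    ∃ S ≥ 1, ∃ C, ∀ᵐ t ∂(volume.restrict (Ioi S)),
      I t - t * J t + t ^ 2 * E t ≤ C * t ^ (2 - σ) := by
  set H : ℝ → ℝ := fun t => I t - t * J t + t ^ 2 * E t with hHdef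
  -- Weak form of `(t^(σ-2) H)' ≤ 0`, that is, of `H' ≤ (2-σ) H / t`.
  have key : ∀ ζ, IsInteriorTimeTest ζ → (∀ t, 0 ≤ ζ t) →
      0 ≤ ∫ t in Ioi (0 : ℝ), (t ^ (σ - 2) * H t) * deriv ζ t := by
    intro ζ hζ hζ0
    -- The three weights match the decomposition `t^(σ-2) H = t^(σ-2) I - t^(σ-1) J + t^σ E`.
    have e0 := hζ.mul_left (contDiffOn_rpow (σ - 2))
    have e1 := hζ.mul_left (contDiffOn_rpow (σ - 1))
    have e2 := hζ.mul_left (contDiffOn_rpow σ)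
    have d : ∀ s t : ℝ, 0 < t → deriv (fun t => t ^ s * ζ t) t =
        s * t ^ (s - 1) * ζ t + t ^ s * deriv ζ t := fun s t ht =>
      hζ.deriv_mul_left (Real.hasDerivAt_rpow_const (Or.inl ht.ne'))
    have a0 := hI _ e0
    have a1 := hJ _ e1
    have a2 := hE _ e2 fun t => by
      rcases le_or_gt t 0 with ht | ht
      · rw [hζ.eq_zero ht, mul_zero]
      · exact mul_nonneg (Real.rpow_nonneg ht.le _) (hζ0 t)
    have i1 := iI.mul_deriv e0
    have i2 := iJ.mul_deriv e1
    have i3 := iE.mul_deriv e2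
    have i4 := iJ.mul_test e0
    have i5 := iQ.mul_test e1
    have s1 : 0 ≤ ∫ t in Ioi (0 : ℝ), ((I t * deriv (fun t => t ^ (σ - 2) * ζ t) t
        - J t * deriv (fun t => t ^ (σ - 1) * ζ t) t + E t * deriv (fun t => t ^ σ * ζ t) t)
        + J t * (t ^ (σ - 2) * ζ t) - Q t * (t ^ (σ - 1) * ζ t)) := by
      have k1 := integral_sub i1 i2
      have k2 := integral_add (i1.sub i2) i3
      have k3 := integral_add ((i1.sub i2).add i3) i4
      have k4 := integral_sub (((i1.sub i2).add i3).add i4) i5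
      simp only [Pi.add_apply, Pi.sub_apply] at k1 k2 k3 k4
      rw [k4, k3, k2, k1, a0, a1]
      linarith
    refine s1.trans ?_
    refine integral_mono_ae ((((i1.sub i2).add i3).add i4).sub i5) ?_ ?_
    · have hgen : ∀ (f : ℝ → ℝ) (s : ℝ), TimeLoc f →
          IntegrableOn (fun t => f t * (t ^ s * deriv ζ t)) (Ioi 0) := by
        intro f s hf
        have := (hf.mul_deriv (hζ.mul_left (contDiffOn_rpow s))).sub
          (hf.mul_test (hζ.mul_left (w := fun t => s * t ^ (s - 1))
            (contDiffOn_const.mul (contDiffOn_rpow (s - 1)))))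
        refine this.congr_fun_ae ?_
        filter_upwards [ae_restrict_mem measurableSet_Ioi] with t ht
        simp only [Pi.sub_apply, d s t ht]
        ring
      have := ((hgen I (σ - 2) iI).sub (hgen J (σ - 1) iJ)).add (hgen E σ iE)
      refine this.congr_fun_ae ?_
      filter_upwards [ae_restrict_mem measurableSet_Ioi] with t ht
      have r1 : t ^ (σ - 1) = t ^ (σ - 2) * t := by
        rw [← Real.rpow_add_one (ne_of_gt ht)]; ring_nf
      have r2 : t ^ σ = t ^ (σ - 2) * t ^ 2 := by
        rw [← Real.rpow_natCast, ← Real.rpow_add ht]; norm_num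
      simp only [Pi.sub_apply, Pi.add_apply, hHdef, r1, r2]
      ring
    -- The terms without `deriv ζ` collect into `t^(σ-3) ζ (t²(2E - Q) - (2-σ) H)`, which is
    -- nonpositive by `hH`.
    · filter_upwards [ae_restrict_mem measurableSet_Ioi, hH] with t ht hHt
      simp only [d _ t ht]
      have r0 : t ^ (σ - 2) = t ^ (σ - 3) * t := by
        rw [← Real.rpow_add_one (ne_of_gt ht)]; ring_nf
      have r1 : t ^ (σ - 1) = t ^ (σ - 3) * t ^ 2 := by
        rw [← Real.rpow_natCast, ← Real.rpow_add ht]; norm_num; ring_nf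
      have r2 : t ^ σ = t ^ (σ - 3) * t ^ 3 := by
        rw [← Real.rpow_natCast, ← Real.rpow_add ht]; norm_num
      have r3 : σ - 2 - 1 = σ - 3 := by ring
      have r4 : σ - 1 - 1 = σ - 2 := by ring
      simp only [hHdef, r3, r4, r1, r2, r0]
      have hnn : 0 ≤ t ^ (σ - 3) * ζ t := mul_nonneg (Real.rpow_nonneg (le_of_lt ht) _) (hζ0 t)
      nlinarith [mul_nonneg hnn (sub_nonneg.2 hHt)]
  -- Starting at time `1` keeps the weight below `1`; it may blow up at `0`.
  have hint : ∀ T, IntegrableOn (fun t => t ^ (σ - 2) * H t) (Ioo 1 T) := by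
    intro T
    have hHi : IntegrableOn H (Ioo 1 T) := by
      have sub : Ioo 1 T ⊆ Ioo 0 T := fun t ht => ⟨by linarith [ht.1], ht.2⟩
      have b : ∀ᵐ t ∂(volume.restrict (Ioo 1 T)), ‖t‖ ≤ T := by
        filter_upwards [ae_restrict_mem measurableSet_Ioo] with t ht
        rw [Real.norm_eq_abs, abs_of_pos (by linarith [ht.1])]; exact ht.2.le
      have b2 : ∀ᵐ t ∂(volume.restrict (Ioo 1 T)), ‖t ^ 2‖ ≤ T ^ 2 := by
        filter_upwards [b] with t ht
        rw [norm_pow]; gcongr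
      exact (((iI T).mono_set sub).sub (((iJ T).mono_set sub).bdd_mul
        (by fun_prop) b)).add (((iE T).mono_set sub).bdd_mul (by fun_prop) b2)
    refine hHi.bdd_mul (c := 1) ?_ ?_
    · exact (((contDiffOn_rpow _).continuousOn).mono fun t ht =>
        (by linarith [ht.1] : (0 : ℝ) < t)).aestronglyMeasurable measurableSet_Ioo
    · filter_upwards [ae_restrict_mem measurableSet_Ioo] with t ht
      have ht1 : 1 ≤ t := ht.1.le
      rw [Real.norm_of_nonneg (Real.rpow_nonneg (by linarith) _)]
      exact Real.rpow_le_one_of_one_le_of_nonpos ht1 (by linarith)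
  obtain ⟨S, hS, hS'⟩ := exists_mem_Ioi_of_ae
    (ae_le_of_weak_antitone zero_le_one hint fun ζ hζ _ hζ0 => key ζ hζ hζ0)
  refine ⟨S, hS.le, S ^ (σ - 2) * H S, ?_⟩
  filter_upwards [hS', ae_restrict_mem measurableSet_Ioi] with t ht hSt
  have htpos : 0 < t := by have : S < t := hSt; linarith
  have : t ^ (2 - σ) * t ^ (σ - 2) = 1 := by
    rw [← Real.rpow_add htpos]; simp
  calc H t = t ^ (2 - σ) * (t ^ (σ - 2) * H t) := by rw [← mul_assoc, this, one_mul]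
    _ ≤ t ^ (2 - σ) * (S ^ (σ - 2) * H S) := by
      exact mul_le_mul_of_nonneg_left ht (Real.rpow_nonneg htpos.le _)
    _ = _ := by ring

/-- If `M' = V` with `M - tV ≤ C t^(1-q)`, then `M / t` decreases by at most `O(s^(-q))`
after time `s`. -/
theorem first_moment_growth {q C S : ℝ} (hq : 0 < q) (hC : 0 ≤ C) (hS : 1 ≤ S) {M V : ℝ → ℝ}
    (iM : TimeLoc M) (iV : TimeLoc V)
    (hM : ∀ ξ, IsInteriorTimeTest ξ →
      ∫ t in Ioi (0 : ℝ), M t * deriv ξ t = - ∫ t in Ioi (0 : ℝ), V t * ξ t)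
    (hb : ∀ᵐ t ∂(volume.restrict (Ioi S)), M t - t * V t ≤ C * t ^ (1 - q)) :
    ∀ᵐ s ∂(volume.restrict (Ioi S)), ∀ᵐ t ∂(volume.restrict (Ioi s)),
      M s / s - C / q * s ^ (-q) ≤ M t / t := by
  have hS0 : (0 : ℝ) ≤ S := by linarith
  have hb0 : ∀ᵐ t ∂(volume.restrict (Ioi (0 : ℝ))), S < t → M t - t * V t ≤ C * t ^ (1 - q) := by
    have := (ae_restrict_iff' measurableSet_Ioi).1 hb
    exact ae_restrict_of_ae this
  -- Formally `(C/q t^(-q) - M/t)' = -C t^(-1-q) + (M - tV)/t² ≤ 0`. The power of `t` is a primitive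
  -- of the error, so the corrected quantity is monotone.
  have key : ∀ ζ, IsInteriorTimeTest ζ → tsupport ζ ⊆ Ioi S → (∀ t, 0 ≤ ζ t) →
      0 ≤ ∫ t in Ioi (0 : ℝ), (C / q * t ^ (-q) - M t / t) * deriv ζ t := by
    intro ζ hζ hsupp hζ0
    have e1 := hζ.mul_left (contDiffOn_rpow (-1))
    have e2 := hζ.mul_left (contDiffOn_rpow (-q))
    have d : ∀ s t : ℝ, 0 < t → deriv (fun t => t ^ s * ζ t) t =
        s * t ^ (s - 1) * ζ t + t ^ s * deriv ζ t := fun s t ht =>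
      hζ.deriv_mul_left (Real.hasDerivAt_rpow_const (Or.inl ht.ne'))
    have a1 := hM _ e1
    have a2 := integral_Ioi_deriv_eq_zero e2
    have i1 := iM.mul_deriv e1
    have i2 := iV.mul_test e1
    have i3 : IntegrableOn (deriv fun t => t ^ (-q) * ζ t) (Ioi 0) := by
      simpa using (timeLoc_const 1).mul_deriv e2
    have s1 : 0 ≤ ∫ t in Ioi (0 : ℝ), (C / q * deriv (fun t => t ^ (-q) * ζ t) t
        - (M t * deriv (fun t => t ^ (-1 : ℝ) * ζ t) t + V t * (t ^ (-1 : ℝ) * ζ t))) := by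
      have k1 := integral_add i1 i2
      have k2 := integral_sub (i3.const_mul (C / q)) (i1.add i2)
      simp only [Pi.add_apply] at k1 k2
      rw [k2, k1, integral_const_mul, a1, a2]
      simp
    refine s1.trans ?_
    refine integral_mono_ae ((i3.const_mul _).sub (i1.add i2)) ?_ ?_
    · have hgen : ∀ (f : ℝ → ℝ) (s : ℝ), TimeLoc f →
          IntegrableOn (fun t => f t * (t ^ s * deriv ζ t)) (Ioi 0) := by
        intro f s hf
        have := (hf.mul_deriv (hζ.mul_left (contDiffOn_rpow s))).sub
          (hf.mul_test (hζ.mul_left (w := fun t => s * t ^ (s - 1))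
            (contDiffOn_const.mul (contDiffOn_rpow (s - 1)))))
        refine this.congr_fun_ae ?_
        filter_upwards [ae_restrict_mem measurableSet_Ioi] with t ht
        simp only [Pi.sub_apply, d s t ht]
        ring
      refine ((hgen _ (-q) (timeLoc_const (C / q))).sub (hgen M (-1) iM)).congr_fun_ae ?_
      filter_upwards with t
      simp only [Pi.sub_apply, Real.rpow_neg_one]
      ring
    · filter_upwards [ae_restrict_mem measurableSet_Ioi, hb0] with t ht hbt
      rw [d (-1) t ht, d (-q) t ht]
      simp only [Real.rpow_neg_one]
      by_cases hSt : S < t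
      · have hb' := hbt hSt
        have r1 : t ^ (1 - q) = t ^ (-q - 1) * t ^ 2 := by
          rw [← Real.rpow_natCast, ← Real.rpow_add ht]; norm_num; ring_nf
        have r2 : t ^ (-1 - 1 : ℝ) = (t⁻¹) ^ 2 := by
          rw [show (-1 - 1 : ℝ) = -(2 : ℕ) by norm_num, Real.rpow_neg (le_of_lt ht),
            Real.rpow_natCast, inv_pow]
        rw [r1] at hb'
        rw [r2]
        have ht0 : t ≠ 0 := ne_of_gt ht
        have hnn : 0 ≤ t⁻¹ ^ 2 * ζ t := mul_nonneg (by positivity) (hζ0 t)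
        have := mul_nonneg hnn (sub_nonneg.2 hb')
        have e : t⁻¹ ^ 2 * ζ t * (C * (t ^ (-q - 1) * t ^ 2) - (M t - t * V t)) =
          C * t ^ (-q - 1) * ζ t - M t * t⁻¹ ^ 2 * ζ t + V t * (t⁻¹ * ζ t) := by
          field_simp
          ring
        have e' : C / q * (-q * t ^ (-q - 1) * ζ t + t ^ (-q) * deriv ζ t) =
          - C * t ^ (-q - 1) * ζ t + C / q * t ^ (-q) * deriv ζ t := by
          field_simp
        rw [e] at this
        rw [e', div_eq_mul_inv (M t)]
        linarith
      · have hn : t ∉ tsupport ζ := fun hm => hSt (hsupp hm)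
        have z1 : ζ t = 0 := image_eq_zero_of_notMem_tsupport hn
        have z2 : deriv ζ t = 0 :=
          image_eq_zero_of_notMem_tsupport fun hm => hn (tsupport_deriv_subset hm)
        simp [z1, z2]
  have hint : ∀ T, IntegrableOn (fun t => C / q * t ^ (-q) - M t / t) (Ioo S T) := by
    intro T
    have sub : Ioo S T ⊆ Ioo 0 T := fun t ht => ⟨by linarith [ht.1], ht.2⟩
    have hm : ∀ s : ℝ, AEStronglyMeasurable (fun t : ℝ => t ^ s) (volume.restrict (Ioo S T)) :=
      fun s => (((contDiffOn_rpow s).continuousOn).mono fun t ht =>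
        (sub ht).1).aestronglyMeasurable measurableSet_Ioo
    have hbd : ∀ s : ℝ, s ≤ 0 → ∀ᵐ t ∂(volume.restrict (Ioo S T)), ‖t ^ s‖ ≤ 1 := by
      intro s hs
      filter_upwards [ae_restrict_mem measurableSet_Ioo] with t ht
      have ht1 : 1 ≤ t := hS.trans ht.1.le
      rw [Real.norm_of_nonneg (Real.rpow_nonneg (by linarith) _)]
      exact Real.rpow_le_one_of_one_le_of_nonpos ht1 hs
    have i1 : IntegrableOn (fun t => t ^ (-q) * (C / q)) (Ioo S T) :=
      ((timeLoc_const (C / q) T).mono_set sub).bdd_mul (hm _) (hbd _ (by linarith))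
    have i2 : IntegrableOn (fun t => t ^ (-1 : ℝ) * M t) (Ioo S T) :=
      ((iM T).mono_set sub).bdd_mul (hm _) (hbd _ (by norm_num))
    refine (i1.sub i2).congr_fun_ae ?_
    filter_upwards with t
    simp only [Pi.sub_apply, Real.rpow_neg_one]
    ring
  filter_upwards [ae_le_of_weak_antitone hS0 hint key, ae_restrict_mem measurableSet_Ioi]
    with s hs hSs
  filter_upwards [hs, ae_restrict_mem measurableSet_Ioi] with t ht hst
  have htpos : 0 < t := by
    have h1 : S < s := hSs
    have h2 : s < t := hst
    linarith
  have : 0 ≤ C / q * t ^ (-q) := by positivity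
  have h3 : C / q * t ^ (-q) - M t / t ≤ C / q * s ^ (-q) - M s / s := ht
  linarith

/-- The energy inequality bounds the total dissipation. -/
theorem dissipation_bound {E D : ℝ → ℝ} (iE : TimeLoc E) (iD : TimeLoc D)
    (hE0 : ∀ᵐ t ∂(volume.restrict (Ioi (0 : ℝ))), 0 ≤ E t)
    (hD0 : ∀ᵐ t ∂(volume.restrict (Ioi (0 : ℝ))), 0 ≤ D t)
    (h : ∀ ξ, IsInteriorTimeTest ξ → (∀ t, 0 ≤ ξ t) →
      ∫ t in Ioi (0 : ℝ), D t * ξ t ≤ ∫ t in Ioi (0 : ℝ), E t * deriv ξ t) :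
    ∃ C, ∀ T, ∫ t in Ioo 1 T, D t ≤ C := by
  set θ := Real.smoothTransition
  have hθd : Differentiable ℝ θ :=
    Real.smoothTransition.contDiff (n := 1) |>.differentiable (by norm_num)
  have hθmono : Monotone θ := Real.smoothTransition.monotone
  -- The slope of the rising half of the test function below. It does not depend on `T`, and this
  -- makes the final bound uniform.
  let κ : ℝ → ℝ := fun t => deriv θ (2 * t - 1) * 2
  have hθ' : ∀ x, 0 ≤ deriv θ x := fun x => hθmono.deriv_nonneg
  have hκ : Continuous κ :=
    ((Real.smoothTransition.contDiff (n := 1)).continuous_deriv le_rfl |>.comp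
      (by fun_prop)).mul continuous_const
  have hκc : HasCompactSupport κ := by
    refine HasCompactSupport.intro (isCompact_Icc (a := (0 : ℝ)) (b := 1)) fun t ht => ?_
    have : deriv θ (2 * t - 1) = 0 := by
      rw [mem_Icc, not_and_or, not_le, not_le] at ht
      rcases ht with ht | ht
      · have : θ =ᶠ[𝓝 (2 * t - 1)] fun _ => 0 := by
          filter_upwards [Iio_mem_nhds (show 2 * t - 1 < 0 by linarith)] with y hy
          exact Real.smoothTransition.zero_of_nonpos (le_of_lt hy)
        rw [this.deriv_eq]; simp
      · have : θ =ᶠ[𝓝 (2 * t - 1)] fun _ => 1 := by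
          filter_upwards [Ioi_mem_nhds (show 1 < 2 * t - 1 by linarith)] with y hy
          exact Real.smoothTransition.one_of_one_le (le_of_lt hy)
        rw [this.deriv_eq]; simp
    simp [κ, this]
  have iEκ := iE.mul_compact hκ hκc
  refine ⟨∫ t in Ioi (0 : ℝ), E t * κ t, fun T => ?_⟩
  -- Equal to `1` on `(1, T)`. The falling factor contributes a nonpositive derivative, which can be
  -- discarded because the energy is nonnegative.
  let ξ : ℝ → ℝ := fun t => θ (2 * t - 1) * θ (T + 1 - t)
  have hsupp : Function.support ξ ⊆ Icc (1 / 2) (T + 1) := by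
    intro t ht
    by_contra hout
    apply ht
    rw [mem_Icc, not_and_or, not_le, not_le] at hout
    rcases hout with h1 | h1
    · simp [ξ, θ, Real.smoothTransition.zero_of_nonpos (show 2 * t - 1 ≤ 0 by linarith)]
    · simp [ξ, θ, Real.smoothTransition.zero_of_nonpos (show T + 1 - t ≤ 0 by linarith)]
  have hξ : IsInteriorTimeTest ξ := by
    refine ⟨⟨?_, HasCompactSupport.of_support_subset_isCompact isCompact_Icc hsupp⟩, fun t ht => ?_⟩
    · exact (Real.smoothTransition.contDiff.comp (by fun_prop)).mul
        (Real.smoothTransition.contDiff.comp (by fun_prop))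
    · have := (closure_minimal hsupp isClosed_Icc ht).1
      change 0 < t
      linarith
  have hξ0 : ∀ t, 0 ≤ ξ t := fun t =>
    mul_nonneg (Real.smoothTransition.nonneg _) (Real.smoothTransition.nonneg _)
  have hder : ∀ t, deriv ξ t ≤ κ t := by
    intro t
    have h1 : HasDerivAt (fun t : ℝ => 2 * t - 1) 2 t := by
      simpa using ((hasDerivAt_id t).const_mul 2).sub_const 1
    have h2 : HasDerivAt (fun t : ℝ => T + 1 - t) (-1) t := by
      simpa using (hasDerivAt_id t).const_sub (T + 1)
    have h3 : HasDerivAt ξ _ t := ((hθd _).hasDerivAt.comp t h1).mul ((hθd _).hasDerivAt.comp t h2)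
    rw [h3.deriv]
    simp only [κ, Function.comp]
    have b1 : θ (T + 1 - t) ≤ 1 := Real.smoothTransition.le_one _
    have b2 : 0 ≤ θ (2 * t - 1) := Real.smoothTransition.nonneg _
    nlinarith [hθ' (2 * t - 1), mul_nonneg b2 (hθ' (T + 1 - t)),
      mul_nonneg (hθ' (2 * t - 1)) (sub_nonneg.2 b1)]
  calc ∫ t in Ioo 1 T, D t = ∫ t in Ioo 1 T, D t * ξ t := by
        refine setIntegral_congr_fun measurableSet_Ioo fun t ht => ?_
        have e1 : θ (2 * t - 1) = 1 := Real.smoothTransition.one_of_one_le (by linarith [ht.1])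
        have e2 : θ (T + 1 - t) = 1 := Real.smoothTransition.one_of_one_le (by linarith [ht.2])
        simp [ξ, e1, e2]
    _ ≤ ∫ t in Ioi (0 : ℝ), D t * ξ t := by
        refine setIntegral_mono_set (iD.mul_test hξ) ?_ ?_
        · filter_upwards [hD0] with t ht using mul_nonneg ht (hξ0 t)
        · exact LE.le.eventuallyLE fun t ht => lt_trans one_pos ht.1
    _ ≤ ∫ t in Ioi (0 : ℝ), E t * deriv ξ t := h ξ hξ hξ0
    _ ≤ ∫ t in Ioi (0 : ℝ), E t * κ t := by
        refine integral_mono_ae (iE.mul_deriv hξ) iEκ ?_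
        filter_upwards [hE0] with t ht using mul_le_mul_of_nonneg_left (hder t) ht

theorem not_ae_le_of_integral_bound {D : ℝ → ℝ} (iD : TimeLoc D)
    (hD0 : ∀ᵐ t ∂(volume.restrict (Ioi (0 : ℝ))), 0 ≤ D t) {C : ℝ}
    (h : ∀ T, ∫ t in Ioo 1 T, D t ≤ C) {δ : ℝ} (hδ : 0 < δ) (S : ℝ) :
    ¬ ∀ᵐ t ∂(volume.restrict (Ioi S)), δ ≤ D t := by
  intro hall
  set S' := max S 1
  have hS1 : 1 ≤ S' := le_max_right _ _
  -- Long enough for the constant `δ` alone to integrate to `|C| + 1`, which exceeds `C`.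
  set T := S' + (|C| + 1) / δ
  have hT : S' ≤ T := le_add_of_nonneg_right (by positivity)
  have sub : Ioo S' T ⊆ Ioo 1 T := Ioo_subset_Ioo_left hS1
  have sub' : Ioo 1 T ⊆ Ioo 0 T := Ioo_subset_Ioo_left zero_le_one
  have i1 : IntegrableOn D (Ioo 1 T) := (iD T).mono_set sub'
  have h1 : ∫ t in Ioo S' T, δ ≤ ∫ t in Ioo S' T, D t := by
    refine integral_mono_ae (by simp) (i1.mono_set sub) ?_
    exact ae_restrict_of_ae_restrict_of_subset (fun t ht => (le_max_left S 1).trans_lt ht.1) hall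
  have h2 : ∫ t in Ioo S' T, D t ≤ ∫ t in Ioo 1 T, D t := by
    refine setIntegral_mono_set i1 ?_ (LE.le.eventuallyLE sub)
    exact ae_restrict_of_ae_restrict_of_subset (fun t ht => lt_trans one_pos ht.1) hD0
  have h3 : ∫ t in Ioo S' T, δ = |C| + 1 := by
    simp [T, Real.volume_real_Ioo_of_le hT]
    field_simp
  linarith [h T, le_abs_self C]

/-! ### Space-time integrability and finite moments. -/

variable {N : ℕ}

/-- Lebesgue measure on the space-time slab `s × ℝᴺ`. -/
abbrev slab (N : ℕ) (s : Set ℝ) : Measure (ℝ × Space N) :=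
  (volume.restrict s).prod (volume : Measure (Space N))

theorem slab_eq_restrict (N : ℕ) (s : Set ℝ) :
    slab N s = (volume : Measure (ℝ × Space N)).restrict (s ×ˢ univ) := by
  have := Measure.prod_restrict (μ := (volume : Measure ℝ)) (ν := (volume : Measure (Space N)))
    s univ
  rw [Measure.restrict_univ] at this
  exact this

theorem slab_mono {N : ℕ} {s t : Set ℝ} (h : s ⊆ t) : slab N s ≤ slab N t := by
  rw [slab_eq_restrict, slab_eq_restrict]
  exact Measure.restrict_mono (prod_mono_left h) le_rfl

/-- Measurability on `(0, ∞) × ℝᴺ`. -/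
def SpaceTimeMeasurable {N : ℕ} {F : Type*} [NormedAddCommGroup F] (g : ℝ → Space N → F) : Prop :=
  AEStronglyMeasurable (fun z : ℝ × Space N => g z.1 z.2) (slab N (Ioi 0))

/-- Integrability on `(0, T) × ℝᴺ` for every `T`. -/
def SpaceTimeLoc {N : ℕ} {F : Type*} [NormedAddCommGroup F] (g : ℝ → Space N → F) : Prop :=
  ∀ T : ℝ, Integrable (fun z : ℝ × Space N => g z.1 z.2) (slab N (Ioo 0 T))


theorem ae_Ioi_of_forall_Ioo {p : ℝ → Prop}
    (h : ∀ T : ℝ, ∀ᵐ t ∂(volume.restrict (Ioo 0 T)), p t) :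
    ∀ᵐ t ∂(volume.restrict (Ioi (0 : ℝ))), p t := by
  have : Ioi (0 : ℝ) = ⋃ n : ℕ, Ioo 0 (n : ℝ) := by
    ext t
    simp only [mem_Ioi, mem_iUnion, mem_Ioo, exists_and_left]
    exact ⟨fun ht => ⟨ht, exists_nat_gt t⟩, fun ht => ht.1⟩
  rw [this, ae_restrict_iUnion_iff]
  exact fun n => h n

theorem SpaceTimeLoc.ae_integrable {F : Type*} [NormedAddCommGroup F] {g : ℝ → Space N → F}
    (h : SpaceTimeLoc g) : ∀ᵐ t ∂(volume.restrict (Ioi (0 : ℝ))), Integrable (g t) :=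
  ae_Ioi_of_forall_Ioo fun T => (h T).prod_right_ae

theorem SpaceTimeLoc.timeLoc {g : ℝ → Space N → ℝ} (h : SpaceTimeLoc g) :
    TimeLoc fun t => ∫ x, g t x := fun T => (h T).integral_prod_left

theorem SpaceTimeLoc.mono {F F' : Type*} [NormedAddCommGroup F] [NormedAddCommGroup F']
    {g : ℝ → Space N → F} {G : ℝ → Space N → F'}
    (hG : SpaceTimeLoc G) (hm : SpaceTimeMeasurable g) (hle : ∀ t x, ‖g t x‖ ≤ ‖G t x‖) :
    SpaceTimeLoc g := fun T =>
  (hG T).mono (hm.mono_measure (slab_mono Ioo_subset_Ioi_self))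
    (Eventually.of_forall fun z => hle z.1 z.2)

theorem SpaceTimeLoc.add {F : Type*} [NormedAddCommGroup F] {g g' : ℝ → Space N → F}
    (h : SpaceTimeLoc g) (h' : SpaceTimeLoc g') : SpaceTimeLoc fun t x => g t x + g' t x :=
  fun T => (h T).add (h' T)

theorem SpaceTimeLoc.const_mul {g : ℝ → Space N → ℝ} (h : SpaceTimeLoc g) (c : ℝ) :
    SpaceTimeLoc fun t x => c * g t x := fun T => (h T).const_mul c

theorem SpaceTimeLoc.norm {F : Type*} [NormedAddCommGroup F] {g : ℝ → Space N → F}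
    (h : SpaceTimeLoc g) : SpaceTimeLoc fun t x => ‖g t x‖ := fun T => (h T).norm

theorem spaceTimeLoc_of_pos {F : Type*} [NormedAddCommGroup F] {g : ℝ → Space N → F}
    (h : ∀ T : ℝ, 0 < T → Integrable (fun z : ℝ × Space N => g z.1 z.2) (slab N (Ioo 0 T))) :
    SpaceTimeLoc g := fun T => by
  rcases lt_or_ge 0 T with hT | hT
  · exact h T hT
  · simp [slab, Ioo_eq_empty (not_lt.2 hT)]

theorem MemLpLqLoc.spaceTimeLoc_one {F : Type*} [NormedAddCommGroup F] {g : ℝ → Space N → F}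
    (h : MemLpLqLoc 1 1 g) : SpaceTimeLoc g := spaceTimeLoc_of_pos fun T hT => by
  obtain ⟨hm, hfin⟩ := h T hT
  refine ⟨hm, ?_⟩
  rw [hasFiniteIntegral_iff_enorm, lintegral_prod _ hm.enorm]
  simpa [eLpNorm_one_eq_lintegral_enorm] using hfin

theorem MemLpLqLoc.spaceTimeLoc_top {F : Type*} [NormedAddCommGroup F] {g : ℝ → Space N → F}
    (h : MemLpLqLoc ∞ 1 g) : SpaceTimeLoc g := spaceTimeLoc_of_pos fun T hT => by
  obtain ⟨hm, hfin⟩ := h T hT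
  refine ⟨hm, ?_⟩
  rw [hasFiniteIntegral_iff_enorm, lintegral_prod _ hm.enorm]
  set A := eLpNorm (fun t : ℝ => eLpNorm (g t) 1 volume) ∞ (volume.restrict (Ioo 0 T)) with hA
  have hle : ∀ᵐ t ∂(volume.restrict (Ioo 0 T)), ∫⁻ x, ‖g t x‖ₑ ≤ A := by
    rw [hA, eLpNorm_exponent_top]
    filter_upwards [enorm_ae_le_eLpNormEssSup (fun t : ℝ => eLpNorm (g t) 1 volume)
      (volume.restrict (Ioo 0 T))] with t ht
    simpa [eLpNorm_one_eq_lintegral_enorm] using ht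
  calc ∫⁻ t in Ioo 0 T, ∫⁻ x, ‖g t x‖ₑ ≤ ∫⁻ t in Ioo 0 T, A := lintegral_mono_ae hle
    _ < ⊤ := by
      rw [lintegral_const]
      exact ENNReal.mul_lt_top hfin (by simp)

theorem MemLpLqLoc.spaceTimeLoc_sq {F : Type*} [NormedAddCommGroup F] {g : ℝ → Space N → F}
    (h : MemLpLqLoc 2 2 g) : SpaceTimeLoc fun t x => ‖g t x‖ ^ 2 :=
  spaceTimeLoc_of_pos fun T hT => by
  obtain ⟨hm, hfin⟩ := h T hT
  have hm2 : AEStronglyMeasurable (fun z : ℝ × Space N => ‖g z.1 z.2‖ ^ 2) (slab N (Ioo 0 T)) :=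
    hm.norm.pow 2
  refine ⟨hm2, ?_⟩
  rw [hasFiniteIntegral_iff_enorm, lintegral_prod _ hm2.enorm]
  have := lintegral_rpow_enorm_lt_top_of_eLpNorm_lt_top (by norm_num) (by norm_num) hfin
  refine lt_of_le_of_lt (le_of_eq ?_) this
  congr 1 with t
  rw [enorm_eq_self, eLpNorm_eq_lintegral_rpow_enorm_toReal (by norm_num) (by norm_num),
    ← ENNReal.rpow_mul]
  simp

theorem SpaceTimeMeasurable.integral {g : ℝ → Space N → ℝ} (h : SpaceTimeMeasurable g) :
    AEStronglyMeasurable (fun t => ∫ x, g t x) (volume.restrict (Ioi 0)) :=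
  AEStronglyMeasurable.integral_prod_right' h

theorem SpaceTimeMeasurable.ae {F : Type*} [NormedAddCommGroup F] {g : ℝ → Space N → F}
    (h : SpaceTimeMeasurable g) :
    ∀ᵐ t ∂(volume.restrict (Ioi (0 : ℝ))), AEStronglyMeasurable (g t) volume :=
  AEStronglyMeasurable.prodMk_left h

/-- Dominated convergence for space-time integrals tested in time. -/
theorem tendsto_integral_space_time {F : ℕ → ℝ → Space N → ℝ} {f G : ℝ → Space N → ℝ} {ξ : ℝ → ℝ}
    (hG : SpaceTimeLoc G) (hm : ∀ n, SpaceTimeMeasurable (F n))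
    (hle : ∀ᶠ n in atTop, ∀ t x, |F n t x| ≤ G t x)
    (hlim : ∀ t x, Tendsto (fun n => F n t x) atTop (𝓝 (f t x)))
    (hξ : Continuous ξ) (hc : HasCompactSupport ξ) :
    Tendsto (fun n => ∫ t in Ioi (0 : ℝ), ∫ x, F n t x * ξ t) atTop
      (𝓝 (∫ t in Ioi (0 : ℝ), (∫ x, f t x) * ξ t)) := by
  simp only [integral_mul_const]
  have hGi := hG.timeLoc.mul_compact hξ.norm hc.norm
  have hmt : ∀ᵐ t ∂(volume.restrict (Ioi (0 : ℝ))), ∀ n, AEStronglyMeasurable (F n t) volume :=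
    ae_all_iff.2 fun n => (hm n).ae
  apply tendsto_integral_filter_of_dominated_convergence _ _ _ hGi
  · filter_upwards [hG.ae_integrable, hmt] with t ht hmt
    refine Tendsto.mul_const _ ?_
    apply tendsto_integral_filter_of_dominated_convergence (G t) _ _ ht
    · exact Eventually.of_forall fun x => hlim t x
    · exact Eventually.of_forall fun n => hmt n
    · filter_upwards [hle] with n hn
      exact Eventually.of_forall fun x => hn t x
  · exact Eventually.of_forall fun n => (hm n).integral.mul hξ.aestronglyMeasurable
  · filter_upwards [hle] with n hn
    filter_upwards [hG.ae_integrable] with t ht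
    rw [norm_mul]
    gcongr
    exact norm_integral_le_of_norm_le ht (Eventually.of_forall fun x => hn t x)

/-- The integrability of a density and a velocity field that makes their moments meaningful. -/
structure FiniteMoments (γ : ℝ) (ρ : ℝ → Space N → ℝ) (v : ℝ → Space N → Space N) : Prop where
  measurable_density : SpaceTimeMeasurable ρ
  measurable_velocity : SpaceTimeMeasurable v
  nonneg : ∀ᵐ t ∂(volume.restrict (Ioi (0 : ℝ))), ∀ᵐ x, 0 ≤ ρ t x
  mass : SpaceTimeLoc ρ
  inertia : SpaceTimeLoc fun t x => ρ t x * ‖x‖ ^ 2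
  kinetic : SpaceTimeLoc fun t x => ρ t x * ‖v t x‖ ^ 2
  internal : SpaceTimeLoc fun t x => ρ t x ^ γ

theorem spaceTimeMeasurable_space {F : Type*} [NormedAddCommGroup F] {g : Space N → F}
    (hg : Continuous g) : SpaceTimeMeasurable fun _ : ℝ => g :=
  (hg.comp continuous_snd).aestronglyMeasurable

/-- Finite mass is derived rather than assumed: in the unit ball `ρ ≤ 1 + ρ^γ`, and outside it `ρ ≤
ρ‖x‖²`. -/
theorem IsFiniteEnergyWeakSolution.finiteMoments {a γ μ lam : ℝ} (hγ : 1 < γ)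
    {f : ℝ → Space N → Space N} {ρ₀ : Space N → ℝ} {v₀ : Space N → Space N}
    {ρ : ℝ → Space N → ℝ} {v : ℝ → Space N → Space N}
    (h : IsFiniteEnergyWeakSolution a γ μ lam f ρ₀ v₀ ρ v)
    (hx : MemLpLqLoc 1 1 (fun t x => ρ t x * ‖x‖ ^ 2)) : FiniteMoments γ ρ v := by
  have hmρ : SpaceTimeMeasurable ρ := by
    have := h.density.aestronglyMeasurable (μ := volume)
    rw [← slab_eq_restrict] at this
    exact this
  obtain ⟨G, ⟨hmv, -, -⟩, -⟩ := h.viscous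
  have hp := h.internal.spaceTimeLoc_top
  refine ⟨hmρ, hmv, Measure.ae_ae_of_ae_prod h.nonneg, ?_, hx.spaceTimeLoc_one,
    h.kinetic.spaceTimeLoc_top, hp⟩
  have hball : SpaceTimeLoc fun (_ : ℝ) (x : Space N) => (Metric.closedBall 0 1).indicator
      (fun _ => (1 : ℝ)) x := fun T => by
    have h1 : Integrable (fun x : Space N => (Metric.closedBall 0 1).indicator
        (fun _ => (1 : ℝ)) x) volume :=
      (integrable_indicator_iff Metric.isClosed_closedBall.measurableSet).2
        (integrableOn_const (measure_closedBall_lt_top).ne)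
    have h2 : Integrable (fun _ : ℝ => (1 : ℝ)) (volume.restrict (Ioo 0 T)) := timeLoc_const 1 T
    simpa using h2.mul_prod h1
  have hsum := (hball.add hp.norm).add hx.spaceTimeLoc_one.norm
  intro T
  have hnn : ∀ᵐ z ∂(slab N (Ioo 0 T)), 0 ≤ ρ z.1 z.2 :=
    (Measure.absolutelyContinuous_of_le (slab_mono Ioo_subset_Ioi_self)).ae_le h.nonneg
  refine (hsum T).mono' (hmρ.mono_measure (slab_mono Ioo_subset_Ioi_self)) ?_
  filter_upwards [hnn] with z hz
  rw [Real.norm_of_nonneg hz]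
  have hpn : 0 ≤ ρ z.1 z.2 ^ γ := Real.rpow_nonneg hz _
  rw [Real.norm_of_nonneg hpn, Real.norm_of_nonneg (by positivity)]
  by_cases hb : ‖z.2‖ ≤ 1
  · rw [indicator_of_mem (by simpa using hb)]
    have : ρ z.1 z.2 ≤ 1 + ρ z.1 z.2 ^ γ := by
      rcases le_total (ρ z.1 z.2) 1 with h1 | h1
      · linarith
      · have := Real.rpow_le_rpow_of_exponent_le h1 hγ.le
        rw [Real.rpow_one] at this
        linarith
    have := mul_nonneg hz (sq_nonneg ‖z.2‖)
    linarith
  · rw [indicator_of_notMem (by simpa using hb)]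
    have h1 : 1 ≤ ‖z.2‖ ^ 2 := one_le_pow₀ (not_le.1 hb).le
    nlinarith [mul_nonneg hz (sub_nonneg.2 h1)]


theorem spaceTimeMeasurable_density_mul {γ : ℝ} {ρ : ℝ → Space N → ℝ} {v : ℝ → Space N → Space N}
    (h : FiniteMoments γ ρ v) {g : Space N → ℝ} (hg : Continuous g) :
    SpaceTimeMeasurable fun t x => ρ t x * g x :=
  h.measurable_density.mul (spaceTimeMeasurable_space hg)

theorem spaceTimeMeasurable_flux {γ : ℝ} {ρ : ℝ → Space N → ℝ} {v : ℝ → Space N → Space N}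
    (h : FiniteMoments γ ρ v) {g : Space N → Space N} (hg : Continuous g) :
    SpaceTimeMeasurable fun t x => ρ t x * inner ℝ (v t x) (g x) :=
  h.measurable_density.mul (h.measurable_velocity.inner (spaceTimeMeasurable_space hg))

/-- A common majorant of all the densities whose moments are considered. -/
theorem FiniteMoments.majorant {γ : ℝ} {ρ : ℝ → Space N → ℝ} {v : ℝ → Space N → Space N}
    (h : FiniteMoments γ ρ v) :
    SpaceTimeLoc fun t x => |ρ t x| * (1 + ‖x‖ ^ 2 + ‖v t x‖ ^ 2) := by
  have := (h.mass.norm.add h.inertia.norm).add h.kinetic.norm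
  intro T
  refine (this T).congr (Eventually.of_forall fun z => ?_)
  simp only [norm_mul, Real.norm_eq_abs, norm_pow, abs_norm]
  ring

theorem mul_one_add_le (a b : ℝ) : a * (1 + b) ≤ 1 + b ^ 2 + a ^ 2 := by
  nlinarith [sq_nonneg (a - b), sq_nonneg (a - 1), sq_nonneg b]

theorem FiniteMoments.loc_density {γ : ℝ} {ρ : ℝ → Space N → ℝ} {v : ℝ → Space N → Space N}
    (h : FiniteMoments γ ρ v) {g : Space N → ℝ} (hg : Continuous g) {C : ℝ}
    (hb : ∀ x, |g x| ≤ C * (1 + ‖x‖ ^ 2)) : SpaceTimeLoc fun t x => ρ t x * g x := by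
  refine (h.majorant.const_mul C).mono (spaceTimeMeasurable_density_mul h hg) fun t x => ?_
  rw [norm_mul, Real.norm_eq_abs, Real.norm_eq_abs]
  have hC : 0 ≤ C := by
    have := (abs_nonneg _).trans (hb 0); simpa using this
  refine le_trans ?_ (le_abs_self _)
  have : |ρ t x| * |g x| ≤ |ρ t x| * (C * (1 + ‖x‖ ^ 2)) := by gcongr; exact hb x
  have h2 : 0 ≤ C * |ρ t x| * ‖v t x‖ ^ 2 := by positivity
  linarith

/-- Young's inequality lets inertia, mass and kinetic energy control the momentum paired with any
field of linear growth. -/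
theorem flux_le {r C : ℝ} {u y x : Space N} (hy : ‖y‖ ≤ C * (1 + ‖x‖)) (hC : 0 ≤ C) :
    |r * inner ℝ u y| ≤ C * (|r| * (1 + ‖x‖ ^ 2 + ‖u‖ ^ 2)) := by
  rw [abs_mul]
  have h1 : |inner ℝ u y| ≤ ‖u‖ * (C * (1 + ‖x‖)) :=
    (abs_real_inner_le_norm u y).trans (by gcongr)
  have h2 := mul_one_add_le ‖u‖ ‖x‖
  calc |r| * |inner ℝ u y| ≤ |r| * (‖u‖ * (C * (1 + ‖x‖))) := by gcongr
    _ = C * (|r| * (‖u‖ * (1 + ‖x‖))) := by ring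
    _ ≤ _ := by gcongr

theorem FiniteMoments.loc_flux {γ : ℝ} {ρ : ℝ → Space N → ℝ} {v : ℝ → Space N → Space N}
    (h : FiniteMoments γ ρ v) {g : Space N → Space N} (hg : Continuous g) {C : ℝ}
    (hb : ∀ x, ‖g x‖ ≤ C * (1 + ‖x‖)) :
    SpaceTimeLoc fun t x => ρ t x * inner ℝ (v t x) (g x) := by
  refine (h.majorant.const_mul C).mono (spaceTimeMeasurable_flux h hg) fun t x => ?_
  have hC : 0 ≤ C := by
    have := (norm_nonneg _).trans (hb 0); simpa using this
  exact (flux_le (hb x) hC).trans (le_abs_self _)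

theorem norm_inv_smul_lt_one {n : ℕ} {x : Space N} (h : ‖x‖ < n) : ‖(n : ℝ)⁻¹ • x‖ < 1 := by
  have hn : (0 : ℝ) < n := (norm_nonneg x).trans_lt h
  rw [norm_smul, norm_inv, Real.norm_natCast, inv_mul_lt_iff₀ hn, mul_one]
  exact h

theorem continuous_gradient {h : Space N → ℝ} (hh : ContDiff ℝ ∞ h) : Continuous (gradient h) := by
  unfold gradient
  exact (InnerProductSpace.toDual ℝ (Space N)).symm.continuous.comp
    (hh.continuous_fderiv (by norm_num))

theorem norm_gradient_eq (h : Space N → ℝ) (x : Space N) : ‖gradient h x‖ = ‖fderiv ℝ h x‖ := by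
  simp [gradient]

theorem gradient_mul {f g : Space N → ℝ} {x : Space N} (hf : DifferentiableAt ℝ f x)
    (hg : DifferentiableAt ℝ g x) :
    gradient (fun x => f x * g x) x = f x • gradient g x + g x • gradient f x := by
  simp [gradient, fderiv_fun_mul hf hg]

theorem gradient_comp_smul (f : Space N → ℝ) (c : ℝ) (x : Space N) :
    gradient (fun x => f (c • x)) x = c • gradient f (c • x) := by
  simp [gradient, fderiv_comp_smul (f := f)]

/-! ### Moments of the continuity equation. -/

/-- The weak continuity equation tested with a smooth function of at most quadratic growth. -/
theorem moment_identity {γ : ℝ} {ρ₀ : Space N → ℝ} {ρ : ℝ → Space N → ℝ}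
    {v : ℝ → Space N → Space N} (hm : FiniteMoments γ ρ v) (hc : ContinuityEquation ρ₀ ρ v)
    {h : Space N → ℝ} (hh : ContDiff ℝ ∞ h) {C : ℝ} (hb : ∀ x, |h x| ≤ C * (1 + ‖x‖ ^ 2))
    (hb' : ∀ x, ‖gradient h x‖ ≤ C * (1 + ‖x‖)) {ξ : ℝ → ℝ} (hξ : IsInteriorTimeTest ξ) :
    ∫ t in Ioi (0 : ℝ), (∫ x, ρ t x * h x) * deriv ξ t =
      - ∫ t in Ioi (0 : ℝ), (∫ x, ρ t x * inner ℝ (v t x) (gradient h x)) * ξ t := by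
  have hC : 0 ≤ C := by
    have := (norm_nonneg _).trans (hb' 0); simpa using this
  set χ : ℕ → Space N → ℝ := fun n x => cutoff N ((n : ℝ)⁻¹ • x) with hχ
  have hχt : ∀ n ≠ 0, IsTest (χ n) := fun n hn => (isTest_cutoff N).comp_inv_smul hn
  have hχs : ∀ n, ContDiff ℝ ∞ (χ n) := fun n => (isTest_cutoff N).1.comp (by fun_prop)
  have hχ1 : ∀ n x, |χ n x| ≤ 1 := fun n x => by
    rw [abs_of_nonneg (cutoff N).nonneg]; exact (cutoff N).le_one
  obtain ⟨B, hB⟩ :=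
    ((isTest_cutoff N).1.continuous_fderiv (by norm_num)).bounded_above_of_compact_support
    ((isTest_cutoff N).2.fderiv ℝ)
  have hB0 : 0 ≤ B := (norm_nonneg _).trans (hB 0)
  have hgrad : ∀ n x, gradient (fun x => χ n x * h x) x =
      χ n x • gradient h x + (h x * (n : ℝ)⁻¹) • gradient (cutoff N) ((n : ℝ)⁻¹ • x) := by
    intro n x
    rw [gradient_mul ((hχs n).differentiable (by norm_num) x) (hh.differentiable (by norm_num) x),
      gradient_comp_smul, smul_smul]
  -- A linear bound independent of `n`, needed for dominated convergence. Quadratic growth of `h` is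
  -- allowed because the gradient of the cutoff carries a factor `1/n` and is supported in `‖x‖ ≤
  -- 2n`.
  have hgb : ∀ n x, n ≠ 0 → ‖gradient (fun x => χ n x * h x) x‖ ≤ (C + C * 3 * B) * (1 + ‖x‖) := by
    intro n x hn
    rw [hgrad]
    have hn1 : (1 : ℝ) ≤ n := by exact_mod_cast Nat.one_le_iff_ne_zero.2 hn
    have h1 : ‖χ n x • gradient h x‖ ≤ C * (1 + ‖x‖) := by
      rw [norm_smul]
      exact (mul_le_of_le_one_left (norm_nonneg _) (hχ1 n x)).trans (hb' x)
    have h2 : ‖(h x * (n : ℝ)⁻¹) • gradient (cutoff N) ((n : ℝ)⁻¹ • x)‖ ≤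
        C * 3 * B * (1 + ‖x‖) := by
      rw [norm_smul, norm_gradient_eq]
      by_cases hx : ‖x‖ ≤ 2 * n
      · have e1 : ‖h x * (n : ℝ)⁻¹‖ ≤ C * 3 * (1 + ‖x‖) := by
          rw [norm_mul, norm_inv, Real.norm_natCast, ← div_eq_mul_inv, div_le_iff₀ (by linarith)]
          refine (hb x).trans ?_
          have : 1 + ‖x‖ ^ 2 ≤ 3 * (1 + ‖x‖) * n := by
            nlinarith [norm_nonneg x, mul_nonneg (norm_nonneg x) (sub_nonneg.2 hn1)]
          calc C * (1 + ‖x‖ ^ 2) ≤ C * (3 * (1 + ‖x‖) * n) := by gcongr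
            _ = _ := by ring
        calc _ ≤ C * 3 * (1 + ‖x‖) * B := by gcongr; exact hB _
          _ = _ := by ring
      · have : fderiv ℝ (cutoff N) ((n : ℝ)⁻¹ • x) = 0 := by
          refine image_eq_zero_of_notMem_tsupport fun hmem => hx ?_
          have := tsupport_fderiv_subset ℝ hmem
          rw [(cutoff N).tsupport_eq, mem_closedBall_zero_iff, norm_smul, norm_inv,
            Real.norm_natCast, inv_mul_le_iff₀ (by linarith)] at this
          simpa [cutoff, mul_comm] using this
        rw [this, norm_zero, mul_zero]; positivity
    calc _ ≤ _ := norm_add_le _ _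
      _ ≤ C * (1 + ‖x‖) + C * 3 * B * (1 + ‖x‖) := add_le_add h1 h2
      _ = _ := by ring
  have hψs : ∀ n, ContDiff ℝ ∞ (fun x => χ n x * h x) := fun n => (hχs n).mul hh
  have heq : ∀ n ≠ 0, (∫ t in Ioi (0 : ℝ), ∫ x, ρ t x * (χ n x * h x) * deriv ξ t) =
      - ∫ t in Ioi (0 : ℝ), ∫ x,
          ρ t x * inner ℝ (v t x) (gradient (fun x => χ n x * h x) x) * ξ t := by
    intro n hn
    have := hc _ ⟨hψs n, (hχt n hn).2.mul_right⟩ ξ hξ.isTimeTest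
    rw [hξ.eq_zero le_rfl] at this
    linarith
  have hev : ∀ x : Space N, ∀ᶠ n : ℕ in atTop, ‖(n : ℝ)⁻¹ • x‖ < 1 := fun x => by
    obtain ⟨m, hm⟩ := exists_nat_gt ‖x‖
    filter_upwards [eventually_ge_atTop m] with n hn
    exact norm_inv_smul_lt_one (hm.trans_le (by exact_mod_cast hn))
  have hlim1 := tendsto_integral_space_time (F := fun n t x => ρ t x * (χ n x * h x))
    (f := fun t x => ρ t x * h x) (ξ := deriv ξ) (hm.majorant.const_mul C)
    (fun n => spaceTimeMeasurable_density_mul hm (hψs n).continuous)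
    (Eventually.of_forall fun n t x => by
      rw [abs_mul, abs_mul]
      have h1 : |χ n x| * |h x| ≤ C * (1 + ‖x‖ ^ 2) :=
        (mul_le_of_le_one_left (abs_nonneg _) (hχ1 n x)).trans (hb x)
      have h2 : |ρ t x| * (|χ n x| * |h x|) ≤ |ρ t x| * (C * (1 + ‖x‖ ^ 2)) := by gcongr
      have h3 : 0 ≤ C * |ρ t x| * ‖v t x‖ ^ 2 := by positivity
      linarith)
    (fun t x => by
      apply tendsto_const_nhds.congr'
      filter_upwards [hev x] with n hn
      rw [hχ]
      simp only [cutoff_eq_one hn.le, one_mul])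
    hξ.deriv_continuous hξ.1.2.deriv
  have hlim2 := tendsto_integral_space_time
    (F := fun n t x => ρ t x * inner ℝ (v t x) (gradient (fun x => χ n x * h x) x))
    (f := fun t x => ρ t x * inner ℝ (v t x) (gradient h x)) (ξ := ξ)
    (hm.majorant.const_mul (C + C * 3 * B))
    (fun n => spaceTimeMeasurable_flux hm (continuous_gradient (hψs n)))
    (by
      filter_upwards [eventually_ne_atTop 0] with n hn t x
      exact flux_le (hgb n x hn) (by positivity))
    (fun t x => by
      apply tendsto_const_nhds.congr'
      filter_upwards [hev x] with n hn
      rw [hgrad, hχ]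
      have : gradient (cutoff N) ((n : ℝ)⁻¹ • x) = 0 := by
        simp [gradient, fderiv_cutoff_eq_zero hn]
      simp only [cutoff_eq_one hn.le, one_smul, this, smul_zero, add_zero])
    hξ.1.1.continuous hξ.1.2
  refine tendsto_nhds_unique hlim1 (hlim2.neg.congr' ?_)
  filter_upwards [eventually_ne_atTop 0] with n hn
  exact (heq n hn).symm


/-! ### Test fields approximating the position vector. -/

theorem IsTest.gradient {ψ : Space N → ℝ} (h : IsTest ψ) : IsTest (gradient ψ) :=
  ⟨(InnerProductSpace.toDual ℝ (Space N)).symm.contDiff.comp (h.1.fderiv_right (m := ∞) le_rfl),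
    (h.2.fderiv ℝ).comp_left (map_zero _)⟩

theorem IsTest.divergence {φ : Space N → Space N} (h : IsTest φ) : IsTest (divergence φ) := by
  constructor
  · refine ContDiff.sum fun i _ => ?_
    have h1 : ContDiff ℝ ∞ fun x => fderiv ℝ φ x (EuclideanSpace.single i 1) :=
      (h.1.fderiv_right (m := ∞) le_rfl).clm_apply contDiff_const
    exact (EuclideanSpace.proj (𝕜 := ℝ) i).contDiff.comp h1
  · exact (h.2.fderiv ℝ).comp_left (g := fun L : Space N →L[ℝ] Space N =>
      ∑ i : Fin N, L (EuclideanSpace.single i 1) i) (by simp)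

theorem laplacian_apply (φ : Space N → Space N) (x : Space N) :
    Laplacian.laplacian φ x = ∑ i, fderiv ℝ (fderiv ℝ φ) x (stdOrthonormalBasis ℝ (Space N) i)
      (stdOrthonormalBasis ℝ (Space N) i) := by
  rw [InnerProductSpace.laplacian_eq_iteratedFDeriv_stdOrthonormalBasis]
  simp [iteratedFDeriv_two_apply]

theorem IsTest.laplacian {φ : Space N → Space N} (h : IsTest φ) :
    Continuous (Laplacian.laplacian φ) ∧ HasCompactSupport (Laplacian.laplacian φ) := by
  have e : Laplacian.laplacian φ = fun x => ∑ i, fderiv ℝ (fderiv ℝ φ) x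
      (stdOrthonormalBasis ℝ (Space N) i) (stdOrthonormalBasis ℝ (Space N) i) :=
    funext fun x => laplacian_apply φ x
  have h2 : ContDiff ℝ ∞ (fderiv ℝ φ) := h.1.fderiv_right (m := ∞) le_rfl
  rw [e]
  constructor
  · refine continuous_finsetSum _ fun i _ => ?_
    exact ((h2.continuous_fderiv (by norm_num)).clm_apply continuous_const).clm_apply
      continuous_const
  · exact ((h.2.fderiv ℝ).fderiv ℝ).comp_left
      (g := fun L : Space N →L[ℝ] Space N →L[ℝ] Space N => ∑ i,
        L (stdOrthonormalBasis ℝ (Space N) i) (stdOrthonormalBasis ℝ (Space N) i)) (by simp)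

section Scaling

variable {φ : Space N → Space N} {n : ℕ}

/-- The prefactor `n` makes first derivatives scale-invariant, so the convective and pressure terms
survive in the limit. Second derivatives keep a factor `1/n`, so the viscous weights have the
critical `L^N` scaling. -/
theorem fderiv_scaled (hn : n ≠ 0) (x : Space N) :
    fderiv ℝ (fun x => (n : ℝ) • φ ((n : ℝ)⁻¹ • x)) x = fderiv ℝ φ ((n : ℝ)⁻¹ • x) := by
  have hn' : (n : ℝ) ≠ 0 := by exact_mod_cast hn
  have := invertibleOfNonzero hn'
  change fderiv ℝ ((n : ℝ) • fun x => φ ((n : ℝ)⁻¹ • x)) x = _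
  rw [fderiv_const_smul_of_invertible, fderiv_comp_smul (f := φ), smul_smul, mul_inv_cancel₀ hn',
    one_smul]

theorem divergence_scaled (hn : n ≠ 0) :
    divergence (fun x => (n : ℝ) • φ ((n : ℝ)⁻¹ • x)) = fun x => divergence φ ((n : ℝ)⁻¹ • x) := by
  ext x
  simp only [divergence, fderiv_scaled hn]

theorem laplacian_scaled (hn : n ≠ 0) (x : Space N) :
    Laplacian.laplacian (fun x => (n : ℝ) • φ ((n : ℝ)⁻¹ • x)) x =
      (n : ℝ)⁻¹ • Laplacian.laplacian φ ((n : ℝ)⁻¹ • x) := by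
  rw [laplacian_apply, laplacian_apply, Finset.smul_sum]
  have : fderiv ℝ (fun x => (n : ℝ) • φ ((n : ℝ)⁻¹ • x)) =
      fun x => fderiv ℝ φ ((n : ℝ)⁻¹ • x) := funext fun x => fderiv_scaled hn x
  rw [this, fderiv_comp_smul (f := fderiv ℝ φ)]
  simp

end Scaling

/-- The compactly supported potential equal to `‖x‖² / 2` near the origin. -/
def quadPotential (N : ℕ) (x : Space N) : ℝ := cutoff N x * (‖x‖ ^ 2 / 2)

theorem contDiff_half_norm_sq : ContDiff ℝ ∞ fun x : Space N => ‖x‖ ^ 2 / 2 :=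
  (contDiff_norm_sq ℝ).div_const 2

theorem gradient_half_norm_sq (x : Space N) : gradient (fun x : Space N => ‖x‖ ^ 2 / 2) x = x := by
  have h1 : HasFDerivAt (fun x : Space N => ‖x‖ ^ 2 / 2) (innerSL ℝ x) x := by
    have := (hasStrictFDerivAt_norm_sq x).hasFDerivAt.const_mul (1 / 2 : ℝ)
    refine (this.congr_fderiv ?_).congr_of_eventuallyEq (Eventually.of_forall fun y => ?_)
    · ext y; simp
    · simp; ring
  have h2 : HasGradientAt (fun x : Space N => ‖x‖ ^ 2 / 2) x x := by
    rw [hasGradientAt_iff_hasFDerivAt]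
    exact h1.congr_fderiv (by ext y; simp)
  exact h2.gradient

theorem isTest_quadPotential : IsTest (quadPotential N) :=
  ⟨(isTest_cutoff N).1.mul contDiff_half_norm_sq, (isTest_cutoff N).2.mul_right⟩

/-- The compactly supported vector field equal to `x` near the origin. -/
def radialField (N : ℕ) : Space N → Space N := gradient (quadPotential N)

theorem isTest_radialField : IsTest (radialField N) := isTest_quadPotential.gradient

theorem radialField_eq {x : Space N} (hx : ‖x‖ < 1) : radialField N x = x := by
  have : quadPotential N =ᶠ[𝓝 x] fun x => ‖x‖ ^ 2 / 2 := by
    filter_upwards [cutoff_eventuallyEq_one hx] with y hy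
    rw [quadPotential, hy, one_mul]
  rw [radialField, gradient, this.fderiv_eq]
  exact gradient_half_norm_sq x

theorem radialField_eventuallyEq {x : Space N} (hx : ‖x‖ < 1) : radialField N =ᶠ[𝓝 x] id := by
  filter_upwards [(Metric.isOpen_ball (x := (0 : Space N)) (ε := 1)).mem_nhds
    (by simpa using hx)]
    with y hy
  exact radialField_eq (mem_ball_zero_iff.1 hy)

theorem fderiv_radialField {x : Space N} (hx : ‖x‖ < 1) :
    fderiv ℝ (radialField N) x = ContinuousLinearMap.id ℝ (Space N) := by
  rw [(radialField_eventuallyEq hx).fderiv_eq, fderiv_id]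

theorem divergence_radialField {x : Space N} (hx : ‖x‖ < 1) : divergence (radialField N) x = N := by
  simp [divergence, fderiv_radialField hx]

/-- The field is linear near the origin, so its second derivatives vanish there. After dilation the
viscous terms see only the tail of the velocity. -/
theorem gradient_divergence_radialField {x : Space N} (hx : ‖x‖ < 1) :
    gradient (divergence (radialField N)) x = 0 := by
  have : divergence (radialField N) =ᶠ[𝓝 x] fun _ => (N : ℝ) := by
    filter_upwards [(Metric.isOpen_ball (x := (0 : Space N)) (ε := 1)).mem_nhds
      (by simpa using hx)]
    with y hy
    exact divergence_radialField (mem_ball_zero_iff.1 hy)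
  rw [gradient, this.fderiv_eq]
  simp

theorem laplacian_radialField {x : Space N} (hx : ‖x‖ < 1) :
    Laplacian.laplacian (radialField N) x = 0 := by
  have : fderiv ℝ (radialField N) =ᶠ[𝓝 x] fun _ => ContinuousLinearMap.id ℝ (Space N) := by
    filter_upwards [(Metric.isOpen_ball (x := (0 : Space N)) (ε := 1)).mem_nhds
      (by simpa using hx)]
    with y hy
    exact fderiv_radialField (mem_ball_zero_iff.1 hy)
  rw [laplacian_apply, this.fderiv_eq]
  simp

/-- Because the scaled field is still the gradient of a test function, its pairing with a
divergence-free force vanishes. -/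
theorem radialField_scaled_eq_gradient {n : ℕ} (hn : n ≠ 0) :
    (fun x => (n : ℝ) • radialField N ((n : ℝ)⁻¹ • x)) =
      gradient fun x => (n : ℝ) ^ 2 * quadPotential N ((n : ℝ)⁻¹ • x) := by
  have hn' : (n : ℝ) ≠ 0 := by exact_mod_cast hn
  ext1 x
  have hd : DifferentiableAt ℝ (fun x => quadPotential N ((n : ℝ)⁻¹ • x)) x :=
    (isTest_quadPotential.comp_inv_smul hn).1.differentiable (by norm_num) x
  rw [gradient_mul (f := fun _ => (n : ℝ) ^ 2) (differentiableAt_const _) hd, gradient_comp_smul]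
  simp [radialField, gradient, smul_smul, pow_two, hn']

/-- The linear bound on the field is scale-invariant: it gives `n ‖φ(x/n)‖ ≤ B ‖x‖` for all `n`, a
majorant that finite moments can integrate. -/
theorem exists_bound_radialField (N : ℕ) : ∃ B, 0 ≤ B ∧ (∀ x, ‖radialField N x‖ ≤ B * ‖x‖) ∧
    (∀ x, ‖fderiv ℝ (radialField N) x‖ ≤ B) ∧ (∀ x, |divergence (radialField N) x| ≤ B) := by
  have ht := isTest_radialField (N := N)
  obtain ⟨B1, h1⟩ := ht.1.continuous.bounded_above_of_compact_support ht.2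
  obtain ⟨B2, h2⟩ := (ht.1.continuous_fderiv (by norm_num)).bounded_above_of_compact_support
    (ht.2.fderiv ℝ)
  obtain ⟨B3, h3⟩ := ht.divergence.1.continuous.bounded_above_of_compact_support ht.divergence.2
  have p1 := (norm_nonneg _).trans (h1 0)
  have p2 := (norm_nonneg _).trans (h2 0)
  have p3 := (norm_nonneg _).trans (h3 0)
  refine ⟨1 + B1 + B2 + B3, by positivity, fun x => ?_, fun x => ?_, fun x => ?_⟩
  · by_cases hx : ‖x‖ < 1
    · rw [radialField_eq hx]
      exact le_mul_of_one_le_left (norm_nonneg _) (by linarith)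
    · have hx' := not_lt.1 hx
      refine (h1 x).trans ?_
      nlinarith
  · linarith [h2 x]
  · have := h3 x
    rw [Real.norm_eq_abs] at this
    linarith


/-! ### Vanishing of the viscous terms and the virial identity. -/

theorem holderTriple_conj (hN : 3 ≤ N) :
    ENNReal.HolderTriple N ((N : ℝ≥0∞) / (N - 1 : ℝ≥0∞)) 1 := ⟨by
  have h1 : (1 : ℝ≥0∞) ≤ N := by exact_mod_cast (by omega : 1 ≤ N)
  have h0 : (N : ℝ≥0∞) ≠ 0 := by exact_mod_cast (by omega : N ≠ 0)
  rw [ENNReal.inv_div (Or.inr (by simp)) (Or.inr h0), inv_one, ← one_div, ← ENNReal.add_div,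
    add_tsub_cancel_of_le h1]
  exact ENNReal.div_self h0 (by simp)⟩

theorem SpaceTimeMeasurable.aemeasurable_eLpNorm {F : Type*} [NormedAddCommGroup F]
    {g : ℝ → Space N → F} (h : SpaceTimeMeasurable g) {p : ℝ≥0∞} (hp0 : p ≠ 0) (hp : p ≠ ⊤) :
    AEMeasurable (fun t => eLpNorm (g t) p volume) (volume.restrict (Ioi 0)) := by
  simp only [eLpNorm_eq_lintegral_rpow_enorm_toReal hp0 hp]
  refine AEMeasurable.pow_const ?_ _
  exact (h.enorm.pow_const p.toReal).lintegral_prod_right'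

theorem MemLpLqLoc.lintegral_lt_top {F : Type*} [NormedAddCommGroup F] {p : ℝ≥0∞}
    {g : ℝ → Space N → F} (h : MemLpLqLoc 1 p g) (T : ℝ) :
    ∫⁻ t in Ioo 0 T, eLpNorm (g t) p volume < ⊤ := by
  rcases lt_or_ge 0 T with hT | hT
  · simpa [eLpNorm_one_eq_lintegral_enorm] using (h T hT).2
  · simp [Ioo_eq_empty (not_lt.2 hT)]

theorem MemLpLqLoc.timeLoc_toReal {F : Type*} [NormedAddCommGroup F] {p : ℝ≥0∞}
    (hp0 : p ≠ 0) (hp : p ≠ ⊤) {g : ℝ → Space N → F} (h : MemLpLqLoc 1 p g)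
    (hm : SpaceTimeMeasurable g) : TimeLoc fun t => (eLpNorm (g t) p volume).toReal := fun T =>
  integrable_toReal_of_lintegral_ne_top
    ((hm.aemeasurable_eLpNorm hp0 hp).mono_measure
      (Measure.restrict_mono Ioo_subset_Ioi_self le_rfl))
    (h.lintegral_lt_top T).ne

theorem MemLpLqLoc.ae_memLp {F : Type*} [NormedAddCommGroup F] {p : ℝ≥0∞}
    (hp0 : p ≠ 0) (hp : p ≠ ⊤) {g : ℝ → Space N → F} (h : MemLpLqLoc 1 p g)
    (hm : SpaceTimeMeasurable g) :
    ∀ᵐ t ∂(volume.restrict (Ioi (0 : ℝ))), MemLp (g t) p volume := by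
  have h1 : ∀ᵐ t ∂(volume.restrict (Ioi (0 : ℝ))), eLpNorm (g t) p volume < ⊤ :=
    ae_Ioi_of_forall_Ioo fun T => ae_lt_top'
      ((hm.aemeasurable_eLpNorm hp0 hp).mono_measure
        (Measure.restrict_mono Ioo_subset_Ioi_self le_rfl)) (h.lintegral_lt_top T).ne
  filter_upwards [h1, hm.ae] with t h1 h2 using ⟨h2, h1⟩

/-- The viscous terms tested with the scaled fields `n⁻¹ Θ(n⁻¹ x)` vanish in the limit. -/
theorem tendsto_viscous (hN : 3 ≤ N) {v : ℝ → Space N → Space N} (hm : SpaceTimeMeasurable v)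
    (hv : MemLpLqLoc 1 ((N : ℝ≥0∞) / (N - 1 : ℝ≥0∞)) v) {Θ : Space N → Space N}
    (hΘ : Continuous Θ) (hc : HasCompactSupport Θ) (h0 : ∀ x, ‖x‖ < 1 → Θ x = 0)
    {ξ : ℝ → ℝ} (hξ : Continuous ξ) (hξc : HasCompactSupport ξ) :
    Tendsto (fun n : ℕ => ∫ t in Ioi (0 : ℝ), ∫ x,
      inner ℝ (v t x) ((n : ℝ)⁻¹ • Θ ((n : ℝ)⁻¹ • x)) * ξ t) atTop (𝓝 0) := by
  have hN0 : N ≠ 0 := by omega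
  set p := (N : ℝ≥0∞) / (N - 1 : ℝ≥0∞) with hpdef
  have := holderTriple_conj hN
  rw [← hpdef] at this
  have hp0 : p ≠ 0 := by
    rw [hpdef]; exact ENNReal.div_ne_zero.2 ⟨by exact_mod_cast hN0, by simp⟩
  have hp : p ≠ ⊤ := by
    rw [hpdef]
    refine ENNReal.div_ne_top (by simp) ?_
    have h1 : (1 : ℝ≥0∞) < N := by exact_mod_cast (by omega : 1 < N)
    exact (tsub_pos_of_lt h1).ne'
  set w : ℕ → ℝ → Space N → ℝ := fun n t x =>
    inner ℝ (v t x) ((n : ℝ)⁻¹ • Θ ((n : ℝ)⁻¹ • x)) with hw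
  have hwm : ∀ n, SpaceTimeMeasurable (w n) := fun n => by
    have hc : Continuous fun x : Space N => (n : ℝ)⁻¹ • Θ ((n : ℝ)⁻¹ • x) := by fun_prop
    exact hm.inner (spaceTimeMeasurable_space hc)
  have hle : ∀ (n : ℕ) t, eLpNorm (w n t) 1 volume ≤
      eLpNorm (fun x => ((n : ℝ)⁻¹ * ‖Θ ((n : ℝ)⁻¹ • x)‖) • v t x) 1 volume := by
    intro n t
    refine eLpNorm_mono fun x => ?_
    refine (abs_real_inner_le_norm _ _).trans (le_of_eq ?_)
    simp only [norm_smul, norm_mul, norm_norm]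
    ring
  have hnorm : ∀ n t, ‖∫ x, w n t x‖ₑ ≤ eLpNorm (w n t) 1 volume := fun n t => by
    rw [eLpNorm_one_eq_lintegral_enorm]; exact enorm_integral_le_lintegral_enorm _
  have hΘn : eLpNorm (fun x => ‖Θ x‖) N volume ≠ ⊤ :=
    (hΘ.norm.memLp_of_hasCompactSupport hc.norm).2.ne
  -- At almost every time the velocity is in `L^{N/(N-1)}`, dual to the critical `L^N`, so the
  -- pairing is bounded by a tail that tends to zero. The full norm of `v t` then serves as majorant
  -- in time.
  have hptw : ∀ᵐ t ∂(volume.restrict (Ioi (0 : ℝ))),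
      Tendsto (fun n => ∫ x, w n t x) atTop (𝓝 0) := by
    filter_upwards [hv.ae_memLp hp0 hp hm] with t ht
    rw [tendsto_iff_enorm_sub_tendsto_zero]
    simp only [sub_zero]
    exact tendsto_of_tendsto_of_tendsto_of_le_of_le tendsto_const_nhds
      (tendsto_eLpNorm_scaled_smul (r := 1) hN0 hp0 hp ht hΘ.norm hc.norm
        fun x hx => by simp [h0 x hx])
      (fun _ => zero_le) fun n => (hnorm n t).trans (hle n t)
  have hbound := ((hv.timeLoc_toReal hp0 hp hm).mul_compact hξ.norm hξc.norm).const_mul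
    (eLpNorm (fun x => ‖Θ x‖) N volume).toReal
  simp only [integral_mul_const]
  have := tendsto_integral_filter_of_dominated_convergence (l := atTop)
    (F := fun n t => (∫ x, w n t x) * ξ t) (f := fun _ => 0) (μ := volume.restrict (Ioi 0)) _
    (Eventually.of_forall fun n => (hwm n).integral.mul hξ.aestronglyMeasurable) ?_ hbound
    (by
      filter_upwards [hptw] with t ht
      simpa using ht.mul_const (ξ t))
  · simpa using this
  · filter_upwards [eventually_ne_atTop 0] with n hn
    filter_upwards [hv.ae_memLp hp0 hp hm] with t ht
    rw [norm_mul, ← mul_assoc]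
    gcongr
    rw [← toReal_enorm, ← ENNReal.toReal_mul]
    refine ENNReal.toReal_mono (ENNReal.mul_ne_top hΘn ht.2.ne) ?_
    refine ((hnorm n t).trans (hle n t)).trans
      ((eLpNorm_scaled_smul_le (r := 1) (p := p) hN0 ht.1 hΘ.norm (fun x hx => by simp [h0 x hx])
        hn).trans ?_)
    gcongr
    exact eLpNorm_indicator_le _

theorem isTest_scaled {φ : Space N → Space N} (hφ : IsTest φ) {n : ℕ} (hn : n ≠ 0) :
    IsTest fun x => (n : ℝ) • φ ((n : ℝ)⁻¹ • x) := by
  have h := hφ.comp_inv_smul hn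
  exact ⟨h.1.const_smul (n : ℝ), h.2.comp_left (g := fun y => (n : ℝ) • y) (smul_zero _)⟩

/-- The virial identity: `d/dt ∫ ρ v · x = ∫ (ρ |v|² + N p)`. -/
theorem virial_identity (hN : 3 ≤ N) {a γ μ lam : ℝ} {f : ℝ → Space N → Space N}
    (hf : DivergenceFree f) {ρ₀ : Space N → ℝ} {v₀ : Space N → Space N} {ρ : ℝ → Space N → ℝ}
    {v : ℝ → Space N → Space N} (hm : FiniteMoments γ ρ v)
    (hmom : MomentumEquation a γ μ lam f ρ₀ v₀ ρ v)
    (hv : MemLpLqLoc 1 ((N : ℝ≥0∞) / (N - 1 : ℝ≥0∞)) v)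
    {ξ : ℝ → ℝ} (hξ : IsInteriorTimeTest ξ) :
    ∫ t in Ioi (0 : ℝ), (∫ x, ρ t x * inner ℝ (v t x) x) * deriv ξ t =
      - ∫ t in Ioi (0 : ℝ), ((∫ x, ρ t x * ‖v t x‖ ^ 2) + N * ∫ x, pressure a γ (ρ t x)) * ξ t := by
  have hφ := isTest_radialField (N := N)
  obtain ⟨B, hB, hB1, hB2, hB3⟩ := exists_bound_radialField N
  have hev : ∀ x : Space N, ∀ᶠ n : ℕ in atTop, n ≠ 0 ∧ ‖(n : ℝ)⁻¹ • x‖ < 1 := fun x => by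
    obtain ⟨m, hm⟩ := exists_nat_gt ‖x‖
    filter_upwards [eventually_ge_atTop m, eventually_ne_atTop 0] with n hn hn0
    exact ⟨hn0, norm_inv_smul_lt_one (hm.trans_le (by exact_mod_cast hn))⟩
  set φ : ℕ → Space N → Space N := fun n x => (n : ℝ) • radialField N ((n : ℝ)⁻¹ • x) with hφn
  have hφt : ∀ n ≠ 0, IsTest (φ n) := fun n hn => isTest_scaled hφ hn
  have hφc : ∀ n, Continuous (φ n) := fun n => by
    have := hφ.1.continuous
    fun_prop
  have hpr : SpaceTimeLoc fun t x => pressure a γ (ρ t x) := hm.internal.const_mul a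
  have hpm : SpaceTimeMeasurable fun t x => pressure a γ (ρ t x) :=
    ((hm.measurable_density.aemeasurable.pow_const γ).const_mul a).aestronglyMeasurable
  have heq : ∀ n ≠ 0,
      (∫ t in Ioi (0 : ℝ), ∫ x, ρ t x * inner ℝ (v t x) (φ n x) * deriv ξ t)
      + (∫ t in Ioi (0 : ℝ), ∫ x, ρ t x * inner ℝ (v t x)
          (fderiv ℝ (radialField N) ((n : ℝ)⁻¹ • x) (v t x)) * ξ t)
      = - (∫ t in Ioi (0 : ℝ), ∫ x, pressure a γ (ρ t x) *
          divergence (radialField N) ((n : ℝ)⁻¹ • x) * ξ t)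
      - μ * (∫ t in Ioi (0 : ℝ), ∫ x, inner ℝ (v t x)
          ((n : ℝ)⁻¹ • Laplacian.laplacian (radialField N) ((n : ℝ)⁻¹ • x)) * ξ t)
      - (μ + lam) * (∫ t in Ioi (0 : ℝ), ∫ x, inner ℝ (v t x)
          ((n : ℝ)⁻¹ • gradient (divergence (radialField N)) ((n : ℝ)⁻¹ • x)) * ξ t) := by
    intro n hn
    have h1 := hmom (φ n) (hφt n hn) ξ hξ.isTimeTest
    -- The force drops out at each finite `n`, so no integrability of `f` at infinity is needed.
    have h2 : ∫ t in Ioi (0 : ℝ), ∫ x, inner ℝ (f t x) (φ n x) * ξ t = 0 := by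
      rw [hφn]
      simp only
      have := hf (fun x => (n : ℝ) ^ 2 * quadPotential N ((n : ℝ)⁻¹ • x))
        ⟨contDiff_const.mul (isTest_quadPotential.comp_inv_smul hn).1,
          (isTest_quadPotential.comp_inv_smul hn).2.mul_left⟩ ξ hξ
      rw [← radialField_scaled_eq_gradient hn] at this
      exact this
    rw [hξ.eq_zero le_rfl, h2] at h1
    simp only [hφn, fderiv_scaled hn, laplacian_scaled hn, divergence_scaled hn,
      gradient_comp_smul (divergence (radialField N)), zero_mul, zero_add, sub_zero] at h1 ⊢
    exact h1
  have lim1 := tendsto_integral_space_time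
    (F := fun n t x => ρ t x * inner ℝ (v t x) (φ n x))
    (f := fun t x => ρ t x * inner ℝ (v t x) x) (ξ := deriv ξ)
    (hm.majorant.const_mul B) (fun n => spaceTimeMeasurable_flux hm (hφc n))
    (by
      filter_upwards [eventually_ne_atTop 0] with n hn t x
      refine flux_le ?_ hB
      have hn' : (0 : ℝ) < n := by positivity
      rw [norm_smul, Real.norm_natCast]
      calc (n : ℝ) * ‖radialField N ((n : ℝ)⁻¹ • x)‖ ≤ n * (B * ‖(n : ℝ)⁻¹ • x‖) := by
            gcongr; exact hB1 _
        _ = B * ‖x‖ := by rw [norm_smul, norm_inv, Real.norm_natCast]; field_simp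
        _ ≤ B * (1 + ‖x‖) := by gcongr; linarith)
    (fun t x => by
      apply tendsto_const_nhds.congr'
      filter_upwards [hev x] with n hn
      have hn' : (n : ℝ) ≠ 0 := by exact_mod_cast hn.1
      simp only [hφn, radialField_eq hn.2, smul_smul, mul_inv_cancel₀ hn', one_smul])
    hξ.deriv_continuous hξ.1.2.deriv
  have lim2 := tendsto_integral_space_time
    (F := fun n t x => ρ t x * inner ℝ (v t x)
      (fderiv ℝ (radialField N) ((n : ℝ)⁻¹ • x) (v t x)))
    (f := fun t x => ρ t x * ‖v t x‖ ^ 2) (ξ := ξ)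
    (hm.kinetic.norm.const_mul B)
    (fun n => by
      have hc : Continuous fun q : Space N × Space N =>
          fderiv ℝ (radialField N) ((n : ℝ)⁻¹ • q.1) q.2 := by
        have := hφ.1.continuous_fderiv (by norm_num)
        fun_prop
      have h2 : AEStronglyMeasurable (fun z : ℝ × Space N =>
          fderiv ℝ (radialField N) ((n : ℝ)⁻¹ • z.2) (v z.1 z.2)) (slab N (Ioi 0)) :=
        hc.comp_aestronglyMeasurable
          (continuous_snd.aestronglyMeasurable.prodMk hm.measurable_velocity)
      exact hm.measurable_density.mul (hm.measurable_velocity.inner h2))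
    (Eventually.of_forall fun n t x => by
      rw [abs_mul, norm_mul, Real.norm_eq_abs, norm_pow, norm_norm]
      have h1 : |inner ℝ (v t x) (fderiv ℝ (radialField N) ((n : ℝ)⁻¹ • x) (v t x))| ≤
          ‖v t x‖ * (B * ‖v t x‖) := by
        refine (abs_real_inner_le_norm _ _).trans ?_
        gcongr
        exact (ContinuousLinearMap.le_opNorm _ _).trans (by gcongr; exact hB2 _)
      calc _ ≤ |ρ t x| * (‖v t x‖ * (B * ‖v t x‖)) := by gcongr
        _ = _ := by ring)
    (fun t x => by
      apply tendsto_const_nhds.congr'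
      filter_upwards [hev x] with n hn
      rw [fderiv_radialField hn.2, ContinuousLinearMap.id_apply, real_inner_self_eq_norm_sq])
    hξ.1.1.continuous hξ.1.2
  have lim3 := tendsto_integral_space_time
    (F := fun n t x => pressure a γ (ρ t x) * divergence (radialField N) ((n : ℝ)⁻¹ • x))
    (f := fun t x => pressure a γ (ρ t x) * N) (ξ := ξ)
    (hpr.norm.const_mul B)
    (fun n => by
      have hc : Continuous fun x => divergence (radialField N) ((n : ℝ)⁻¹ • x) := by
        have := hφ.divergence.1.continuous
        fun_prop
      exact hpm.mul (spaceTimeMeasurable_space hc))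
    (Eventually.of_forall fun n t x => by
      rw [abs_mul, mul_comm, Real.norm_eq_abs]
      gcongr
      exact hB3 _)
    (fun t x => by
      apply tendsto_const_nhds.congr'
      filter_upwards [hev x] with n hn
      rw [divergence_radialField hn.2])
    hξ.1.1.continuous hξ.1.2
  have lim4 := tendsto_viscous hN hm.measurable_velocity hv hφ.laplacian.1 hφ.laplacian.2
    (fun x hx => laplacian_radialField hx) hξ.1.1.continuous hξ.1.2
  have lim5 := tendsto_viscous hN hm.measurable_velocity hv hφ.divergence.gradient.1.continuous
    hφ.divergence.gradient.2
    (fun x hx => gradient_divergence_radialField hx) hξ.1.1.continuous hξ.1.2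
  have hlim := tendsto_nhds_unique (lim1.add lim2)
    (((lim3.neg.sub (lim4.const_mul μ)).sub (lim5.const_mul (μ + lam))).congr' (by
      filter_upwards [eventually_ne_atTop 0] with n hn
      exact (heq n hn).symm))
  simp only [mul_zero, sub_zero, integral_mul_const] at hlim
  have iK := hm.kinetic.timeLoc.mul_test hξ
  have iP := hpr.timeLoc.mul_test hξ
  have e : ∫ t in Ioi (0 : ℝ), ((∫ x, ρ t x * ‖v t x‖ ^ 2) + N * ∫ x, pressure a γ (ρ t x)) * ξ t =
      (∫ t in Ioi (0 : ℝ), (∫ x, ρ t x * ‖v t x‖ ^ 2) * ξ t) +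
      ∫ t in Ioi (0 : ℝ), (∫ x, pressure a γ (ρ t x)) * N * ξ t := by
    have iP' : IntegrableOn (fun t => (∫ x, pressure a γ (ρ t x)) * N * ξ t) (Ioi 0) := by
      refine (iP.const_mul (N : ℝ)).congr (Eventually.of_forall fun t => ?_)
      simp only
      ring
    rw [← integral_add iK iP']
    congr 1 with t
    ring
  rw [e]
  linarith


/-! ### Estimates at a fixed time. -/

/-- The smooth weight `⟨x⟩ = (1 + ‖x‖²)^(1/2)`. -/
def bracket (x : Space N) : ℝ := Real.sqrt (1 + ‖x‖ ^ 2)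

theorem bracket_pos (x : Space N) : 0 < bracket x := Real.sqrt_pos.2 (by positivity)

theorem bracket_sq (x : Space N) : bracket x ^ 2 = 1 + ‖x‖ ^ 2 := Real.sq_sqrt (by positivity)

theorem norm_le_bracket (x : Space N) : ‖x‖ ≤ bracket x :=
  Real.le_sqrt_of_sq_le (by linarith)

theorem one_le_bracket (x : Space N) : 1 ≤ bracket x :=
  Real.le_sqrt_of_sq_le (by nlinarith [sq_nonneg ‖x‖])

theorem bracket_le (x : Space N) : bracket x ≤ 1 + ‖x‖ := by
  rw [bracket, Real.sqrt_le_left (by positivity)]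
  nlinarith [norm_nonneg x]

theorem contDiff_bracket : ContDiff ℝ ∞ (bracket (N := N)) :=
  (contDiff_const.add (contDiff_norm_sq ℝ)).sqrt fun x => by positivity

theorem gradient_bracket (x : Space N) : gradient bracket x = (bracket x)⁻¹ • x := by
  have h0 : HasFDerivAt (fun y : Space N => 1 + ‖y‖ ^ 2) _ x :=
    (hasStrictFDerivAt_norm_sq x).hasFDerivAt.const_add 1
  have h1 := h0.sqrt (by positivity)
  have h2 : HasGradientAt (bracket (N := N)) ((bracket x)⁻¹ • x) x := by
    rw [hasGradientAt_iff_hasFDerivAt]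
    refine h1.congr_fderiv ?_
    ext y
    simp only [FunLike.coe_smul, Pi.smul_apply, smul_eq_mul, map_smul,
      InnerProductSpace.toDual_apply_apply, nsmul_eq_mul, bracket]
    field_simp
    simp
  exact h2.gradient

theorem norm_gradient_bracket_le (x : Space N) : ‖gradient bracket x‖ ≤ 1 := by
  rw [gradient_bracket, norm_smul, norm_inv, Real.norm_of_nonneg (bracket_pos x).le,
    inv_mul_le_iff₀ (bracket_pos x), mul_one]
  exact norm_le_bracket x

/-- The time slices for which all moments are finite. -/
structure FiniteSlice (γ : ℝ) (r : Space N → ℝ) (u : Space N → Space N) : Prop where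
  measurable_density : AEStronglyMeasurable r volume
  measurable_velocity : AEStronglyMeasurable u volume
  nonneg : ∀ᵐ x, 0 ≤ r x
  mass : Integrable r
  inertia : Integrable fun x => r x * ‖x‖ ^ 2
  kinetic : Integrable fun x => r x * ‖u x‖ ^ 2
  internal : Integrable fun x => r x ^ γ

theorem FiniteMoments.ae_finiteSlice {γ : ℝ} {ρ : ℝ → Space N → ℝ} {v : ℝ → Space N → Space N}
    (h : FiniteMoments γ ρ v) :
    ∀ᵐ t ∂(volume.restrict (Ioi (0 : ℝ))), FiniteSlice γ (ρ t) (v t) := by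
  filter_upwards [h.measurable_density.ae, h.measurable_velocity.ae, h.nonneg,
    h.mass.ae_integrable, h.inertia.ae_integrable, h.kinetic.ae_integrable,
    h.internal.ae_integrable] with t h1 h2 h3 h4 h5 h6 h7
  exact ⟨h1, h2, h3, h4, h5, h6, h7⟩

namespace FiniteSlice
variable {γ : ℝ} {r : Space N → ℝ} {u : Space N → Space N}

theorem integrable_flux (h : FiniteSlice γ r u) {g : Space N → Space N} (hg : Continuous g)
    {C : ℝ} (hb : ∀ x, ‖g x‖ ≤ C * (1 + ‖x‖)) : Integrable fun x => r x * inner ℝ (u x) (g x) := by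
  have hC : 0 ≤ C := by
    have := (norm_nonneg _).trans (hb 0); simpa using this
  refine (((h.mass.norm.add h.inertia.norm).add h.kinetic.norm).const_mul C).mono'
    (h.measurable_density.mul (h.measurable_velocity.inner hg.aestronglyMeasurable))
    (Eventually.of_forall fun x => ?_)
  refine (flux_le (hb x) hC).trans (le_of_eq ?_)
  simp only [Pi.add_apply, norm_mul, Real.norm_eq_abs, norm_pow, abs_norm]
  ring

theorem integrable_momentum (h : FiniteSlice γ r u) :
    Integrable fun x => r x * inner ℝ (u x) x :=
  h.integrable_flux continuous_id (C := 1) fun x => by simp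

theorem integrable_deviation (h : FiniteSlice γ r u) (t : ℝ) :
    Integrable fun x => r x * ‖x - t • u x‖ ^ 2 := by
  have := (h.inertia.sub (h.integrable_momentum.const_mul (2 * t))).add
    (h.kinetic.const_mul (t ^ 2))
  refine this.congr (Eventually.of_forall fun x => ?_)
  simp only [Pi.add_apply, Pi.sub_apply]
  rw [norm_sub_sq_real, inner_smul_right, norm_smul, mul_pow, Real.norm_eq_abs, sq_abs,
    real_inner_comm]
  ring

theorem integral_deviation (h : FiniteSlice γ r u) (t : ℝ) :
    ∫ x, r x * ‖x - t • u x‖ ^ 2 = (∫ x, r x * ‖x‖ ^ 2) - 2 * t * (∫ x, r x * inner ℝ (u x) x) +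
      t ^ 2 * ∫ x, r x * ‖u x‖ ^ 2 := by
  have i1 : Integrable fun x => r x * ‖x‖ ^ 2 - 2 * t * (r x * inner ℝ (u x) x) :=
    h.inertia.sub (h.integrable_momentum.const_mul (2 * t))
  rw [← integral_const_mul, ← integral_const_mul,
    ← integral_sub h.inertia (h.integrable_momentum.const_mul (2 * t)),
    ← integral_add i1 (h.kinetic.const_mul (t ^ 2))]
  congr 1 with x
  rw [norm_sub_sq_real, inner_smul_right, norm_smul, mul_pow, Real.norm_eq_abs, sq_abs,
    real_inner_comm]
  ring

theorem integral_deviation_nonneg (h : FiniteSlice γ r u) (t : ℝ) :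
    0 ≤ ∫ x, r x * ‖x - t • u x‖ ^ 2 := by
  refine integral_nonneg_of_ae ?_
  filter_upwards [h.nonneg] with x hx
  exact mul_nonneg hx (sq_nonneg _)

theorem integral_rpow_nonneg (h : FiniteSlice γ r u) : 0 ≤ ∫ x, r x ^ γ := by
  refine integral_nonneg_of_ae ?_
  filter_upwards [h.nonneg] with x hx using Real.rpow_nonneg hx _

theorem integrable_bracket (h : FiniteSlice γ r u) : Integrable fun x => r x * bracket x := by
  refine (((h.mass.norm.const_mul 2).add h.inertia.norm)).mono'
    (h.measurable_density.mul contDiff_bracket.continuous.aestronglyMeasurable)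
    (Eventually.of_forall fun x => ?_)
  simp only [Pi.add_apply, norm_mul, Real.norm_eq_abs, norm_pow, abs_norm,
    abs_of_pos (bracket_pos x)]
  have : bracket x ≤ 2 + ‖x‖ ^ 2 :=
    (bracket_le x).trans (by nlinarith [sq_nonneg (‖x‖ - 1), sq_nonneg ‖x‖])
  nlinarith [abs_nonneg (r x)]

/-- This replaces Cauchy–Schwarz in the integrals below; the free parameter is later taken as a
power of `t` that balances the two terms. -/
theorem le_young (d : ℝ) {ε : ℝ} (hε : 0 < ε) : d ≤ ε / 2 + d ^ 2 / (2 * ε) := by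
  have : ε / 2 + d ^ 2 / (2 * ε) - d = (ε - d) ^ 2 / (2 * ε) := by field_simp; ring
  have h2 : 0 ≤ (ε - d) ^ 2 / (2 * ε) := by positivity
  linarith

/-- The weight is homogeneous of degree one up to a bounded error: `⟨x⟩ - x·∇⟨x⟩ = ⟨x⟩⁻¹ ≤ 1`. The
rest is `(x - tu)·∇⟨x⟩`, controlled by the deviation since `‖∇⟨x⟩‖ ≤ 1`. -/
theorem integral_bracket_sub_flux_le (h : FiniteSlice γ r u) (t : ℝ) {ε : ℝ} (hε : 0 < ε) :
    (∫ x, r x * bracket x) - t * ∫ x, r x * inner ℝ (u x) (gradient bracket x) ≤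
      (1 + ε / 2) * (∫ x, r x) + (∫ x, r x * ‖x - t • u x‖ ^ 2) / (2 * ε) := by
  have hfl : Integrable fun x => r x * inner ℝ (u x) (gradient bracket x) :=
    h.integrable_flux (continuous_gradient contDiff_bracket) (C := 1) fun x => by
      linarith [norm_gradient_bracket_le x, norm_nonneg x]
  rw [← integral_const_mul, ← integral_sub h.integrable_bracket (hfl.const_mul t),
    ← integral_const_mul, ← integral_div, ← integral_add (h.mass.const_mul _)
      ((h.integrable_deviation t).div_const _)]
  refine integral_mono_ae (h.integrable_bracket.sub (hfl.const_mul t))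
    ((h.mass.const_mul _).add ((h.integrable_deviation t).div_const _)) ?_
  filter_upwards [h.nonneg] with x hx
  have hb := bracket_pos x
  have e1 : bracket x - t * inner ℝ (u x) (gradient bracket x) =
      (bracket x)⁻¹ + inner ℝ (x - t • u x) (gradient bracket x) := by
    rw [inner_sub_left, real_inner_smul_left, gradient_bracket, inner_smul_right, inner_smul_right,
      real_inner_self_eq_norm_sq]
    have := bracket_sq x
    field_simp
    linarith
  have e2 : inner ℝ (x - t • u x) (gradient bracket x) ≤ ‖x - t • u x‖ :=
    (real_inner_le_norm _ _).trans
      (mul_le_of_le_one_right (norm_nonneg _) (norm_gradient_bracket_le x))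
  have e3 : (bracket x)⁻¹ ≤ 1 := inv_le_one_of_one_le₀ (one_le_bracket x)
  have e4 := le_young ‖x - t • u x‖ hε
  have e5 : bracket x - t * inner ℝ (u x) (gradient bracket x) ≤
      1 + ε / 2 + ‖x - t • u x‖ ^ 2 / (2 * ε) := by linarith
  calc r x * bracket x - t * (r x * inner ℝ (u x) (gradient bracket x))
      = r x * (bracket x - t * inner ℝ (u x) (gradient bracket x)) := by ring
    _ ≤ r x * (1 + ε / 2 + ‖x - t • u x‖ ^ 2 / (2 * ε)) := by gcongr
    _ = _ := by ring

/-- A density with small internal energy spreads: its first moment is large. -/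
theorem mass_le (h : FiniteSlice γ r u) (hγ : 1 < γ) {A R : ℝ} (hA : 0 < A) (hR : 0 < R) :
    ∫ x, r x ≤ A * volume.real (Metric.ball (0 : Space N) R) + A ^ (1 - γ) * (∫ x, r x ^ γ) +
      (∫ x, r x * bracket x) / R := by
  have iB : Integrable ((Metric.ball (0 : Space N) R).indicator fun _ => A) :=
    (integrable_indicator_iff Metric.isOpen_ball.measurableSet).2
      (integrableOn_const measure_ball_lt_top.ne)
  have eB : ∫ x, (Metric.ball (0 : Space N) R).indicator (fun _ => A) x =
      A * volume.real (Metric.ball (0 : Space N) R) := by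
    rw [integral_indicator Metric.isOpen_ball.measurableSet, setIntegral_const,
      smul_eq_mul, mul_comm]
  have iI := h.internal.const_mul (A ^ (1 - γ))
  have iS : Integrable fun x =>
      (Metric.ball (0 : Space N) R).indicator (fun _ => A) x + A ^ (1 - γ) * r x ^ γ := iB.add iI
  rw [← eB, ← integral_const_mul, ← integral_div, ← integral_add iB iI,
    ← integral_add iS (h.integrable_bracket.div_const _)]
  refine integral_mono_ae h.mass (iS.add (h.integrable_bracket.div_const _)) ?_
  filter_upwards [h.nonneg] with x hx
  have p1 : 0 ≤ A ^ (1 - γ) * r x ^ γ :=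
    mul_nonneg (Real.rpow_nonneg hA.le _) (Real.rpow_nonneg hx _)
  have p2 : 0 ≤ r x * bracket x / R := div_nonneg (mul_nonneg hx (bracket_pos x).le) hR.le
  -- Three regimes, one per term: in the ball with density at most `A`; in the ball with larger
  -- density, where `r ≤ A^(1-γ) r^γ`; and outside the ball, where `⟨x⟩ ≥ R`.
  by_cases hxR : ‖x‖ < R
  · rw [indicator_of_mem (by simpa using hxR)]
    have : r x ≤ A + A ^ (1 - γ) * r x ^ γ := by
      rcases le_or_gt (r x) A with h1 | h1
      · linarith
      · have hr : 0 < r x := hA.trans h1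
        have h2 : r x ^ (1 - γ) ≤ A ^ (1 - γ) :=
          Real.rpow_le_rpow_of_nonpos hA h1.le (by linarith)
        have h3 : r x = r x ^ (1 - γ) * r x ^ γ := by
          rw [← Real.rpow_add hr]; simp
        have h4 : r x ^ (1 - γ) * r x ^ γ ≤ A ^ (1 - γ) * r x ^ γ := by gcongr
        linarith
    linarith
  · rw [indicator_of_notMem (by simpa using hxR)]
    have : r x ≤ r x * bracket x / R := by
      rw [le_div_iff₀ hR]
      exact mul_le_mul_of_nonneg_left ((not_lt.1 hxR).trans (norm_le_bracket x)) hx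
    linarith

/-- The part of the density at most `1`. -/
def lowPart (r : Space N → ℝ) (x : Space N) : ℝ := if r x ≤ 1 then r x else 0

theorem aestronglyMeasurable_lowPart (h : FiniteSlice γ r u) :
    AEStronglyMeasurable (lowPart r) volume := by
  have hm : Measurable fun s : ℝ => if s ≤ 1 then s else 0 :=
    Measurable.ite measurableSet_Iic measurable_id measurable_const
  exact (hm.comp_aemeasurable h.measurable_density.aemeasurable).aestronglyMeasurable

theorem integrable_lowPart (h : FiniteSlice γ r u) : Integrable fun x => lowPart r x * ‖u x‖ := by
  refine (h.mass.norm.add h.kinetic.norm).mono'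
    (h.aestronglyMeasurable_lowPart.mul h.measurable_velocity.norm)
    (Eventually.of_forall fun x => ?_)
  simp only [Pi.add_apply, norm_mul, norm_norm, norm_pow]
  have h1 : ‖lowPart r x‖ ≤ ‖r x‖ := by
    unfold lowPart; split_ifs <;> simp
  have h2 : ‖u x‖ ≤ 1 + ‖u x‖ ^ 2 := by nlinarith [sq_nonneg (‖u x‖ - 1), sq_nonneg ‖u x‖]
  calc ‖lowPart r x‖ * ‖u x‖ ≤ ‖r x‖ * (1 + ‖u x‖ ^ 2) := by gcongr
    _ = _ := by ring

/-- Where the density is at most `1`, `‖x‖ ≤ ‖x - tu‖ + t‖u‖`. Where it exceeds `1`, `r ≤ r^γ` lets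
internal energy and inertia bound `r‖x‖`. The split keeps only the low density beside `‖u‖`, because
Hölder needs an `L^s` bound with `s` possibly above `1`, and mass alone provides one only for
bounded density. -/
theorem integral_bracket_le (h : FiniteSlice γ r u) (hγ : 1 < γ) {t ε β : ℝ} (ht : 0 ≤ t)
    (hε : 0 < ε) (hβ : 0 < β) :
    ∫ x, r x * bracket x ≤ (1 + ε / 2) * (∫ x, r x) + (∫ x, r x * ‖x - t • u x‖ ^ 2) / (2 * ε) +
      t * (∫ x, lowPart r x * ‖u x‖) +
      (β / 2 * (∫ x, r x ^ γ) + (∫ x, r x * ‖x‖ ^ 2) / (2 * β)) := by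
  have i1 : Integrable fun x => (1 + ε / 2) * r x + r x * ‖x - t • u x‖ ^ 2 / (2 * ε) :=
    (h.mass.const_mul _).add ((h.integrable_deviation t).div_const _)
  have i2 : Integrable fun x => (1 + ε / 2) * r x + r x * ‖x - t • u x‖ ^ 2 / (2 * ε) +
      t * (lowPart r x * ‖u x‖) := i1.add (h.integrable_lowPart.const_mul t)
  have i3 : Integrable fun x => β / 2 * r x ^ γ + r x * ‖x‖ ^ 2 / (2 * β) :=
    (h.internal.const_mul _).add (h.inertia.div_const _)
  rw [← integral_const_mul, ← integral_const_mul, ← integral_const_mul, ← integral_div,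
    ← integral_div, ← integral_add (h.mass.const_mul _) ((h.integrable_deviation t).div_const _),
    ← integral_add (h.internal.const_mul _) (h.inertia.div_const _),
    ← integral_add i1 (h.integrable_lowPart.const_mul t), ← integral_add i2 i3]
  refine integral_mono_ae h.integrable_bracket (i2.add i3) ?_
  filter_upwards [h.nonneg] with x hx
  have q1 := mul_le_mul_of_nonneg_left (bracket_le x) hx
  have p1 : 0 ≤ r x * ‖x - t • u x‖ ^ 2 / (2 * ε) := by positivity
  have p2 : 0 ≤ r x ^ γ := Real.rpow_nonneg hx _
  have p3 : 0 ≤ r x * ‖x‖ ^ 2 / (2 * β) := by positivity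
  have p4 : 0 ≤ ε / 2 * r x := by positivity
  by_cases h1 : r x ≤ 1
  · have hl : lowPart r x = r x := if_pos h1
    have h2 : ‖x‖ ≤ ‖x - t • u x‖ + t * ‖u x‖ := by
      have := norm_add_le (x - t • u x) (t • u x)
      rwa [sub_add_cancel, norm_smul, Real.norm_of_nonneg ht] at this
    have h3 : ‖x‖ ≤ ε / 2 + ‖x - t • u x‖ ^ 2 / (2 * ε) + t * ‖u x‖ := by
      linarith [le_young ‖x - t • u x‖ hε]
    have h4 := mul_le_mul_of_nonneg_left h3 hx
    have h5 : 0 ≤ β / 2 * r x ^ γ := by positivity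
    rw [hl]
    have e : r x * (ε / 2 + ‖x - t • u x‖ ^ 2 / (2 * ε) + t * ‖u x‖) =
      ε / 2 * r x + r x * ‖x - t • u x‖ ^ 2 / (2 * ε) + t * (r x * ‖u x‖) := by ring
    linarith
  · have hl : lowPart r x = 0 := if_neg h1
    have h1' : 1 ≤ r x := (not_le.1 h1).le
    have h2 : r x ≤ r x ^ γ := by
      have := Real.rpow_le_rpow_of_exponent_le h1' hγ.le
      rwa [Real.rpow_one] at this
    have h3 := mul_le_mul_of_nonneg_left (le_young ‖x‖ hβ) hx
    have h4 : β / 2 * r x ≤ β / 2 * r x ^ γ := by gcongr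
    rw [hl]
    have e : r x * (β / 2 + ‖x‖ ^ 2 / (2 * β)) = β / 2 * r x + r x * ‖x‖ ^ 2 / (2 * β) := by ring
    linarith

/-- The momentum carried by the low-density part is controlled by `‖u‖_p`. -/
theorem integral_lowPart_le (h : FiniteSlice γ r u) {s p : ℝ≥0∞} [ENNReal.HolderTriple s p 1]
    (hs1 : 1 ≤ s) (hs : s ≠ ⊤) (hu : MemLp u p volume) :
    ∫ x, lowPart r x * ‖u x‖ ≤
      (ENNReal.ofReal (∫ x, r x) ^ (1 / s.toReal)).toReal * (eLpNorm u p volume).toReal := by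
  have hs0 : s ≠ 0 := (zero_lt_one.trans_le hs1).ne'
  have hs1' : 1 ≤ s.toReal := by
    rw [← ENNReal.toReal_one]; exact ENNReal.toReal_mono hs hs1
  -- Since the low part takes values in `[0, 1]` and `s ≥ 1`, its `s`-th power is at most the
  -- density itself.
  have hlow : eLpNorm (lowPart r) s volume ≤ ENNReal.ofReal (∫ x, r x) ^ (1 / s.toReal) := by
    rw [eLpNorm_eq_lintegral_rpow_enorm_toReal hs0 hs]
    gcongr
    rw [ofReal_integral_eq_lintegral_ofReal h.mass h.nonneg]
    refine lintegral_mono_ae ?_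
    filter_upwards [h.nonneg] with x hx
    unfold lowPart
    split_ifs with h1
    · rw [Real.enorm_eq_ofReal hx]
      refine (ENNReal.rpow_le_rpow_of_exponent_ge ?_ hs1').trans (by rw [ENNReal.rpow_one])
      exact ENNReal.ofReal_le_one.2 h1
    · rw [enorm_zero, ENNReal.zero_rpow_of_pos (by linarith)]
      exact zero_le
  have hfin : ENNReal.ofReal (∫ x, r x) ^ (1 / s.toReal) ≠ ⊤ :=
    ENNReal.rpow_ne_top_of_nonneg (by positivity) ENNReal.ofReal_ne_top
  have hH := eLpNorm_smul_le_mul_eLpNorm (r := 1) hu.1 h.aestronglyMeasurable_lowPart (p := s)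
    (q := p)
  have hle : ∫ x, lowPart r x * ‖u x‖ ≤ (eLpNorm (lowPart r • u) 1 volume).toReal := by
    rw [eLpNorm_one_eq_lintegral_enorm, ← integral_norm_eq_lintegral_enorm
      (h.aestronglyMeasurable_lowPart.smul hu.1)]
    refine integral_mono h.integrable_lowPart ?_ fun x => ?_
    · refine h.integrable_lowPart.norm.congr (Eventually.of_forall fun x => ?_)
      simp [norm_smul]
    · simp only [Pi.smul_apply', norm_smul]
      gcongr
      exact le_abs_self _
  rw [← ENNReal.toReal_mul]
  refine hle.trans (ENNReal.toReal_mono (ENNReal.mul_ne_top hfin hu.2.ne) (hH.trans ?_))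
  gcongr

end FiniteSlice


/-! ### Conservation of mass, energy and dissipation. -/

/-- Weak monotonicity applies to both `m` and `-m`. Two times are then compared through a third,
later than both. -/
theorem exists_ae_eq_const_of_weak_deriv_eq_zero {m : ℝ → ℝ} (im : TimeLoc m)
    (h : ∀ ξ, IsInteriorTimeTest ξ → ∫ t in Ioi (0 : ℝ), m t * deriv ξ t = 0) :
    ∃ c, ∀ᵐ t ∂(volume.restrict (Ioi (0 : ℝ))), m t = c := by
  have h1 := ae_le_of_weak_antitone le_rfl im fun ζ hζ _ _ => (h ζ hζ).ge
  have h2 := ae_le_of_weak_antitone (h := fun t => -m t) le_rfl (fun T => (im T).neg)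
    fun ζ hζ _ _ => by simp [neg_mul, integral_neg, h ζ hζ]
  have h3 := h1.and h2
  obtain ⟨s, -, hs⟩ := exists_mem_Ioi_of_ae h3
  refine ⟨m s, ?_⟩
  filter_upwards [h3] with t ht
  obtain ⟨r, -, hr⟩ := exists_mem_Ioi_of_ae
    (((ae_restrict_Ioi_mono (le_max_left s t) (hs.1.and hs.2)).and
      (ae_restrict_Ioi_mono (le_max_right s t) (ht.1.and ht.2))))
  linarith [hr.1.1, hr.1.2, hr.2.1, hr.2.2]

theorem exists_mass_eq {γ : ℝ} {ρ₀ : Space N → ℝ} {ρ : ℝ → Space N → ℝ}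
    {v : ℝ → Space N → Space N} (hm : FiniteMoments γ ρ v) (hc : ContinuityEquation ρ₀ ρ v) :
    ∃ m, ∀ᵐ t ∂(volume.restrict (Ioi (0 : ℝ))), ∫ x, ρ t x = m := by
  refine exists_ae_eq_const_of_weak_deriv_eq_zero hm.mass.timeLoc fun ξ hξ => ?_
  have hg : ∀ x : Space N, gradient (fun _ : Space N => (1 : ℝ)) x = 0 := fun x => by
    simp [gradient]
  have := moment_identity hm hc (h := fun _ => 1) contDiff_const (C := 1)
    (fun x => by simp) (fun x => by rw [hg]; simp; positivity) hξ
  simpa [hg] using this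

/-- The mass of a solution starting from a nonzero density is positive. -/
theorem mass_pos {γ : ℝ} {ρ₀ : Space N → ℝ} {v₀ : Space N → Space N} {ρ : ℝ → Space N → ℝ}
    {v : ℝ → Space N → Space N} (hm : FiniteMoments γ ρ v) (hc : ContinuityEquation ρ₀ ρ v)
    (hdata : LocallyIntegrable ρ₀) (hpos : 0 < ∫ x, ρ₀ x * inner ℝ (v₀ x) x) {m : ℝ}
    (hmass : ∀ᵐ t ∂(volume.restrict (Ioi (0 : ℝ))), ∫ x, ρ t x = m) : 0 < m := by
  obtain ⟨s, -, hs⟩ := exists_mem_Ioi_of_ae (hmass.and hm.nonneg)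
  have hm0 : 0 ≤ m := hs.1 ▸ integral_nonneg_of_ae hs.2
  refine hm0.lt_of_ne fun h0 => hpos.ne' ?_
  have hzero : ∀ᵐ t ∂(volume.restrict (Ioi (0 : ℝ))), ρ t =ᵐ[volume] 0 := by
    filter_upwards [hmass, hm.nonneg, hm.mass.ae_integrable] with t h1 h2 h3
    exact (integral_eq_zero_iff_of_nonneg_ae h2 h3).1 (h1.trans h0.symm)
  have hρ₀ : ∀ᵐ x, ρ₀ x = 0 := by
    refine ae_eq_zero_of_integral_contDiff_smul_eq_zero hdata fun ψ hψ hψc => ?_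
    -- A time test equal to `1` at `0` retains the initial datum. If the mass were zero, the other
    -- two terms of the continuity equation would vanish, leaving `∫ ρ₀ ψ = 0` for every `ψ`.
    let ξ : ContDiffBump (0 : ℝ) := ⟨1, 2, one_pos, one_lt_two⟩
    have h1 := hc ψ ⟨hψ, hψc⟩ ξ ⟨ξ.contDiff, ξ.hasCompactSupport⟩
    have e1 : ∫ t in Ioi (0 : ℝ), ∫ x, ρ t x * ψ x * deriv ξ t = 0 :=
      integral_eq_zero_of_ae (hzero.mono fun t ht => integral_eq_zero_of_ae <| by
        filter_upwards [ht] with x hx; simp [hx])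
    have e2 : ∫ t in Ioi (0 : ℝ), ∫ x, ρ t x * inner ℝ (v t x) (gradient ψ x) * ξ t = 0 :=
      integral_eq_zero_of_ae (hzero.mono fun t ht => integral_eq_zero_of_ae <| by
        filter_upwards [ht] with x hx; simp [hx])
    rw [e1, e2, ξ.one_of_mem_closedBall (by simp [ξ]), one_mul, add_zero, add_zero] at h1
    simpa [mul_comm] using h1
  refine integral_eq_zero_of_ae ?_
  filter_upwards [hρ₀] with x hx
  simp [hx]

theorem FiniteSlice.energy_eq {γ : ℝ} {r : Space N → ℝ} {u : Space N → Space N}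
    (h : FiniteSlice γ r u) (a : ℝ) :
    energy a γ r u = (∫ x, r x * ‖u x‖ ^ 2) / 2 + a * (∫ x, r x ^ γ) / (γ - 1) := by
  have i1 : Integrable fun x => a * r x ^ γ := h.internal.const_mul a
  rw [← integral_const_mul, ← integral_div, ← integral_div,
    ← integral_add (h.kinetic.div_const 2) (i1.div_const _)]
  unfold energy pressure
  congr 1 with x
  ring

theorem FiniteMoments.timeLoc_energy {γ : ℝ} {ρ : ℝ → Space N → ℝ} {v : ℝ → Space N → Space N}
    (h : FiniteMoments γ ρ v) (a : ℝ) : TimeLoc fun t => energy a γ (ρ t) (v t) := by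
  have := (h.kinetic.const_mul (1 / 2)).add (h.internal.const_mul (a / (γ - 1)))
  refine SpaceTimeLoc.timeLoc fun T => (this T).congr (Eventually.of_forall fun z => ?_)
  simp only [pressure]
  ring

/-- A crude constant is enough: it serves only to make the divergence term integrable. -/
theorem sq_trace_le (A : Grad N) : (∑ i, A (i, i)) ^ 2 ≤ N ^ 2 * ‖A‖ ^ 2 := by
  have h1 : |∑ i, A (i, i)| ≤ N * ‖A‖ := by
    refine (Finset.abs_sum_le_sum_abs _ _).trans ?_
    refine (Finset.sum_le_sum fun i _ => PiLp.norm_apply_le A (i, i)).trans ?_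
    simp
  calc (∑ i, A (i, i)) ^ 2 = |∑ i, A (i, i)| ^ 2 := (sq_abs _).symm
    _ ≤ (N * ‖A‖) ^ 2 := by gcongr
    _ = _ := by ring

theorem MemLpLqLoc.dissipation {G : ℝ → Space N → Grad N} (h : MemLpLqLoc 2 2 G) (μ lam : ℝ) :
    SpaceTimeLoc fun t x => μ * ‖G t x‖ ^ 2 + (μ + lam) * (∑ i, G t x (i, i)) ^ 2 := by
  refine (h.spaceTimeLoc_sq.const_mul μ).add (SpaceTimeLoc.const_mul ?_ (μ + lam))
  refine spaceTimeLoc_of_pos fun T hT => ?_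
  have hm := (h T hT).1
  refine ((h.spaceTimeLoc_sq T).const_mul ((N : ℝ) ^ 2)).mono' ?_
    (Eventually.of_forall fun z => ?_)
  · refine AEStronglyMeasurable.pow ?_ 2
    have hc : Continuous fun A : Grad N => ∑ i : Fin N, A (i, i) := by fun_prop
    exact hc.comp_aestronglyMeasurable hm
  · rw [Real.norm_of_nonneg (sq_nonneg _)]
    exact sq_trace_le _

theorem MemLpLqLoc.ae_le_dissipation {G : ℝ → Space N → Grad N} (h : MemLpLqLoc 2 2 G) {μ lam : ℝ}
    (hl : 0 < μ + lam) : ∀ᵐ t ∂(volume.restrict (Ioi (0 : ℝ))),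
      μ * ∫ x, ‖G t x‖ ^ 2 ≤ CompressibleNS.dissipation μ lam (G t) := by
  filter_upwards [h.spaceTimeLoc_sq.ae_integrable, (h.dissipation μ lam).ae_integrable]
    with t h1 h2
  rw [← integral_const_mul]
  refine integral_mono (h1.const_mul μ) h2 fun x => ?_
  simp only [le_add_iff_nonneg_right]
  positivity

/-- The momentum of the low-density part is controlled by the Dirichlet norm. -/
theorem exists_integral_lowPart_le (hN : 3 ≤ N) (γ m : ℝ) : ∃ C > 0, ∀ (r : Space N → ℝ)
    (u : Space N → Space N) (G : Space N → Grad N), FiniteSlice γ r u → ∫ x, r x = m →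
    MemLp u ((2 * N : ℝ≥0∞) / (N - 2 : ℝ≥0∞)) volume → HasWeakGradient u G →
    Integrable (fun x => ‖G x‖ ^ 2) →
    ∫ x, FiniteSlice.lowPart r x * ‖u x‖ ≤ C * Real.sqrt (∫ x, ‖G x‖ ^ 2) := by
  have hN' : (3 : ℝ) ≤ N := by exact_mod_cast hN
  have h2 : (0 : ℝ) < N - 2 := by linarith
  have hp : (2 * N : ℝ≥0∞) / (N - 2 : ℝ≥0∞) = ((2 * N / (N - 2) : ℝ).toNNReal : ℝ≥0∞) := by
    change _ = ENNReal.ofReal _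
    rw [ENNReal.ofReal_div_of_pos h2, ENNReal.ofReal_mul zero_le_two,
      ENNReal.ofReal_sub _ zero_le_two, ENNReal.ofReal_natCast, ENNReal.ofReal_ofNat]
  have hpos : (0 : ℝ) < 2 * N / (N - 2) := div_pos (by linarith) h2
  have hs1 : (1 : ℝ) ≤ 2 * N / (N + 2) := by
    rw [le_div_iff₀ (by linarith)]; linarith
  -- The dual of the Sobolev exponent. It is at least `1`, as the low-density bound requires.
  have hH : ENNReal.HolderTriple (ENNReal.ofReal (2 * N / (N + 2)))
      ((2 * N / (N - 2) : ℝ).toNNReal : ℝ≥0∞) 1 := ⟨by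
    change _ + (ENNReal.ofReal _)⁻¹ = _
    rw [← ENNReal.ofReal_inv_of_pos (by linarith), ← ENNReal.ofReal_inv_of_pos hpos,
      ← ENNReal.ofReal_add (by positivity) (by positivity), inv_one, ← ENNReal.ofReal_one]
    congr 1
    field_simp
    ring⟩
  obtain ⟨C, hC⟩ := HasWeakGradient.sobolev hN (p := (2 * N / (N - 2) : ℝ).toNNReal) (by
    rw [Real.coe_toNNReal _ hpos.le]; field_simp)
  set A : ℝ := (ENNReal.ofReal m ^ (1 / (ENNReal.ofReal (2 * N / (N + 2))).toReal)).toReal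
  have hA : 0 ≤ A := ENNReal.toReal_nonneg
  -- The extra `1` only secures strict positivity of the constant.
  refine ⟨A * C + 1, by positivity, fun r u G hr hm hu hG hGi => ?_⟩
  rw [hp] at hu
  have h3 := hr.integral_lowPart_le (s := ENNReal.ofReal (2 * N / (N + 2)))
    (ENNReal.one_le_ofReal.2 hs1) ENNReal.ofReal_ne_top hu
  rw [hm] at h3
  have hG2 : MemLp G 2 volume :=
    (memLp_two_iff_integrable_sq_norm hG.2.1.aestronglyMeasurable).2 hGi
  have e : (eLpNorm G 2 volume).toReal = Real.sqrt (∫ x, ‖G x‖ ^ 2) := by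
    rw [hG2.eLpNorm_eq_integral_rpow_norm (by norm_num) (by norm_num),
      ENNReal.toReal_ofReal (by positivity), Real.sqrt_eq_rpow]
    simp
  have h4 : (eLpNorm u ((2 * N / (N - 2) : ℝ).toNNReal : ℝ≥0∞) volume).toReal ≤
      C * Real.sqrt (∫ x, ‖G x‖ ^ 2) := by
    rw [← e, ← ENNReal.coe_toReal, ← ENNReal.toReal_mul]
    exact ENNReal.toReal_mono (ENNReal.mul_ne_top ENNReal.coe_ne_top hG2.2.ne) (hC u G hu hG)
  calc _ ≤ A * (C * Real.sqrt (∫ x, ‖G x‖ ^ 2)) := h3.trans (by gcongr)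
    _ ≤ _ := by nlinarith [Real.sqrt_nonneg (∫ x, ‖G x‖ ^ 2)]


/-! ### Virial decay, growth of the first moment and persistent dissipation. -/

theorem FiniteMoments.timeLoc_inertia {γ : ℝ} {ρ : ℝ → Space N → ℝ} {v : ℝ → Space N → Space N}
    (h : FiniteMoments γ ρ v) : TimeLoc fun t => ∫ x, ρ t x * (‖x‖ ^ 2 / 2) := by
  refine SpaceTimeLoc.timeLoc fun T => ((h.inertia.const_mul (1 / 2)) T).congr
    (Eventually.of_forall fun z => ?_)
  simp only
  ring

theorem FiniteMoments.timeLoc_momentum {γ : ℝ} {ρ : ℝ → Space N → ℝ} {v : ℝ → Space N → Space N}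
    (h : FiniteMoments γ ρ v) : TimeLoc fun t => ∫ x, ρ t x * inner ℝ (v t x) x :=
  (h.loc_flux continuous_id (C := 1) fun x => by simp).timeLoc

theorem inertia_identity {γ : ℝ} {ρ₀ : Space N → ℝ} {ρ : ℝ → Space N → ℝ}
    {v : ℝ → Space N → Space N} (hm : FiniteMoments γ ρ v) (hc : ContinuityEquation ρ₀ ρ v)
    {ξ : ℝ → ℝ} (hξ : IsInteriorTimeTest ξ) :
    ∫ t in Ioi (0 : ℝ), (∫ x, ρ t x * (‖x‖ ^ 2 / 2)) * deriv ξ t =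
      - ∫ t in Ioi (0 : ℝ), (∫ x, ρ t x * inner ℝ (v t x) x) * ξ t := by
  have := moment_identity hm hc contDiff_half_norm_sq (C := 1)
    (fun x => by rw [abs_of_nonneg (by positivity)]; nlinarith [sq_nonneg ‖x‖])
    (fun x => by rw [gradient_half_norm_sq]; linarith) hξ
  simpa only [gradient_half_norm_sq] using this

theorem EnergyInequality.le {a γ μ lam : ℝ} {ρ : ℝ → Space N → ℝ} {v : ℝ → Space N → Space N}
    {G : ℝ → Space N → Grad N} (h : EnergyInequality a γ μ lam ρ v G) {ξ : ℝ → ℝ}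
    (hξ : IsInteriorTimeTest ξ) (h0 : ∀ t, 0 ≤ ξ t) :
    ∫ t in Ioi (0 : ℝ), dissipation μ lam (G t) * ξ t ≤
      ∫ t in Ioi (0 : ℝ), energy a γ (ρ t) (v t) * deriv ξ t := by
  linarith [h ξ hξ h0]

theorem FiniteSlice.energy_nonneg {a γ : ℝ} (ha : 0 < a) (hγ : 1 < γ) {r : Space N → ℝ}
    {u : Space N → Space N} (h : FiniteSlice γ r u) : 0 ≤ energy a γ r u := by
  have h1 : 0 < γ - 1 := by linarith
  have h2 := h.integral_rpow_nonneg
  have h3 : 0 ≤ ∫ x, r x * ‖u x‖ ^ 2 := integral_nonneg_of_ae <| by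
    filter_upwards [h.nonneg] with x hx
    exact mul_nonneg hx (sq_nonneg _)
  rw [h.energy_eq]
  positivity

/-- `σ = min(2, N(γ - 1))`, the decay rate of the internal energy. -/
def decayRate (N : ℕ) (γ : ℝ) : ℝ := min 2 (N * (γ - 1))

/-- Decay of the deviation `∫ ρ|x - tv|²` and of the internal energy. -/
theorem exists_virial_decay {a γ : ℝ} (ha : 0 < a) (hγ : 1 < γ) {ρ : ℝ → Space N → ℝ}
    {v : ℝ → Space N → Space N} (hm : FiniteMoments γ ρ v)
    (hI : ∀ ξ, IsInteriorTimeTest ξ →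
      ∫ t in Ioi (0 : ℝ), (∫ x, ρ t x * (‖x‖ ^ 2 / 2)) * deriv ξ t =
        - ∫ t in Ioi (0 : ℝ), (∫ x, ρ t x * inner ℝ (v t x) x) * ξ t)
    (hJ : ∀ ξ, IsInteriorTimeTest ξ →
      ∫ t in Ioi (0 : ℝ), (∫ x, ρ t x * inner ℝ (v t x) x) * deriv ξ t =
        - ∫ t in Ioi (0 : ℝ),
          ((∫ x, ρ t x * ‖v t x‖ ^ 2) + N * ∫ x, pressure a γ (ρ t x)) * ξ t)
    (hE : ∀ ξ, IsInteriorTimeTest ξ → (∀ t, 0 ≤ ξ t) →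
      0 ≤ ∫ t in Ioi (0 : ℝ), energy a γ (ρ t) (v t) * deriv ξ t) :
    ∃ S ≥ 1, ∃ C ≥ 0, ∀ᵐ t ∂(volume.restrict (Ioi S)),
      ∫ x, ρ t x * ‖x - t • v t x‖ ^ 2 ≤ C * t ^ (2 - decayRate N γ) ∧
      ∫ x, ρ t x ^ γ ≤ C * t ^ (-decayRate N γ) ∧ ∫ x, ρ t x * ‖x‖ ^ 2 ≤ C * t ^ 2 := by
  set σ := decayRate N γ with hσ
  have hσ2 : σ ≤ 2 := min_le_left _ _
  have hσγ : σ ≤ N * (γ - 1) := min_le_right _ _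
  have hγ1 : 0 < γ - 1 := by linarith
  have hσ0 : 0 ≤ σ := le_min zero_le_two (by positivity)
  have iQ : TimeLoc fun t => (∫ x, ρ t x * ‖v t x‖ ^ 2) + N * ∫ x, pressure a γ (ρ t x) := fun T =>
    (hm.kinetic.timeLoc T).add (((hm.internal.const_mul a).timeLoc T).const_mul (N : ℝ))
  have hP : ∀ t, ∫ x, pressure a γ (ρ t x) = a * ∫ x, ρ t x ^ γ := fun t => integral_const_mul _ _
  have hX : ∀ t, ∫ x, ρ t x * (‖x‖ ^ 2 / 2) = (∫ x, ρ t x * ‖x‖ ^ 2) / 2 := fun t => by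
    rw [← integral_div]; congr 1 with x; ring
  -- Completing the square: the kinetic energy, inertia and momentum combine into half the
  -- deviation, so both remaining terms are nonnegative and can be bounded separately.
  have hvir : ∀ t, FiniteSlice γ (ρ t) (v t) →
      (∫ x, ρ t x * (‖x‖ ^ 2 / 2)) - t * (∫ x, ρ t x * inner ℝ (v t x) x) +
        t ^ 2 * energy a γ (ρ t) (v t) =
      (∫ x, ρ t x * ‖x - t • v t x‖ ^ 2) / 2 + t ^ 2 * (a * (∫ x, ρ t x ^ γ) / (γ - 1)) := by
    intro t hs
    rw [hs.energy_eq, hs.integral_deviation, hX]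
    ring
  obtain ⟨S, hS, C, hC⟩ := virial_growth hσ2 hm.timeLoc_inertia hm.timeLoc_momentum iQ
    (hm.timeLoc_energy a) hI hJ hE (by
      filter_upwards [hm.ae_finiteSlice] with t hs
      rw [hvir t hs, hs.energy_eq, hP]
      have hW := hs.integral_deviation_nonneg t
      have hB := hs.integral_rpow_nonneg
      set B := ∫ x, ρ t x ^ γ
      -- The kinetic parts cancel, leaving `2 - N(γ-1)` times the internal energy. Its coefficient
      -- is at most `2 - σ` by the choice of `σ`.
      have e : 2 * ((∫ x, ρ t x * ‖v t x‖ ^ 2) / 2 + a * B / (γ - 1)) -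
          ((∫ x, ρ t x * ‖v t x‖ ^ 2) + N * (a * B)) =
          (2 - N * (γ - 1)) * (a * B / (γ - 1)) := by
        field_simp; ring
      have h1 : 0 ≤ a * B / (γ - 1) := by positivity
      have h2 : (2 - N * (γ - 1)) * (a * B / (γ - 1)) ≤ (2 - σ) * (a * B / (γ - 1)) := by
        gcongr
      have h3 : 0 ≤ (2 - σ) * ((∫ x, ρ t x * ‖x - t • v t x‖ ^ 2) / 2) :=
        mul_nonneg (by linarith) (by positivity)
      rw [e]
      have h4 := mul_le_mul_of_nonneg_left h2 (sq_nonneg t)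
      linarith)
  obtain ⟨s, hs0, hs⟩ := exists_mem_Ioi_of_ae
    (ae_le_of_weak_antitone le_rfl (hm.timeLoc_energy a) fun ζ hζ _ h0 => hE ζ hζ h0)
  set E₀ := |energy a γ (ρ s) (v s)|
  set C' := |C|
  have hC' : 0 ≤ C' := abs_nonneg C
  refine ⟨max S s, hS.trans (le_max_left _ _), 4 * C' + C' * (γ - 1) / a + 4 * E₀,
    by positivity, ?_⟩
  filter_upwards [ae_restrict_Ioi_mono (le_max_left S s) hC,
    ae_restrict_Ioi_mono (le_max_right S s) hs,
    ae_restrict_Ioi_mono ((zero_le_one.trans hS).trans (le_max_left S s)) hm.ae_finiteSlice,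
    ae_restrict_mem measurableSet_Ioi] with t h1 h2 h3 h4
  have ht1 : 1 ≤ t := hS.trans ((le_max_left S s).trans (le_of_lt h4))
  have ht0 : 0 < t := by linarith
  rw [hvir t h3] at h1
  have hW := h3.integral_deviation_nonneg t
  -- Nonnegativity at time parameter `2t` is the integrated form of `‖x‖² ≤ 2‖x - tv‖² + 2t²‖v‖²`.
  -- With the monotone energy it bounds the inertia by a multiple of `t²`.
  have hW2 := h3.integral_deviation_nonneg (2 * t)
  have hB := h3.integral_rpow_nonneg
  rw [h3.energy_eq] at h2
  have hWe := h3.integral_deviation t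
  rw [h3.integral_deviation] at hW2
  set W := ∫ x, ρ t x * ‖x - t • v t x‖ ^ 2
  set B := ∫ x, ρ t x ^ γ
  set K := ∫ x, ρ t x * ‖v t x‖ ^ 2
  set X := ∫ x, ρ t x * ‖x‖ ^ 2
  have hB1 : 0 ≤ a * B / (γ - 1) := by positivity
  have hp0 : 0 < t ^ (2 - σ) := Real.rpow_pos_of_pos ht0 _
  have hCC : C * t ^ (2 - σ) ≤ C' * t ^ (2 - σ) := by gcongr; exact le_abs_self C
  have hpe : t ^ (2 - σ) = t ^ 2 * t ^ (-σ) := by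
    rw [sub_eq_add_neg, Real.rpow_add ht0]; norm_cast
  have hn0 : 0 < t ^ (-σ) := Real.rpow_pos_of_pos ht0 _
  have hn1 : t ^ (-σ) ≤ 1 := Real.rpow_le_one_of_one_le_of_nonpos ht1 (by linarith)
  have t2 : 0 < t ^ 2 := by positivity
  have hp1 : t ^ (2 - σ) ≤ t ^ 2 := by rw [hpe]; exact mul_le_of_le_one_right t2.le hn1
  have hWle : W ≤ 2 * C' * t ^ (2 - σ) := by
    have := mul_nonneg t2.le hB1
    linarith
  have hA0 : 0 ≤ C' * (γ - 1) / a := by positivity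
  have hE0 : 0 ≤ E₀ := abs_nonneg _
  refine ⟨hWle.trans (by gcongr; linarith), ?_, ?_⟩
  · have h5 : t ^ 2 * (a * B / (γ - 1)) ≤ t ^ 2 * (C' * t ^ (-σ)) := by
      have : t ^ 2 * (C' * t ^ (-σ)) = C' * t ^ (2 - σ) := by rw [hpe]; ring
      linarith
    have h6 := le_of_mul_le_mul_left h5 t2
    have h7 : B ≤ C' * (γ - 1) / a * t ^ (-σ) := by
      rw [div_le_iff₀ hγ1] at h6
      rw [div_mul_eq_mul_div, le_div_iff₀ ha]
      linarith
    exact h7.trans (by gcongr; linarith)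
  · have hK : K ≤ 2 * E₀ := by linarith [le_abs_self (energy a γ (ρ s) (v s))]
    have h5 : X ≤ 2 * W + 2 * t ^ 2 * K := by linarith
    have h6 : t ^ 2 * K ≤ t ^ 2 * (2 * E₀) := by gcongr
    have h7 : C' * t ^ (2 - σ) ≤ C' * t ^ 2 := by gcongr
    have h8 : 0 ≤ C' * (γ - 1) / a * t ^ 2 := by positivity
    linarith


theorem decayRate_pos (hN : 0 < N) {γ : ℝ} (hγ : 1 < γ) : 0 < decayRate N γ := by
  have h1 : 0 < γ - 1 := by linarith
  have h2 : (0 : ℝ) < N := by exact_mod_cast hN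
  exact lt_min two_pos (by positivity)

/-- When `σ = 2` the value is `-2`; when `σ = N(γ-1)` it is `-σ²/2`. The sign says that the internal
energy decays too fast for the mass to remain in a ball of radius `t^(1-σ/2)`. -/
theorem exponent_neg (hN : 0 < N) {γ : ℝ} (hγ : 1 < γ) :
    (1 - decayRate N γ / 2) * (N * (γ - 1)) - decayRate N γ < 0 := by
  have h0 := decayRate_pos hN hγ
  rcases min_choice 2 ((N : ℝ) * (γ - 1)) with h | h
  · rw [decayRate, h]; norm_num
  · have h1 : decayRate N γ = N * (γ - 1) := h
    rw [← h1]
    nlinarith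

theorem volume_real_ball_eq {R : ℝ} (hR : 0 < R) :
    volume.real (Metric.ball (0 : Space N) R) =
      R ^ N * volume.real (Metric.ball (0 : Space N) 1) := by
  rw [measureReal_def, Measure.addHaar_ball_of_pos _ _ hR, ENNReal.toReal_mul,
    ENNReal.toReal_ofReal (by positivity), finrank_euclideanSpace_fin, measureReal_def]

theorem volume_real_ball_one_pos : 0 < volume.real (Metric.ball (0 : Space N) 1) :=
  ENNReal.toReal_pos (Metric.measure_ball_pos _ _ one_pos).ne' measure_ball_lt_top.ne

/-- Mass conservation and decay of the internal energy force mass to large distances. -/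
theorem eventually_lt_first_moment (hN : 0 < N) {γ : ℝ} (hγ : 1 < γ) {m C B : ℝ} (hm : 0 < m)
    (hB : 0 < B) : ∀ᶠ t : ℝ in atTop, ∀ (r : Space N → ℝ) (u : Space N → Space N),
      FiniteSlice γ r u → ∫ x, r x = m → ∫ x, r x ^ γ ≤ C * t ^ (-decayRate N γ) →
      B * t ^ (1 - decayRate N γ / 2) < ∫ x, r x * bracket x := by
  set σ := decayRate N γ
  set w := volume.real (Metric.ball (0 : Space N) 1)
  have hw : 0 < w := volume_real_ball_one_pos
  -- The constants are fixed so that, if the claim fails, mass outside radius `L t^(1-σ/2)`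
  -- contributes at most `m/4` and density below `A₀ t^(-d)` inside contributes `m/4`. The remaining
  -- term is eventually below `m/2`.
  set L := 4 * B / m
  have hL : 0 < L := by positivity
  set A₀ := m / (4 * w * L ^ N)
  have hA₀ : 0 < A₀ := by positivity
  set e := (1 - σ / 2) * (N * (γ - 1)) - σ
  have he : e < 0 := exponent_neg hN hγ
  have hlim : Tendsto (fun t : ℝ => A₀ ^ (1 - γ) * C * t ^ e) atTop (𝓝 0) := by
    have := (tendsto_rpow_neg_atTop (neg_pos.2 he)).const_mul (A₀ ^ (1 - γ) * C)
    simpa using this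
  filter_upwards [hlim.eventually_lt_const (show 0 < m / 2 by positivity), eventually_gt_atTop 0]
    with t h1 ht r u hs hmass hint
  by_contra! hle
  set R := L * t ^ (1 - σ / 2)
  have htp : 0 < t ^ (1 - σ / 2) := Real.rpow_pos_of_pos ht _
  have hR : 0 < R := by positivity
  set d := (1 - σ / 2) * N
  have hRN : R ^ N = L ^ N * t ^ d := by
    rw [mul_pow, ← Real.rpow_natCast (t ^ (1 - σ / 2)), ← Real.rpow_mul ht.le]
  have htd : 0 < t ^ d := Real.rpow_pos_of_pos ht _
  have hA : 0 < A₀ * (t ^ d)⁻¹ := by positivity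
  have key := hs.mass_le hγ hA hR
  rw [hmass, volume_real_ball_eq hR, hRN] at key
  have e1 : A₀ * (t ^ d)⁻¹ * (L ^ N * t ^ d * w) = m / 4 := by
    simp only [A₀]; field_simp
  have e2 : (∫ x, r x * bracket x) / R ≤ m / 4 := by
    rw [div_le_iff₀ hR]
    refine hle.trans (le_of_eq ?_)
    simp only [R, L]; field_simp
  have e3 : (A₀ * (t ^ d)⁻¹) ^ (1 - γ) * (C * t ^ (-σ)) = A₀ ^ (1 - γ) * C * t ^ e := by
    rw [Real.mul_rpow hA₀.le (by positivity), ← Real.rpow_neg ht.le, ← Real.rpow_mul ht.le]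
    have : t ^ e = t ^ (-d * (1 - γ)) * t ^ (-σ) := by
      rw [← Real.rpow_add ht]
      congr 1
      simp only [e, d]; ring
    rw [this]; ring
  have e4 : (A₀ * (t ^ d)⁻¹) ^ (1 - γ) * (∫ x, r x ^ γ) ≤
      (A₀ * (t ^ d)⁻¹) ^ (1 - γ) * (C * t ^ (-σ)) := by
    gcongr
  linarith

theorem abs_bracket_le (x : Space N) : |bracket x| ≤ 2 * (1 + ‖x‖ ^ 2) := by
  rw [abs_of_pos (bracket_pos x)]
  exact (bracket_le x).trans (by nlinarith [sq_nonneg (‖x‖ - 1), sq_nonneg ‖x‖])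

theorem norm_gradient_bracket_le_two (x : Space N) : ‖gradient bracket x‖ ≤ 2 * (1 + ‖x‖) := by
  linarith [norm_gradient_bracket_le x, norm_nonneg x]

theorem rpow_one_sub_half {t σ : ℝ} (ht : 0 < t) :
    t ^ (2 - σ) = t ^ (1 - σ / 2) * t ^ (1 - σ / 2) := by
  rw [← Real.rpow_add ht]; ring_nf

/-- The first moment grows at least linearly. -/
theorem exists_first_moment_ge (hN : 0 < N) {γ : ℝ} (hγ : 1 < γ) {ρ₀ : Space N → ℝ}
    {ρ : ℝ → Space N → ℝ} {v : ℝ → Space N → Space N} (hm : FiniteMoments γ ρ v)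
    (hc : ContinuityEquation ρ₀ ρ v) {m : ℝ} (hm0 : 0 < m)
    (hmass : ∀ᵐ t ∂(volume.restrict (Ioi (0 : ℝ))), ∫ x, ρ t x = m) {S C : ℝ} (hS : 1 ≤ S)
    (hC : 0 ≤ C) (hW : ∀ᵐ t ∂(volume.restrict (Ioi S)),
      ∫ x, ρ t x * ‖x - t • v t x‖ ^ 2 ≤ C * t ^ (2 - decayRate N γ))
    (hB : ∀ᵐ t ∂(volume.restrict (Ioi S)), ∫ x, ρ t x ^ γ ≤ C * t ^ (-decayRate N γ)) :
    ∃ c > 0, ∃ S' ≥ S, ∀ᵐ t ∂(volume.restrict (Ioi S')), c * t ≤ ∫ x, ρ t x * bracket x := by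
  set σ := decayRate N γ
  have hσ : 0 < σ := decayRate_pos hN hγ
  have hσ2 : σ ≤ 2 := min_le_left _ _
  -- From the choice `ε = t^(1-σ/2) ≥ 1`: the mass term is at most `3/2 m ε`, and the deviation, at
  -- most `C ε²`, contributes `C/2 ε`.
  set C₂ := 3 / 2 * m + C / 2
  have hC₂ : 0 < C₂ := by positivity
  have hslice := ae_restrict_Ioi_mono (zero_le_one.trans hS) (hm.ae_finiteSlice.and hmass)
  have growth := first_moment_growth (q := σ / 2) (half_pos hσ) hC₂.le hS
    (hm.loc_density contDiff_bracket.continuous abs_bracket_le).timeLoc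
    (hm.loc_flux (continuous_gradient contDiff_bracket) norm_gradient_bracket_le_two).timeLoc
    (fun ξ hξ => moment_identity hm hc contDiff_bracket abs_bracket_le
      norm_gradient_bracket_le_two hξ) (by
      filter_upwards [hslice, hW, ae_restrict_mem measurableSet_Ioi] with t h1 h2 h3
      have ht1 : 1 ≤ t := hS.trans (le_of_lt h3)
      have ht : 0 < t := by linarith
      have hε : 0 < t ^ (1 - σ / 2) := Real.rpow_pos_of_pos ht _
      have hε1 : 1 ≤ t ^ (1 - σ / 2) := Real.one_le_rpow ht1 (by linarith)
      refine (h1.1.integral_bracket_sub_flux_le t hε).trans ?_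
      rw [h1.2]
      rw [rpow_one_sub_half ht] at h2
      have h4 : (∫ x, ρ t x * ‖x - t • v t x‖ ^ 2) / (2 * t ^ (1 - σ / 2)) ≤
          C / 2 * t ^ (1 - σ / 2) := by
        rw [div_le_iff₀ (by positivity)]
        linarith
      have h5 := mul_le_mul_of_nonneg_left hε1 hm0.le
      simp only [C₂]
      linarith)
  -- The threshold is exactly what `M/s` may lose after time `s`, so the slope obtained at `s`
  -- remains positive.
  have hlow := eventually_lt_first_moment hN hγ (C := C) hm0 (B := C₂ / (σ / 2)) (by positivity)
  obtain ⟨T, hT⟩ := eventually_atTop.1 hlow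
  obtain ⟨s, hsT, ⟨hs, hsm⟩, hsB, hsg⟩ := exists_mem_Ioi_of_ae
    (ae_restrict_Ioi_mono (le_max_left S T) (hslice.and (hB.and growth)))
  have hsS : S < s := (le_max_left S T).trans_lt hsT
  have hs0 : 0 < s := by linarith
  have hlt := hT s ((le_max_right S T).trans hsT.le) (ρ s) (v s) hs hsm hsB
  refine ⟨(∫ x, ρ s x * bracket x) / s - C₂ / (σ / 2) * s ^ (-(σ / 2)), ?_, s, hsS.le, ?_⟩
  · rw [gt_iff_lt, sub_pos, lt_div_iff₀ hs0]
    refine lt_of_eq_of_lt ?_ hlt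
    rw [sub_eq_add_neg, Real.rpow_add hs0, Real.rpow_one]
    ring
  · filter_upwards [hsg, ae_restrict_mem measurableSet_Ioi] with t h1 h2
    exact (le_div_iff₀ (hs0.trans h2)).1 h1

/-- If the low-density momentum is dominated by the dissipation, then the dissipation of a
spreading solution is bounded below for large times. -/
theorem exists_dissipation_ge (hN : 0 < N) {γ : ℝ} (hγ : 1 < γ) {ρ : ℝ → Space N → ℝ}
    {v : ℝ → Space N → Space N} (hm : FiniteMoments γ ρ v) {m : ℝ} (hm0 : 0 < m)
    (hmass : ∀ᵐ t ∂(volume.restrict (Ioi (0 : ℝ))), ∫ x, ρ t x = m) {S C : ℝ} (hS : 1 ≤ S)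
    (hdecay : ∀ᵐ t ∂(volume.restrict (Ioi S)),
      ∫ x, ρ t x * ‖x - t • v t x‖ ^ 2 ≤ C * t ^ (2 - decayRate N γ) ∧
      ∫ x, ρ t x ^ γ ≤ C * t ^ (-decayRate N γ) ∧ ∫ x, ρ t x * ‖x‖ ^ 2 ≤ C * t ^ 2) {c : ℝ}
    (hc : 0 < c) (hM : ∀ᵐ t ∂(volume.restrict (Ioi S)), c * t ≤ ∫ x, ρ t x * bracket x)
    {D : ℝ → ℝ} {A : ℝ} (hA : 0 < A) (hD : ∀ᵐ t ∂(volume.restrict (Ioi (0 : ℝ))),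
      ∫ x, FiniteSlice.lowPart (ρ t) x * ‖v t x‖ ≤ A * Real.sqrt (D t)) :
    ∃ δ > 0, ∃ S', ∀ᵐ t ∂(volume.restrict (Ioi S')), δ ≤ D t := by
  set σ := decayRate N γ
  have hσ : 0 < σ := decayRate_pos hN hγ
  have hσ2 : σ ≤ 2 := min_le_left _ _
  set C₃ := 3 / 2 * m + 3 / 2 * C
  have hlim : Tendsto (fun t : ℝ => C₃ * t ^ (-(σ / 2))) atTop (𝓝 0) := by
    simpa using (tendsto_rpow_neg_atTop (half_pos hσ)).const_mul C₃
  obtain ⟨T, hT⟩ := eventually_atTop.1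
    (hlim.eventually_lt_const (show 0 < c / 2 by positivity))
  -- Half of the growth `c t` absorbs the lower-order terms, leaving `c/2 ≤ A √D`.
  refine ⟨(c / (2 * A)) ^ 2, by positivity, max S T, ?_⟩
  filter_upwards [ae_restrict_Ioi_mono (le_max_left S T) (hdecay.and hM),
    ae_restrict_Ioi_mono ((zero_le_one.trans hS).trans (le_max_left S T))
      (hm.ae_finiteSlice.and (hmass.and hD)), ae_restrict_mem measurableSet_Ioi]
    with t ⟨⟨h1, h2, h3⟩, h4⟩ ⟨h5, h6, h7⟩ h8
  have ht1 : 1 ≤ t := hS.trans ((le_max_left S T).trans (le_of_lt h8))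
  have ht : 0 < t := by linarith
  have h9 := hT t ((le_max_right S T).trans (le_of_lt h8))
  set ε := t ^ (1 - σ / 2)
  -- With this choice `β t^(-σ)` and `t² / β` both equal `ε`, so every error term is of order
  -- `t^(1-σ/2)`.
  set β := t ^ (1 + σ / 2)
  have hε : 0 < ε := Real.rpow_pos_of_pos ht _
  have hβ : 0 < β := Real.rpow_pos_of_pos ht _
  have hε1 : 1 ≤ ε := Real.one_le_rpow ht1 (by linarith)
  have key := h4.trans (h5.integral_bracket_le hγ ht.le hε hβ)
  rw [h6] at key
  rw [rpow_one_sub_half ht] at h1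
  have e1 : (∫ x, ρ t x * ‖x - t • v t x‖ ^ 2) / (2 * ε) ≤ C / 2 * ε := by
    rw [div_le_iff₀ (by positivity)]
    linarith
  have hβσ : β * t ^ (-σ) = ε := by
    rw [← Real.rpow_add ht]; congr 1; ring
  have hβε : ε * β = t ^ 2 := by
    rw [← Real.rpow_add ht]; norm_num
  have e2 : β / 2 * (∫ x, ρ t x ^ γ) ≤ C / 2 * ε := by
    have := mul_le_mul_of_nonneg_left h2 hβ.le
    rw [← hβσ]
    linarith
  have e3 : (∫ x, ρ t x * ‖x‖ ^ 2) / (2 * β) ≤ C / 2 * ε := by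
    rw [div_le_iff₀ (by positivity)]
    rw [← hβε] at h3
    linarith
  have e4 := mul_le_mul_of_nonneg_left hε1 hm0.le
  have e5 : t * (∫ x, FiniteSlice.lowPart (ρ t) x * ‖v t x‖) ≤ t * (A * Real.sqrt (D t)) := by
    gcongr
  have e6 : C₃ * ε = t * (C₃ * t ^ (-(σ / 2))) := by
    simp only [ε]
    rw [sub_eq_add_neg, Real.rpow_add ht, Real.rpow_one]; ring
  have e7 : t * (C₃ * t ^ (-(σ / 2))) ≤ t * (c / 2) := by gcongr
  have e8 : t * (c / 2) ≤ t * (A * Real.sqrt (D t)) := by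
    have : C₃ * ε = 3 / 2 * (m * ε) + 3 / 2 * (C * ε) := by simp only [C₃]; ring
    linarith
  have e9 := le_of_mul_le_mul_left e8 ht
  have e10 : c / (2 * A) ≤ Real.sqrt (D t) := by
    rw [div_le_iff₀ (by positivity)]; linarith
  have hD0 : 0 < D t := Real.sqrt_pos.1 (lt_of_lt_of_le (by positivity) e10)
  exact (Real.le_sqrt (by positivity) hD0.le).1 e10

end CompressibleNS

end

/-! ### The contradiction. -/

theorem theorem1p1 (N : ℕ) (hN : 3 ≤ N) (a γ μ lam : ℝ) (ha : 0 < a)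
    (hγ : 1 < γ) (hγN : γ ≤ N / 4 + 1 / 2) (hμ : 0 < μ) (hμlam : 0 < μ + lam)
    (f : ℝ → CompressibleNS.Space N → CompressibleNS.Space N)
    (hf : LocallyIntegrableOn (fun z : ℝ × CompressibleNS.Space N => f z.1 z.2) (Ici 0 ×ˢ univ))
    (hdivf : CompressibleNS.DivergenceFree f)
    (ρ₀ : CompressibleNS.Space N → ℝ) (v₀ : CompressibleNS.Space N → CompressibleNS.Space N)
    (hdata : CompressibleNS.IsInitialData γ ρ₀ v₀)
    (hmom : Integrable (fun x => ρ₀ x * ‖v₀ x‖ * ‖x‖))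
    (hpos : 0 < ∫ x, ρ₀ x * inner ℝ (v₀ x) x) :
    ¬ ∃ (ρ : ℝ → CompressibleNS.Space N → ℝ)
        (v : ℝ → CompressibleNS.Space N → CompressibleNS.Space N),
      CompressibleNS.IsFiniteEnergyWeakSolution a γ μ lam f ρ₀ v₀ ρ v ∧
      CompressibleNS.MemLpLqLoc 1 1 (fun t x => ρ t x * ‖x‖ ^ 2) ∧
      CompressibleNS.MemLpLqLoc 1 ((N : ENNReal) / (N - 1 : ENNReal)) v := by
  open CompressibleNS in
  rintro ⟨ρ, v, hsol, hx, hv⟩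
  have hN0 : 0 < N := by omega
  have hm := hsol.finiteMoments hγ hx
  obtain ⟨G, ⟨-, hslice, hG⟩, henergy⟩ := hsol.viscous
  obtain ⟨m, hmass⟩ := exists_mass_eq hm hsol.continuity
  have hm0 := mass_pos hm hsol.continuity hdata.density hpos hmass
  have iD := (hG.dissipation μ lam).timeLoc
  have hDG := hG.ae_le_dissipation (μ := μ) hμlam
  have hD0 : ∀ᵐ t ∂(volume.restrict (Ioi (0 : ℝ))), 0 ≤ dissipation μ lam (G t) :=
    hDG.mono fun t ht => le_trans (mul_nonneg hμ.le (integral_nonneg fun x => sq_nonneg _)) ht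
  -- The virial argument needs only that the energy is nonincreasing; the dissipation itself is kept
  -- for the final contradiction.
  have hE : ∀ ξ, IsInteriorTimeTest ξ → (∀ t, 0 ≤ ξ t) →
      0 ≤ ∫ t in Ioi (0 : ℝ), energy a γ (ρ t) (v t) * deriv ξ t := fun ξ hξ h0 =>
    le_trans (integral_nonneg_of_ae (hD0.mono fun t ht => mul_nonneg ht (h0 t)))
      (henergy.le hξ h0)
  obtain ⟨K, hK⟩ := dissipation_bound (hm.timeLoc_energy a) iD
    (hm.ae_finiteSlice.mono fun t ht => ht.energy_nonneg ha hγ) hD0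
    fun ξ hξ h0 => henergy.le hξ h0
  obtain ⟨S, hS, C, hC, hdecay⟩ := exists_virial_decay ha hγ hm
    (fun ξ hξ => inertia_identity hm hsol.continuity hξ)
    (fun ξ hξ => virial_identity hN hdivf hm hsol.momentumEq hv hξ) hE
  obtain ⟨c, hc, S', hS', hM⟩ := exists_first_moment_ge hN0 hγ hm hsol.continuity hm0 hmass hS hC
    (hdecay.mono fun t ht => ht.1) (hdecay.mono fun t ht => ht.2.1)
  obtain ⟨A, hA, hlow⟩ := exists_integral_lowPart_le hN γ m
  obtain ⟨δ, hδ, T, hT⟩ := exists_dissipation_ge hN0 hγ hm hm0 hmass (hS.trans hS')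
    (ae_restrict_Ioi_mono hS' hdecay) hc hM hA (D := fun t => ∫ x, ‖G t x‖ ^ 2) (by
      filter_upwards [hm.ae_finiteSlice, hmass, hslice, hG.spaceTimeLoc_sq.ae_integrable]
        with t h1 h2 h3 h4
      exact hlow _ _ _ h1 h2 h3.1 h3.2 h4)
  -- The dissipation is at least `μ ‖∇v‖₂² ≥ μ δ` for all large times, so its time integral cannot
  -- stay bounded.
  refine not_ae_le_of_integral_bound iD hD0 hK (mul_pos hμ hδ) (max T 0) ?_
  filter_upwards [ae_restrict_Ioi_mono (le_max_left T 0) hT,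
    ae_restrict_Ioi_mono (le_max_right T 0) hDG] with t h1 h2
  exact (mul_le_mul_of_nonneg_left h1 hμ.le).trans h2
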